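/- Work over $\mathbb{C}$. For a finite set $X$, a root datum is a quadruple $v=(\mathfrak h,a,b,p)$, where $\mathfrak h$ is a finite-dimensional vector space, $a:X\to\mathfrak h$ and $b:X\to\mathfrak h^*$ have linearly independent images and $p:X\to\mathbb Z/2$; its Cartan datum is $(A,p)$ with $A=(\langle a(x),b(y)\rangle)_{x,y\in X}$. The contragredient Lie superalgebra $\mathfrak g(v)$ is the quotient of the Lie superalgebra generated by the (even, commutative) space $\mathfrak h$ and by elements $e_x,f_x$ of parity $p(x)$ $(x\in X)$, with relations $[e_x,f_y]=\delta_{xy}a(x)$, $[h,e_x]=\langle h,b(x)\rangle e_x$, $[h,f_x]=-\langle h,b(x)\rangle f_x$, by the maximal ideal having zero intersection with $\mathfrak h$. A Lie superalgebra admits the Cartan datum $(A,p)$ if it is isomorphic to $\mathfrak g(v)$ for a root datum $v$ with Cartan datum $(A,p)$ and $\dim\mathfrak h=|X|+\operatorname{corank}A$. Cartan data $(A,p)$ and $(A',p')$ are $D$-equivalent if $p=p'$ and $A=DA'$ for an invertible diagonal matrix $D$. Let $\mathfrak g=G(3)$, the contragredient Lie superalgebra (with $\dim\mathfrak h=3$)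 whose Cartan matrix is the Gram matrix of the simple roots $\alpha_1=\varepsilon_2$, $\alpha_2=\varepsilon_3-\delta_1$, $\alpha_3=\delta_1-\varepsilon_2$, where $\varepsilon_1+\varepsilon_2+\varepsilon_3=0$, $(\varepsilon_i,\varepsilon_i)=1$, $(\varepsilon_i,\varepsilon_j)=-\tfrac12$ for $i\ne j$, $(\varepsilon_i,\delta_1)=0$, $(\delta_1,\delta_1)=-1$; $\alpha_1$ is even and $\alpha_2,\alpha_3$ are odd. Let $\kappa(x,y)=\operatorname{str}(\operatorname{ad}x\operatorname{ad}y)$ be the Killing form of $\mathfrak g$. Let $$G(3)^{(1)}=\mathfrak g\otimes\mathbb C[t,t^{-1}]\oplus\mathbb CK\oplus\mathbb Cd,\quad [x t^m,y t^n]=[x,y]t^{m+n}+m\,\delta_{m+n,0}\,\kappa(x,y)K,\quad [d,xt^n]=n\,xt^n,$$ with $K$ central. Let $\sigma=\exp(\operatorname{ad}h)$ be the inner automorphism of order two of $\mathfrak g$ given by $h\in\mathfrak h$ with $\langle h,\alpha_1\rangle=\pi i$, $\langle h,\alpha_2\rangle=\langle h,\alpha_3\rangle=0$, and let $G(3)^{(2)}$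 be the corresponding twisted affinization, that is, the subalgebra of $G(3)^{(1)}$ spanned by $K$, $d$ and the elements $xt^j$ with $j\in\mathbb{Z}$, $x\in\mathfrak g$, $\sigma(x)=(-1)^jx$. Then the affine Lie superalgebras $G(3)^{(1)}$ and $G(3)^{(2)}$ are isomorphic. Moreover they admit $D$-equivalent Cartan data: $G(3)^{(1)}$ admits the Cartan datum $(A,p)$ and $G(3)^{(2)}$ admits the Cartan datum $(A',p)$, where $$A=\begin{pmatrix}0&-\frac32&-\frac12&\frac32\\-\frac32&3&0&0\\-\frac12&0&1&-1\\\frac32&0&-1&0\end{pmatrix},\qquad A'=\begin{pmatrix}0&-3&-1&3\\-3&6&0&0\\-1&0&2&-2\\3&0&-2&0\end{pmatrix}=2A,$$ and in both cases the first and the fourth simple roots are odd and the other two are even. -/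

import Mathlib

noncomputable section

/-! ### Lie superalgebras over `ℂ` -/

/-- The `i`-th homogeneous component (`i ∈ ℤ/2`) for a parity involution `P`: the even part is the
`(+1)`-eigenspace of `P` and the odd part is the `(-1)`-eigenspace. -/
def homog {L : Type*} [AddCommGroup L] [Module ℂ L] (P : L →ₗ[ℂ] L) (i : ZMod 2) :
    Submodule ℂ L :=
  Module.End.eigenspace P ((-1) ^ i.val)

/-- The sign `(-1)^{ij}` of the rule of signs. -/
def ksgn (i j : ZMod 2) : ℂ := (-1) ^ (i * j).val

/-- A Lie superalgebra over `ℂ`. The `ℤ/2`-grading is recorded by its parity involution `par`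
(`+1` on even elements, `-1` on odd elements); over `ℂ` an involution is the same thing as
a `ℤ/2`-grading. -/
class LieSuperalgebra (L : Type*) [AddCommGroup L] [Module ℂ L] where
  br : L →ₗ[ℂ] L →ₗ[ℂ] L
  par : L →ₗ[ℂ] L
  par_par : ∀ x, par (par x) = x
  par_br : ∀ x y, par (br x y) = br (par x) (par y)
  skew : ∀ (i j : ZMod 2) (x y : L), x ∈ homog par i → y ∈ homog par j →
    br x y = -(ksgn i j • br y x)
  jacobi : ∀ (i j k : ZMod 2) (x y z : L),
    x ∈ homog par i → y ∈ homog par j → z ∈ homog par k →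
    br x (br y z) = br (br x y) z + ksgn i j • br y (br x z)

namespace LieSuperalgebra

/-- Isomorphisms of Lie superalgebras (linear, even, and compatible with the brackets). -/
structure Iso (L L' : Type*) [AddCommGroup L] [Module ℂ L] [LieSuperalgebra L]
    [AddCommGroup L'] [Module ℂ L'] [LieSuperalgebra L'] where
  toEquiv : L ≃ₗ[ℂ] L'
  map_par : ∀ x, toEquiv (par x) = par (toEquiv x)
  map_br : ∀ x y, toEquiv (br x y) = br (toEquiv x) (toEquiv y)

section Quotient

variable (L : Type*) [AddCommGroup L] [Module ℂ L] [LieSuperalgebra L]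

/-- Graded ideals. -/
structure SuperIdeal where
  carrier : Submodule ℂ L
  par_mem : ∀ x ∈ carrier, par x ∈ carrier
  br_mem_left : ∀ x y, y ∈ carrier → br x y ∈ carrier
  br_mem_right : ∀ x y, x ∈ carrier → br x y ∈ carrier

/-- Graded subalgebras. -/
structure SuperSubalgebra where
  carrier : Submodule ℂ L
  par_mem : ∀ x ∈ carrier, par x ∈ carrier
  br_mem : ∀ x ∈ carrier, ∀ y ∈ carrier, br x y ∈ carrier

end Quotient

end LieSuperalgebra

open LieSuperalgebra

theorem mem_homog {L : Type*} [AddCommGroup L] [Module ℂ L] {P : L →ₗ[ℂ] L} {i : ZMod 2} {x : L} :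
    x ∈ homog P i ↔ P x = ((-1) ^ i.val : ℂ) • x :=
  Module.End.mem_eigenspace_iff

theorem val_cases (i : ZMod 2) : i = 0 ∨ i = 1 := by
  revert i; decide

/-- A homogeneous element of a quotient by an involution-stable subspace lifts to
a homogeneous element. -/
theorem homog_lift {L L' : Type*} [AddCommGroup L] [Module ℂ L] [AddCommGroup L'] [Module ℂ L']
    (P : L →ₗ[ℂ] L) (P' : L' →ₗ[ℂ] L') (hP : ∀ x, P (P x) = x) (q : L →ₗ[ℂ] L')
    (hq : Function.Surjective q) (hc : ∀ x, q (P x) = P' (q x)) (i : ZMod 2) (y : L')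
    (hy : y ∈ homog P' i) : ∃ x ∈ homog P i, q x = y := by
  obtain ⟨x, rfl⟩ := hq y
  rw [mem_homog] at hy
  refine ⟨(1 / 2 : ℂ) • (x + ((-1) ^ i.val : ℂ) • P x), ?_, ?_⟩
  · rw [mem_homog]
    simp only [map_smul, map_add, hP]
    rw [smul_comm]
    congr 1
    rw [smul_add, smul_smul, ← pow_add, ← two_mul, pow_mul]
    simp [add_comm]
  · simp only [map_smul, map_add, hc, hy]
    rw [smul_smul, ← pow_add, ← two_mul, pow_mul]
    simp only [even_two, Even.neg_pow, one_pow, one_smul]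
    rw [← two_smul ℂ (q x), smul_smul]
    norm_num

/-- The quotient Lie superalgebra of `L` by a graded ideal. -/
instance quotientLieSuperalgebra (L : Type*) [AddCommGroup L] [Module ℂ L] [LieSuperalgebra L]
    (I : SuperIdeal L) : LieSuperalgebra (L ⧸ I.carrier) where
  br := I.carrier.liftQ
    { toFun := fun x => I.carrier.mapQ I.carrier (br x) (fun y hy => I.br_mem_left x y hy)
      map_add' := fun x x' => by
        apply Submodule.linearMap_qext; ext y; simp
      map_smul' := fun c x => by
        apply Submodule.linearMap_qext; ext y; simp }
    (fun x hx => by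
      rw [LinearMap.mem_ker]
      apply Submodule.linearMap_qext; ext y
      simpa using I.br_mem_right x y hx)
  par := I.carrier.mapQ I.carrier par (fun x hx => I.par_mem x hx)
  par_par := by
    intro x
    obtain ⟨x, rfl⟩ := I.carrier.mkQ_surjective x
    simp [par_par]
  par_br := by
    intro x y
    obtain ⟨x, rfl⟩ := I.carrier.mkQ_surjective x
    obtain ⟨y, rfl⟩ := I.carrier.mkQ_surjective y
    simp [par_br]
  skew := by
    intro i j x y hx0 hy0
    obtain ⟨x, hx, rfl⟩ := homog_lift par _ par_par _ I.carrier.mkQ_surjective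
      (by intro x; simp) i x hx0
    obtain ⟨y, hy, rfl⟩ := homog_lift par _ par_par _ I.carrier.mkQ_surjective
      (by intro x; simp) j y hy0
    simp [skew i j x y hx hy]
  jacobi := by
    intro i j k x y z hx0 hy0 hz0
    obtain ⟨x, hx, rfl⟩ := homog_lift par _ par_par _ I.carrier.mkQ_surjective
      (by intro x; simp) i x hx0
    obtain ⟨y, hy, rfl⟩ := homog_lift par _ par_par _ I.carrier.mkQ_surjective
      (by intro x; simp) j y hy0
    obtain ⟨z, hz, rfl⟩ := homog_lift par _ par_par _ I.carrier.mkQ_surjective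
      (by intro x; simp) k z hz0
    simp [jacobi i j k x y z hx hy hz]

/-- A graded subalgebra is a Lie superalgebra. -/
instance subalgebraLieSuperalgebra (L : Type*) [AddCommGroup L] [Module ℂ L] [LieSuperalgebra L]
    (S : SuperSubalgebra L) : LieSuperalgebra S.carrier where
  br := LinearMap.mk₂ ℂ (fun x y => ⟨br x.1 y.1, S.br_mem _ x.2 _ y.2⟩)
    (by intros; ext; simp) (by intros; ext; simp) (by intros; ext; simp) (by intros; ext; simp)
  par := par.restrict S.par_mem
  par_par := by intro x; ext; simp [par_par]
  par_br := by intro x y; ext; simp [par_br]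
  skew := by
    intro i j x y hx hy
    rw [mem_homog] at hx hy
    ext
    simpa using skew i j x.1 y.1 (mem_homog.2 (by simpa using congrArg Subtype.val hx))
      (mem_homog.2 (by simpa using congrArg Subtype.val hy))
  jacobi := by
    intro i j k x y z hx hy hz
    rw [mem_homog] at hx hy hz
    ext
    simpa using jacobi i j k x.1 y.1 z.1 (mem_homog.2 (by simpa using congrArg Subtype.val hx))
      (mem_homog.2 (by simpa using congrArg Subtype.val hy))
      (mem_homog.2 (by simpa using congrArg Subtype.val hz))

/-! ### Root data and contragredient Lie superalgebras -/

/-- A root datum `(𝔥, a, b, p)` of the finite set `X`. -/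
structure SuperRootDatum (X : Type*) (H : Type*) [AddCommGroup H] [Module ℂ H] where
  finite : FiniteDimensional ℂ H
  a : X → H
  b : X → Module.Dual ℂ H
  p : X → ZMod 2
  a_indep : LinearIndependent ℂ a
  b_indep : LinearIndependent ℂ b

/-- The Cartan matrix `a_{x,y} = ⟨a(x), b(y)⟩`. -/
def SuperRootDatum.cartan {X H : Type*} [AddCommGroup H] [Module ℂ H] (v : SuperRootDatum X H) :
    Matrix X X ℂ :=
  Matrix.of fun x y => v.b y (v.a x)

/-- Two Cartan data `(A, p)` and `(A', p')` are `D`-equivalent if `p = p'` and `A = D A'` for an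
invertible diagonal matrix `D`. -/
def DEquivalent {X : Type*} [Fintype X] [DecidableEq X] (A : Matrix X X ℂ) (p : X → ZMod 2)
    (A' : Matrix X X ℂ) (p' : X → ZMod 2) : Prop :=
  p = p' ∧ ∃ d : X → ℂ, (∀ x, d x ≠ 0) ∧ A = Matrix.diagonal d * A'

/-- Generators of the half-baked superalgebra: the elements of `𝔥`, and `e_{b(x)}`, `e_{-b(x)}`. -/
inductive Gen (X H : Type*)
  | h : H → Gen X H
  | e : X → Gen X H
  | f : X → Gen X H

/-- The free nonassociative algebra on the generators. -/
abbrev FreeGen (X H : Type*) := FreeNonUnitalNonAssocAlgebra ℂ (Gen X H)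

section
variable {X H : Type*}

/-- The generators inside the free nonassociative algebra. -/
abbrev genH (h : H) : FreeGen X H := FreeNonUnitalNonAssocAlgebra.of ℂ (Gen.h h)
abbrev genE (x : X) : FreeGen X H := FreeNonUnitalNonAssocAlgebra.of ℂ (Gen.e x)
abbrev genF (x : X) : FreeGen X H := FreeNonUnitalNonAssocAlgebra.of ℂ (Gen.f x)

end

/-- Rescaling the generators: `h ↦ h`, `e_x ↦ s x • e_x`, `f_x ↦ t x • f_x`. -/
def genScale {X : Type*} (H : Type*) (s t : X → ℂ) : FreeGen X H →ₙₐ[ℂ] FreeGen X H :=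
  FreeNonUnitalNonAssocAlgebra.lift ℂ fun g => match g with
    | Gen.h h => genH h
    | Gen.e x => s x • genE x
    | Gen.f x => t x • genF x

/-- The parity involution of the free nonassociative algebra, with `𝔥` even and `e_{±b(x)}` of
parity `p(x)`. -/
def freePar {X : Type*} (H : Type*) (p : X → ZMod 2) : FreeGen X H →ₙₐ[ℂ] FreeGen X H :=
  genScale H (fun x => (-1) ^ (p x).val) (fun x => (-1) ^ (p x).val)

section HalfBaked

variable {X H : Type*}

theorem genScale_genScale (s t s' t' : X → ℂ) (x : FreeGen X H) :
    genScale H s t (genScale H s' t' x) = genScale H (s * s') (t * t') x := by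
  have : (genScale H s t).comp (genScale H s' t') = genScale H (s * s') (t * t') := by
    apply FreeNonUnitalNonAssocAlgebra.hom_ext
    rintro (h | x | x) <;> simp [genScale, smul_smul, mul_comm]
  exact DFunLike.congr_fun this x

theorem genScale_one (x : FreeGen X H) : genScale H 1 1 x = x := by
  have : genScale H (1 : X → ℂ) 1 = NonUnitalAlgHom.id ℂ (FreeGen X H) := by
    apply FreeNonUnitalNonAssocAlgebra.hom_ext
    rintro (h | x | x) <;> simp [genScale]
  exact DFunLike.congr_fun this x

theorem freePar_freePar (p : X → ZMod 2) (x : FreeGen X H) :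
    freePar H p (freePar H p x) = x := by
  have h1 : (fun x => (-1) ^ (p x).val : X → ℂ) * (fun x => (-1) ^ (p x).val) = 1 := by
    ext x
    simp [← mul_pow]
  rw [freePar, genScale_genScale, h1, genScale_one]

variable [AddCommGroup H] [Module ℂ H]

/-- The relators of the half-baked Lie superalgebra: `𝔥` is a commutative subalgebra (in
particular, `𝔥 → 𝔤̃` is linear), `[e_x, f_y] = δ_{xy} a(x)`, `[h, e_x] = ⟨h, b(x)⟩ e_x`,
`[h, f_x] = -⟨h, b(x)⟩ f_x`, and the axioms of a Lie superalgebra. -/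
inductive Relator (v : SuperRootDatum X H) : FreeGen X H → Prop
  | add (h h' : H) : Relator v (genH (h + h') - genH h - genH h')
  | smul (c : ℂ) (h : H) : Relator v (genH (c • h) - c • genH h)
  | comm (h h' : H) : Relator v (genH h * genH h')
  | ef (x : X) : Relator v (genE x * genF x - genH (v.a x))
  | ef_ne (x y : X) (hxy : x ≠ y) : Relator v (genE x * genF y)
  | he (h : H) (x : X) : Relator v (genH h * genE x - v.b x h • genE x)
  | hf (h : H) (x : X) : Relator v (genH h * genF x + v.b x h • genF x)
  | skew (i j : ZMod 2) (x y : FreeGen X H)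
      (hx : x ∈ homog (freePar H v.p : FreeGen X H →ₗ[ℂ] FreeGen X H) i)
      (hy : y ∈ homog (freePar H v.p : FreeGen X H →ₗ[ℂ] FreeGen X H) j) :
      Relator v (x * y + ksgn i j • (y * x))
  | jacobi (i j k : ZMod 2) (x y z : FreeGen X H)
      (hx : x ∈ homog (freePar H v.p : FreeGen X H →ₗ[ℂ] FreeGen X H) i)
      (hy : y ∈ homog (freePar H v.p : FreeGen X H →ₗ[ℂ] FreeGen X H) j)
      (hz : z ∈ homog (freePar H v.p : FreeGen X H →ₗ[ℂ] FreeGen X H) k) :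
      Relator v (x * (y * z) - (x * y) * z - ksgn i j • (y * (x * z)))

/-- Two-sided ideals (as subspaces) of the free nonassociative algebra that contain all relators. -/
def IsRelIdeal (v : SuperRootDatum X H) (J : Submodule ℂ (FreeGen X H)) : Prop :=
  (∀ r, Relator v r → r ∈ J) ∧ ∀ x y, y ∈ J → x * y ∈ J ∧ y * x ∈ J

/-- The two-sided ideal generated by the relators. -/
def relIdeal (v : SuperRootDatum X H) : Submodule ℂ (FreeGen X H) :=
  sInf {J | IsRelIdeal v J}

theorem relIdeal_isRelIdeal (v : SuperRootDatum X H) : IsRelIdeal v (relIdeal v) := by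
  refine ⟨fun r hr => ?_, fun x y hy => ?_⟩
  · rw [relIdeal, Submodule.mem_sInf]
    exact fun J hJ => hJ.1 r hr
  · rw [relIdeal, Submodule.mem_sInf] at hy
    constructor <;> rw [relIdeal, Submodule.mem_sInf] <;> intro J hJ
    · exact (hJ.2 x y (hy J hJ)).1
    · exact (hJ.2 x y (hy J hJ)).2

theorem genScale_relIdeal (v : SuperRootDatum X H) (s t : X → ℂ) (hst : ∀ x, s x * t x = 1)
    (x : FreeGen X H) (hx : x ∈ relIdeal v) : genScale H s t x ∈ relIdeal v := by
  have key : IsRelIdeal v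
      ((relIdeal v).comap (genScale H s t : FreeGen X H →ₗ[ℂ] FreeGen X H)) := by
    have hR := relIdeal_isRelIdeal v
    have hom : ∀ (i : ZMod 2) (x : FreeGen X H),
        x ∈ homog (freePar H v.p : FreeGen X H →ₗ[ℂ] FreeGen X H) i →
        genScale H s t x ∈ homog (freePar H v.p : FreeGen X H →ₗ[ℂ] FreeGen X H) i := by
      intro i x hx
      rw [mem_homog] at hx ⊢
      have hx' : freePar H v.p x = ((-1) ^ i.val : ℂ) • x := hx
      show freePar H v.p (genScale H s t x) = _
      rw [freePar, genScale_genScale, mul_comm, mul_comm _ t, ← genScale_genScale, ← freePar, hx',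
        map_smul]
    refine ⟨?_, ?_⟩
    · intro r hr
      show genScale H s t r ∈ relIdeal v
      cases hr with
      | add h h' => simpa [genScale] using hR.1 _ (Relator.add h h')
      | smul c h => simpa [genScale] using hR.1 _ (Relator.smul c h)
      | comm h h' => simpa [genScale] using hR.1 _ (Relator.comm h h')
      | ef x =>
        have := hR.1 _ (Relator.ef (v := v) x)
        simpa [genScale, smul_mul_smul_comm, hst x] using this
      | ef_ne x y hxy =>
        have := (relIdeal v).smul_mem (s x * t y) (hR.1 _ (Relator.ef_ne (v := v) x y hxy))
        simpa [genScale, smul_mul_smul_comm] using this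
      | he h x =>
        have := (relIdeal v).smul_mem (s x) (hR.1 _ (Relator.he (v := v) h x))
        rw [smul_sub, smul_comm] at this
        simpa [genScale, mul_smul_comm] using this
      | hf h x =>
        have := (relIdeal v).smul_mem (t x) (hR.1 _ (Relator.hf (v := v) h x))
        rw [smul_add, smul_comm] at this
        simpa [genScale, mul_smul_comm] using this
      | skew i j x y hx hy =>
        simpa using hR.1 _ (Relator.skew i j _ _ (hom i x hx) (hom j y hy))
      | jacobi i j k x y z hx hy hz =>
        simpa using hR.1 _ (Relator.jacobi i j k _ _ _ (hom i x hx) (hom j y hy) (hom k z hz))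
    · intro x y hy
      have hy' : genScale H s t y ∈ relIdeal v := hy
      constructor
      · show genScale H s t (x * y) ∈ relIdeal v
        rw [map_mul]; exact (hR.2 _ _ hy').1
      · show genScale H s t (y * x) ∈ relIdeal v
        rw [map_mul]; exact (hR.2 _ _ hy').2
  rw [relIdeal, Submodule.mem_sInf] at hx
  exact hx _ key

theorem freePar_relIdeal (v : SuperRootDatum X H)
    (x : FreeGen X H) (hx : x ∈ relIdeal v) : freePar H v.p x ∈ relIdeal v :=
  genScale_relIdeal v _ _ (fun x => by simp [← mul_pow]) x hx

/-- The half-baked Lie superalgebra `𝔤̃(v)`. -/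
def HalfBaked (v : SuperRootDatum X H) : Type _ := FreeGen X H ⧸ relIdeal v

instance (v : SuperRootDatum X H) : AddCommGroup (HalfBaked v) :=
  inferInstanceAs (AddCommGroup (FreeGen X H ⧸ relIdeal v))

instance (v : SuperRootDatum X H) : Module ℂ (HalfBaked v) :=
  inferInstanceAs (Module ℂ (FreeGen X H ⧸ relIdeal v))

/-- The projection of the free nonassociative algebra onto `𝔤̃(v)`. -/
def HalfBaked.mk (v : SuperRootDatum X H) : FreeGen X H →ₗ[ℂ] HalfBaked v := (relIdeal v).mkQ

theorem HalfBaked.mk_surjective (v : SuperRootDatum X H) : Function.Surjective (HalfBaked.mk v) :=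
  (relIdeal v).mkQ_surjective

theorem HalfBaked.mk_eq_zero (v : SuperRootDatum X H) (x : FreeGen X H) :
    HalfBaked.mk v x = 0 ↔ x ∈ relIdeal v :=
  Submodule.Quotient.mk_eq_zero _

theorem HalfBaked.ext {M : Type*} [AddCommGroup M] [Module ℂ M] {v : SuperRootDatum X H}
    {φ ψ : HalfBaked v →ₗ[ℂ] M} (h : ∀ x, φ (HalfBaked.mk v x) = ψ (HalfBaked.mk v x)) : φ = ψ := by
  ext x
  obtain ⟨x, rfl⟩ := HalfBaked.mk_surjective v x
  exact h x

/-- Descent of a linear map to `𝔤̃(v)`. -/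
def HalfBaked.desc {M : Type*} [AddCommGroup M] [Module ℂ M] (v : SuperRootDatum X H)
    (φ : FreeGen X H →ₗ[ℂ] M) (hφ : ∀ x ∈ relIdeal v, φ x = 0) : HalfBaked v →ₗ[ℂ] M :=
  (relIdeal v).liftQ φ hφ

@[simp]
theorem HalfBaked.desc_mk {M : Type*} [AddCommGroup M] [Module ℂ M] (v : SuperRootDatum X H)
    (φ : FreeGen X H →ₗ[ℂ] M) (hφ : ∀ x ∈ relIdeal v, φ x = 0) (x : FreeGen X H) :
    HalfBaked.desc v φ hφ (HalfBaked.mk v x) = φ x :=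
  rfl

/-- The bracket of `𝔤̃(v)`, induced by the product of the free nonassociative algebra. -/
def HalfBaked.bracket (v : SuperRootDatum X H) : HalfBaked v →ₗ[ℂ] HalfBaked v →ₗ[ℂ] HalfBaked v :=
  HalfBaked.desc v
    { toFun := fun x => HalfBaked.desc v (HalfBaked.mk v ∘ₗ LinearMap.mulLeft ℂ x) (fun y hy =>
        (HalfBaked.mk_eq_zero v _).2 ((relIdeal_isRelIdeal v).2 x y hy).1)
      map_add' := fun x x' => by
        apply HalfBaked.ext; intro y; simp [add_mul]
      map_smul' := fun c x => by
        apply HalfBaked.ext; intro y; simp [smul_mul_assoc] }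
    (fun x hx => by
      apply HalfBaked.ext; intro y
      exact (HalfBaked.mk_eq_zero v _).2 ((relIdeal_isRelIdeal v).2 y x hx).2)

@[simp]
theorem HalfBaked.bracket_mk (v : SuperRootDatum X H) (x y : FreeGen X H) :
    HalfBaked.bracket v (HalfBaked.mk v x) (HalfBaked.mk v y) = HalfBaked.mk v (x * y) :=
  rfl

/-- The endomorphism of the vector space `𝔤̃(v)` induced by a rescaling of the generators with
`s x * t x = 1`. -/
def HalfBaked.scale (v : SuperRootDatum X H) (s t : X → ℂ) (hst : ∀ x, s x * t x = 1) :
    HalfBaked v →ₗ[ℂ] HalfBaked v :=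
  HalfBaked.desc v (HalfBaked.mk v ∘ₗ (genScale H s t : FreeGen X H →ₗ[ℂ] FreeGen X H))
    (fun x hx => (HalfBaked.mk_eq_zero v _).2 (genScale_relIdeal v s t hst x hx))

@[simp]
theorem HalfBaked.scale_mk (v : SuperRootDatum X H) (s t : X → ℂ) (hst : ∀ x, s x * t x = 1)
    (x : FreeGen X H) :
    HalfBaked.scale v s t hst (HalfBaked.mk v x) = HalfBaked.mk v (genScale H s t x) :=
  rfl

instance (v : SuperRootDatum X H) : LieSuperalgebra (HalfBaked v) where
  br := HalfBaked.bracket v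
  par := HalfBaked.scale v (fun x => (-1) ^ (v.p x).val) (fun x => (-1) ^ (v.p x).val)
    (fun x => by simp [← mul_pow])
  par_par := by
    intro x
    obtain ⟨x, rfl⟩ := HalfBaked.mk_surjective v x
    exact congrArg (HalfBaked.mk v) (freePar_freePar v.p x)
  par_br := by
    intro x y
    obtain ⟨x, rfl⟩ := HalfBaked.mk_surjective v x
    obtain ⟨y, rfl⟩ := HalfBaked.mk_surjective v y
    simp
  skew := by
    intro i j x y hx0 hy0
    obtain ⟨x, hx, rfl⟩ := homog_lift (freePar H v.p : FreeGen X H →ₗ[ℂ] FreeGen X H) _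
      (freePar_freePar v.p) _ (HalfBaked.mk_surjective v) (fun x => rfl) i x hx0
    obtain ⟨y, hy, rfl⟩ := homog_lift (freePar H v.p : FreeGen X H →ₗ[ℂ] FreeGen X H) _
      (freePar_freePar v.p) _ (HalfBaked.mk_surjective v) (fun x => rfl) j y hy0
    have := (HalfBaked.mk_eq_zero v _).2
      ((relIdeal_isRelIdeal v).1 _ (Relator.skew i j x y hx hy))
    rw [map_add, map_smul] at this
    simpa using eq_neg_of_add_eq_zero_left this
  jacobi := by
    intro i j k x y z hx0 hy0 hz0
    obtain ⟨x, hx, rfl⟩ := homog_lift (freePar H v.p : FreeGen X H →ₗ[ℂ] FreeGen X H) _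
      (freePar_freePar v.p) _ (HalfBaked.mk_surjective v) (fun x => rfl) i x hx0
    obtain ⟨y, hy, rfl⟩ := homog_lift (freePar H v.p : FreeGen X H →ₗ[ℂ] FreeGen X H) _
      (freePar_freePar v.p) _ (HalfBaked.mk_surjective v) (fun x => rfl) j y hy0
    obtain ⟨z, hz, rfl⟩ := homog_lift (freePar H v.p : FreeGen X H →ₗ[ℂ] FreeGen X H) _
      (freePar_freePar v.p) _ (HalfBaked.mk_surjective v) (fun x => rfl) k z hz0
    have := (HalfBaked.mk_eq_zero v _).2
      ((relIdeal_isRelIdeal v).1 _ (Relator.jacobi i j k x y z hx hy hz))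
    rw [map_sub, map_sub, map_smul, sub_sub, sub_eq_zero] at this
    simpa using this

/-- A graded ideal of `𝔤̃(v)` that has zero intersection with (the image of) `𝔥`. -/
def AvoidsCartan (v : SuperRootDatum X H) (J : SuperIdeal (HalfBaked v)) : Prop :=
  ∀ h : H, HalfBaked.mk v (genH h) ∈ J.carrier → HalfBaked.mk v (genH h) = 0

/-- The sum of all graded ideals of `𝔤̃(v)` that have zero intersection with `𝔥`. -/
def sumAvoiding (v : SuperRootDatum X H) : Submodule ℂ (HalfBaked v) :=
  sSup {M | ∃ J : SuperIdeal (HalfBaked v), AvoidsCartan v J ∧ J.carrier = M}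

theorem le_sumAvoiding (v : SuperRootDatum X H) (J : SuperIdeal (HalfBaked v))
    (hJ : AvoidsCartan v J) : J.carrier ≤ sumAvoiding v :=
  le_sSup ⟨J, hJ, rfl⟩

/-- The maximal ideal of `𝔤̃(v)` having zero intersection with `𝔥`: the sum of all
the ideals with this property. -/
def maxIdeal (v : SuperRootDatum X H) : SuperIdeal (HalfBaked v) where
  carrier := sumAvoiding v
  par_mem := by
    intro x hx
    have : sumAvoiding v ≤ (sumAvoiding v).comap par := by
      refine sSup_le ?_
      rintro M ⟨J, hJ, rfl⟩ y hy
      exact le_sumAvoiding v J hJ (J.par_mem y hy)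
    exact this hx
  br_mem_left := by
    intro x y hy
    have : sumAvoiding v ≤ (sumAvoiding v).comap (br x) := by
      refine sSup_le ?_
      rintro M ⟨J, hJ, rfl⟩ y hy
      exact le_sumAvoiding v J hJ (J.br_mem_left x y hy)
    exact this hy
  br_mem_right := by
    intro x y hx
    have : sumAvoiding v ≤ (sumAvoiding v).comap (br.flip y) := by
      refine sSup_le ?_
      rintro M ⟨J, hJ, rfl⟩ x hx
      exact le_sumAvoiding v J hJ (J.br_mem_right x y hx)
    exact this hx

/-- The contragredient Lie superalgebra `𝔤(v)`: the quotient of `𝔤̃(v)` by the maximal ideal having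
zero intersection with `𝔥`. -/
abbrev Contragredient (v : SuperRootDatum X H) : Type _ := HalfBaked v ⧸ (maxIdeal v).carrier

theorem HalfBaked.scale_scale (v : SuperRootDatum X H) (s t s' t' : X → ℂ) (hst : ∀ x, s x * t x = 1)
    (hst' : ∀ x, s' x * t' x = 1) (h1 : s * s' = 1) (h2 : t * t' = 1) (x : HalfBaked v) :
    HalfBaked.scale v s t hst (HalfBaked.scale v s' t' hst' x) = x := by
  obtain ⟨x, rfl⟩ := HalfBaked.mk_surjective v x
  simp [genScale_genScale, h1, h2, genScale_one]

theorem HalfBaked.scale_br (v : SuperRootDatum X H) (s t : X → ℂ) (hst : ∀ x, s x * t x = 1)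
    (x y : HalfBaked v) :
    HalfBaked.scale v s t hst (br x y) =
      br (HalfBaked.scale v s t hst x) (HalfBaked.scale v s t hst y) := by
  obtain ⟨x, rfl⟩ := HalfBaked.mk_surjective v x
  obtain ⟨y, rfl⟩ := HalfBaked.mk_surjective v y
  exact congrArg (HalfBaked.mk v) (map_mul (genScale H s t) x y)

theorem HalfBaked.scale_par (v : SuperRootDatum X H) (s t : X → ℂ) (hst : ∀ x, s x * t x = 1)
    (x : HalfBaked v) :
    HalfBaked.scale v s t hst (par x) = par (HalfBaked.scale v s t hst x) := by
  obtain ⟨x, rfl⟩ := HalfBaked.mk_surjective v x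
  have : genScale H s t (freePar H v.p x) = freePar H v.p (genScale H s t x) := by
    rw [freePar, genScale_genScale, mul_comm, mul_comm t, ← genScale_genScale]
  exact congrArg (HalfBaked.mk v) this

theorem HalfBaked.scale_genH (v : SuperRootDatum X H) (s t : X → ℂ) (hst : ∀ x, s x * t x = 1)
    (h : H) : HalfBaked.scale v s t hst (HalfBaked.mk v (genH h)) = HalfBaked.mk v (genH h) := by
  simp [genScale]

/-- The preimage of a graded ideal under a rescaling of the generators. -/
def HalfBaked.scaleComap (v : SuperRootDatum X H) (s t : X → ℂ) (hst : ∀ x, s x * t x = 1)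
    (J : SuperIdeal (HalfBaked v)) : SuperIdeal (HalfBaked v) where
  carrier := J.carrier.comap (HalfBaked.scale v s t hst)
  par_mem := fun x hx => by
    rw [Submodule.mem_comap] at hx ⊢
    rw [HalfBaked.scale_par]; exact J.par_mem _ hx
  br_mem_left := fun x y hy => by
    rw [Submodule.mem_comap] at hy ⊢
    rw [HalfBaked.scale_br]; exact J.br_mem_left _ _ hy
  br_mem_right := fun x y hx => by
    rw [Submodule.mem_comap] at hx ⊢
    rw [HalfBaked.scale_br]; exact J.br_mem_right _ _ hx

theorem HalfBaked.mem_scaleComap (v : SuperRootDatum X H) (s t : X → ℂ)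
    (hst : ∀ x, s x * t x = 1) (J : SuperIdeal (HalfBaked v)) (x : HalfBaked v) :
    x ∈ (HalfBaked.scaleComap v s t hst J).carrier ↔ HalfBaked.scale v s t hst x ∈ J.carrier :=
  Submodule.mem_comap

theorem HalfBaked.scaleComap_avoids (v : SuperRootDatum X H) (s t : X → ℂ)
    (hst : ∀ x, s x * t x = 1) (J : SuperIdeal (HalfBaked v)) (hJ : AvoidsCartan v J) :
    AvoidsCartan v (HalfBaked.scaleComap v s t hst J) := by
  intro h hh
  rw [HalfBaked.mem_scaleComap, HalfBaked.scale_genH] at hh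
  exact hJ h hh

theorem HalfBaked.scale_maxIdeal (v : SuperRootDatum X H) (s t : X → ℂ) (hst : ∀ x, s x * t x = 1)
    (x : HalfBaked v) (hx : x ∈ (maxIdeal v).carrier) :
    HalfBaked.scale v s t hst x ∈ (maxIdeal v).carrier := by
  have hts : ∀ x, t x * s x = 1 := fun x => by rw [mul_comm]; exact hst x
  have e1 : s * t = 1 := funext hst
  have e2 : t * s = 1 := funext hts
  have key : sumAvoiding v ≤ (sumAvoiding v).comap (HalfBaked.scale v s t hst) := by
    refine sSup_le ?_
    rintro M ⟨J, hJ, rfl⟩ y hy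
    rw [Submodule.mem_comap]
    refine le_sumAvoiding v _ (HalfBaked.scaleComap_avoids v t s hts J hJ) ?_
    rw [HalfBaked.mem_scaleComap, HalfBaked.scale_scale v _ _ _ _ _ _ e2 e1]
    exact hy
  exact Submodule.mem_comap.1 (key hx)

/-- The automorphism `exp (ad h)` of `𝔤(v)` for `h ∈ 𝔥`: it is the identity on `𝔥` and multiplies
`e_{±b(x)}` by `exp(±⟨h, b(x)⟩)`. -/
def expAd (v : SuperRootDatum X H) (h : H) : Iso (Contragredient v) (Contragredient v) where
  toEquiv :=
    LinearEquiv.ofLinearMap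
      ((maxIdeal v).carrier.mapQ (maxIdeal v).carrier
        (HalfBaked.scale v (fun x => Complex.exp (v.b x h)) (fun x => Complex.exp (-v.b x h))
          (fun x => by rw [← Complex.exp_add]; simp))
        (fun x hx => HalfBaked.scale_maxIdeal v _ _ _ x hx))
      ((maxIdeal v).carrier.mapQ (maxIdeal v).carrier
        (HalfBaked.scale v (fun x => Complex.exp (-v.b x h)) (fun x => Complex.exp (v.b x h))
          (fun x => by rw [← Complex.exp_add]; simp))
        (fun x hx => HalfBaked.scale_maxIdeal v _ _ _ x hx))
      (by
        apply Submodule.linearMap_qext; ext x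
        simp only [LinearMap.coe_comp, Function.comp_apply, Submodule.mkQ_apply,
          Submodule.mapQ_apply, LinearMap.id_coe, id_eq]
        rw [HalfBaked.scale_scale] <;> ext x <;> simp [← Complex.exp_add])
      (by
        apply Submodule.linearMap_qext; ext x
        simp only [LinearMap.coe_comp, Function.comp_apply, Submodule.mkQ_apply,
          Submodule.mapQ_apply, LinearMap.id_coe, id_eq]
        rw [HalfBaked.scale_scale] <;> ext x <;> simp [← Complex.exp_add])
  map_par := by
    intro x
    obtain ⟨x, rfl⟩ := (maxIdeal v).carrier.mkQ_surjective x
    exact congrArg (maxIdeal v).carrier.mkQ (HalfBaked.scale_par v _ _ _ x)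
  map_br := by
    intro x y
    obtain ⟨x, rfl⟩ := (maxIdeal v).carrier.mkQ_surjective x
    obtain ⟨y, rfl⟩ := (maxIdeal v).carrier.mkQ_surjective y
    exact congrArg (maxIdeal v).carrier.mkQ (HalfBaked.scale_br v _ _ _ x y)

end HalfBaked

/-- `L` admits the Cartan datum `(A, p)`: it is isomorphic to the contragredient Lie superalgebra
of a root datum with Cartan datum `(A, p)` and `dim 𝔥 = |X| + corank A`. -/
def AdmitsCartanDatum (L : Type*) [AddCommGroup L] [Module ℂ L] [LieSuperalgebra L]
    {X : Type*} [Fintype X] [DecidableEq X] (A : Matrix X X ℂ) (p : X → ZMod 2) : Prop :=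
  ∃ (H : Type) (_ : AddCommGroup H) (_ : Module ℂ H) (v : SuperRootDatum X H),
    v.cartan = A ∧ v.p = p ∧
    Module.finrank ℂ H = Fintype.card X + (Fintype.card X - A.rank) ∧
    Nonempty (Iso L (Contragredient v))

/-! ### Affinizations -/

/-- Even supersymmetric invariant bilinear forms. -/
structure InvariantForm (L : Type*) [AddCommGroup L] [Module ℂ L] [LieSuperalgebra L] where
  form : L →ₗ[ℂ] L →ₗ[ℂ] ℂ
  even : ∀ x y, form (par x) (par y) = form x y
  supersymm : ∀ (i j : ZMod 2) (x y : L), x ∈ homog par i → y ∈ homog par j →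
    form x y = ksgn i j * form y x
  invariant : ∀ x y z, form (br x y) z = form x (br y z)

/-! ### The Killing form -/

section Killing

theorem ksgn_mul_self (i j : ZMod 2) : ksgn i j * ksgn i j = 1 := by
  rw [ksgn, ← mul_pow]; simp

theorem ksgn_comm (i j : ZMod 2) : ksgn i j = ksgn j i := by
  rw [ksgn, ksgn, mul_comm]

variable {L : Type*} [AddCommGroup L] [Module ℂ L] [LieSuperalgebra L]

theorem par_mul_par : (par * par : Module.End ℂ L) = 1 := by
  ext y
  simp [par_par]

theorem br_mem_homog {i j : ZMod 2} {x y : L} (hx : x ∈ homog par i) (hy : y ∈ homog par j) :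
    br x y ∈ homog par (i + j) := by
  rw [mem_homog] at *
  rw [par_br, hx, hy]
  simp only [map_smul, LinearMap.smul_apply, smul_smul]
  congr 1
  rcases val_cases i with rfl | rfl <;> rcases val_cases j with rfl | rfl <;>
    simp [show (1 + 1 : ZMod 2) = 0 from rfl, ZMod.val_one]

theorem br_par_comm {i : ZMod 2} {x : L} (hx : x ∈ homog par i) :
    (br x * par : Module.End ℂ L) = ((-1) ^ i.val : ℂ) • (par * br x) := by
  rw [mem_homog] at hx
  ext y
  have h := par_br x y
  rw [hx] at h
  simp only [map_smul, LinearMap.smul_apply] at h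
  simp only [Module.End.mul_apply, LinearMap.smul_apply, h, smul_smul, ← mul_pow]
  simp

theorem exists_homog (z : L) : ∃ z0 ∈ homog (par : L →ₗ[ℂ] L) 0,
    ∃ z1 ∈ homog (par : L →ₗ[ℂ] L) 1, z = z0 + z1 := by
  refine ⟨(1 / 2 : ℂ) • (z + par z), ?_, (1 / 2 : ℂ) • (z - par z), ?_, ?_⟩
  · rw [mem_homog]; simp [par_par, add_comm]
  · rw [mem_homog]; simp [par_par, ZMod.val_one, ← smul_neg]
  · module

theorem br_br_eq {i j : ZMod 2} {x y : L} (hx : x ∈ homog par i) (hy : y ∈ homog par j) :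
    (br (br x y) : Module.End ℂ L) = br x * br y - ksgn i j • (br y * br x) := by
  ext z
  obtain ⟨z0, h0, z1, h1, rfl⟩ := exists_homog z
  have e0 := jacobi i j 0 x y z0 hx hy h0
  have e1 := jacobi i j 1 x y z1 hx hy h1
  simp only [map_add, LinearMap.sub_apply, Module.End.mul_apply, LinearMap.smul_apply, e0, e1]
  module

variable (L) in
/-- The Killing form `(x, y) ↦ str (ad x ∘ ad y)`, the supertrace of an endomorphism `f` being
the trace of `par ∘ f`. -/
def killingBilin : L →ₗ[ℂ] L →ₗ[ℂ] ℂ :=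
  LinearMap.mk₂ ℂ (fun x y => LinearMap.trace ℂ L (par * (br x * br y)))
    (by intros; simp [mul_add, add_mul]) (by intros; simp)
    (by intros; simp [mul_add]) (by intros; simp)

theorem killingBilin_apply (x y : L) :
    killingBilin L x y = LinearMap.trace ℂ L (par * (br x * br y)) := rfl

theorem killingBilin_even (x y : L) :
    killingBilin L (par x) (par y) = killingBilin L x y := by
  have hb : ∀ x : L, (br (par x) : Module.End ℂ L) = par * br x * par := by
    intro x; ext y; simp [par_br, par_par]
  have e : (par * (par * br x * par * (par * br y * par)) : Module.End ℂ L) =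
      (br x * br y) * par := by
    calc (par * (par * br x * par * (par * br y * par)) : Module.End ℂ L)
        = (par * par) * br x * (par * par) * br y * par := by simp only [mul_assoc]
      _ = _ := by rw [par_mul_par]; simp
  rw [killingBilin_apply, killingBilin_apply, hb, hb, e, LinearMap.trace_mul_comm]

theorem killingBilin_eq_zero {i j : ZMod 2} {x y : L} (hx : x ∈ homog par i)
    (hy : y ∈ homog par j) (hij : i ≠ j) : killingBilin L x y = 0 := by
  have h := killingBilin_even x y
  rw [mem_homog] at hx hy
  rw [hx, hy] at h
  simp only [map_smul, LinearMap.smul_apply, smul_eq_mul, ← mul_assoc] at h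
  rcases val_cases i with rfl | rfl <;> rcases val_cases j with rfl | rfl <;>
    simp_all [ZMod.val_one, neg_eq_iff_add_eq_zero, ← two_mul]

theorem killingBilin_supersymm (i j : ZMod 2) (x y : L) (hx : x ∈ homog par i)
    (hy : y ∈ homog par j) : killingBilin L x y = ksgn i j * killingBilin L y x := by
  by_cases hij : i = j
  · subst hij
    rw [killingBilin_apply, ← mul_assoc, LinearMap.trace_mul_comm, ← mul_assoc, br_par_comm hy,
      smul_mul_assoc, map_smul, mul_assoc, killingBilin_apply, smul_eq_mul]
    congr 1
    rcases val_cases i with rfl | rfl <;> simp [ksgn]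
  · rw [killingBilin_eq_zero hx hy hij, killingBilin_eq_zero hy hx (Ne.symm hij), mul_zero]

theorem killingBilin_invariant_homog {i j k : ZMod 2} {x y z : L} (hx : x ∈ homog par i)
    (hy : y ∈ homog par j) (hz : z ∈ homog par k) :
    killingBilin L (br x y) z = killingBilin L x (br y z) := by
  by_cases hij : i + j = k
  · have e : LinearMap.trace ℂ L (par * (br y * br x * br z)) =
        (-1) ^ j.val * LinearMap.trace ℂ L (par * (br x * (br z * br y))) := by
      have e1 : (par * (br y * br x * br z) : Module.End ℂ L) =
          ((-1) ^ j.val : ℂ) • (br y * (par * (br x * br z))) := by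
        have := br_par_comm hy
        calc (par * (br y * br x * br z) : Module.End ℂ L) = (par * br y) * (br x * br z) := by
              simp only [mul_assoc]
          _ = ((-1) ^ j.val : ℂ) • ((br y * par) * (br x * br z)) := by
              rw [this, smul_mul_assoc, smul_smul, ← mul_pow]; simp
          _ = _ := by rw [mul_assoc]
      rw [e1, map_smul, LinearMap.trace_mul_comm, smul_eq_mul]
      simp only [mul_assoc]
    rw [killingBilin_apply, killingBilin_apply, br_br_eq hx hy, br_br_eq hy hz]
    simp only [sub_mul, mul_sub, map_sub, smul_mul_assoc, mul_smul_comm, map_smul, smul_eq_mul]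
    rw [e, mul_assoc (br x) (br y) (br z), ← mul_assoc (ksgn i j)]
    congr 2
    subst hij
    rcases val_cases i with rfl | rfl <;> rcases val_cases j with rfl | rfl <;>
      simp [ksgn, show (1 + 1 : ZMod 2) = 0 from rfl, ZMod.val_one]
  · rw [killingBilin_eq_zero (br_mem_homog hx hy) hz hij,
      killingBilin_eq_zero hx (br_mem_homog hy hz)]
    rintro rfl
    apply hij
    rcases val_cases k with rfl | rfl <;> rcases val_cases j with rfl | rfl <;> decide

variable (L) in
/-- The Killing form as an invariant form. -/
def killing : InvariantForm L where
  form := killingBilin L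
  even := killingBilin_even
  supersymm := killingBilin_supersymm
  invariant := by
    intro x y z
    obtain ⟨x0, hx0, x1, hx1, rfl⟩ := exists_homog x
    obtain ⟨y0, hy0, y1, hy1, rfl⟩ := exists_homog y
    obtain ⟨z0, hz0, z1, hz1, rfl⟩ := exists_homog z
    simp only [map_add, LinearMap.add_apply]
    rw [killingBilin_invariant_homog hx0 hy0 hz0, killingBilin_invariant_homog hx0 hy0 hz1,
      killingBilin_invariant_homog hx0 hy1 hz0, killingBilin_invariant_homog hx0 hy1 hz1,
      killingBilin_invariant_homog hx1 hy0 hz0, killingBilin_invariant_homog hx1 hy0 hz1,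
      killingBilin_invariant_homog hx1 hy1 hz0, killingBilin_invariant_homog hx1 hy1 hz1]

end Killing

/-! ### Affinization and twisted affinization -/

section Affine

namespace Loop

section

variable {L : Type*} [AddCommGroup L]

theorem induct' {p : (ℤ →₀ L) → Prop} (zero : p 0)
    (add : ∀ f g, p f → p g → p (f + g)) (single : ∀ m x, p (Finsupp.single m x))
    (f : ℤ →₀ L) : p f := by
  rw [← Finsupp.sum_single f]
  exact Finset.sum_induction _ p add zero fun m _ => single m _

variable [Module ℂ L]

/-- The derivation `t d/dt`. -/
def deriv : (ℤ →₀ L) →ₗ[ℂ] (ℤ →₀ L) :=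
  Finsupp.lsum ℂ fun n => (n : ℂ) • Finsupp.lsingle n

@[simp] theorem deriv_single (n : ℤ) (x : L) :
    deriv (Finsupp.single n x) = (n : ℂ) • Finsupp.single n x := by
  simp [deriv]

end

variable {L : Type*} [AddCommGroup L] [Module ℂ L] [LieSuperalgebra L]

/-- The bracket `[x t^m, y t^n] = [x, y] t^(m+n)` of the loop superalgebra `L ⊗ ℂ[t, t⁻¹]`, whose
elements are viewed as finitely supported functions `ℤ → L`. -/
def bracket : (ℤ →₀ L) →ₗ[ℂ] (ℤ →₀ L) →ₗ[ℂ] (ℤ →₀ L) :=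
  Finsupp.lsum ℂ fun m =>
    { toFun := fun x => Finsupp.lsum ℂ fun n => Finsupp.lsingle (m + n) ∘ₗ br x
      map_add' := fun x x' => by ext n y : 2; simp
      map_smul' := fun c x => by ext n y : 2; simp }

/-- The cocycle `(x t^m, y t^n) ↦ m δ_{m+n,0} B(x, y)`. -/
def cocycle (B : InvariantForm L) : (ℤ →₀ L) →ₗ[ℂ] (ℤ →₀ L) →ₗ[ℂ] ℂ :=
  Finsupp.lsum ℂ fun m =>
    { toFun := fun x => Finsupp.lsum ℂ fun n => (if m + n = 0 then (m : ℂ) else 0) • B.form x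
      map_add' := fun x x' => by ext n y : 2; by_cases h : m + n = 0 <;> simp [h]
      map_smul' := fun c x => by ext n y : 2; by_cases h : m + n = 0 <;> simp [h]; ring }

/-- The parity involution of the loop superalgebra. -/
def parity : (ℤ →₀ L) →ₗ[ℂ] (ℤ →₀ L) := Finsupp.mapRange.linearMap par

@[simp] theorem bracket_single (m n : ℤ) (x y : L) :
    bracket (Finsupp.single m x) (Finsupp.single n y) = Finsupp.single (m + n) (br x y) := by
  simp [bracket]

@[simp] theorem cocycle_single (B : InvariantForm L) (m n : ℤ) (x y : L) :
    cocycle B (Finsupp.single m x) (Finsupp.single n y) =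
      if m + n = 0 then m * B.form x y else 0 := by
  by_cases h : m + n = 0 <;> simp [cocycle, h]

@[simp] theorem parity_single (n : ℤ) (x : L) :
    parity (Finsupp.single n x) = Finsupp.single n (par x) := by
  simp [parity]

theorem induct {i : ZMod 2} {p : (f : ℤ →₀ L) → f ∈ homog parity i → Prop}
    (zero : p 0 (Submodule.zero_mem _))
    (add : ∀ f g hf hg, p f hf → p g hg → p (f + g) (Submodule.add_mem _ hf hg))
    (single : ∀ m x (_ : x ∈ homog par i) hx', p (Finsupp.single m x) hx')
    (f : ℤ →₀ L) (hf : f ∈ homog parity i) : p f hf := by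
  suffices h : ∃ hf, p f hf from h.2
  rw [← Finsupp.sum_single f]
  refine Finset.sum_induction _ (fun f => ∃ hf, p f hf) ?_ ⟨_, zero⟩ ?_
  · rintro f g ⟨hf, hf'⟩ ⟨hg, hg'⟩
    exact ⟨_, add f g hf hg hf' hg'⟩
  · intro m _
    have hm : f m ∈ homog par i := by
      rw [mem_homog] at hf ⊢
      have := DFunLike.congr_fun hf m
      simpa [parity] using this
    have hm' : Finsupp.single m (f m) ∈ homog parity i := by
      rw [mem_homog] at hm ⊢
      simp only [parity, Finsupp.mapRange.linearMap_apply, Finsupp.mapRange_single, hm,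
        Finsupp.smul_single]
    exact ⟨hm', single m _ hm hm'⟩

theorem parity_parity (f : ℤ →₀ L) : parity (parity f) = f := by
  ext m; simp [parity, par_par]

theorem parity_deriv (f : ℤ →₀ L) : parity (deriv f) = deriv (parity f) := by
  induction f using induct' with
  | zero => simp
  | add f g hf hg => simp [hf, hg]
  | single m x => simp

theorem parity_bracket (f g : ℤ →₀ L) :
    parity (bracket f g) = bracket (parity f) (parity g) := by
  induction f using induct' with
  | zero => simp
  | add f f' hf hf' => simp [hf, hf']
  | single m x =>
    induction g using induct' with
    | zero => simp
    | add f g hf hg => simp [hf, hg]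
    | single n y => simp [par_br]

theorem parity_cocycle (B : InvariantForm L) (f g : ℤ →₀ L) :
    cocycle B (parity f) (parity g) = cocycle B f g := by
  induction f using induct' with
  | zero => simp
  | add f f' hf hf' => simp [hf, hf']
  | single m x =>
    induction g using induct' with
    | zero => simp
    | add f g hf hg => simp only [map_add, hf, hg]
    | single n y => simp [B.even]

theorem deriv_bracket (f g : ℤ →₀ L) :
    deriv (bracket f g) = bracket (deriv f) g + bracket f (deriv g) := by
  induction f using induct' with
  | zero => simp
  | add f f' hf hf' => simp only [map_add, LinearMap.add_apply, hf, hf']; abel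
  | single m x =>
    induction g using induct' with
    | zero => simp
    | add f g hf hg => simp only [map_add, hf, hg]; abel
    | single n y => simp [add_smul]

theorem cocycle_deriv (B : InvariantForm L) (f g : ℤ →₀ L) :
    cocycle B (deriv f) g = -cocycle B f (deriv g) := by
  induction f using induct' with
  | zero => simp
  | add f f' hf hf' => simp only [map_add, LinearMap.add_apply, hf, hf']; ring
  | single m x =>
    induction g using induct' with
    | zero => simp
    | add f g hf hg => simp only [map_add, hf, hg]; ring
    | single n y =>
      simp only [deriv_single, map_smul, LinearMap.smul_apply, cocycle_single, smul_eq_mul]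
      split_ifs with h
      · rw [show n = -m by omega]; push_cast; ring
      · simp

theorem bracket_skew (i j : ZMod 2) (f g : ℤ →₀ L) (hf : f ∈ homog parity i)
    (hg : g ∈ homog parity j) : bracket f g = -(ksgn i j • bracket g f) := by
  induction f, hf using induct with
  | zero => simp
  | add f f' _ _ hf hf' => simp only [map_add, LinearMap.add_apply, hf, hf']; module
  | single m x hx _ =>
    induction g, hg using induct with
    | zero => simp
    | add f g _ _ hf hg => simp only [map_add, LinearMap.add_apply, hf, hg]; module
    | single n y hy _ => simp [skew i j x y hx hy, add_comm m n]

theorem cocycle_skew (B : InvariantForm L) (i j : ZMod 2) (f g : ℤ →₀ L)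
    (hf : f ∈ homog parity i) (hg : g ∈ homog parity j) :
    cocycle B f g = -(ksgn i j * cocycle B g f) := by
  induction f, hf using induct with
  | zero => simp
  | add f f' _ _ hf hf' => simp only [map_add, LinearMap.add_apply, hf, hf']; ring
  | single m x hx _ =>
    induction g, hg using induct with
    | zero => simp
    | add f g _ _ hf hg => simp only [map_add, LinearMap.add_apply, hf, hg]; ring
    | single n y hy _ =>
      simp only [cocycle_single, add_comm n m, B.supersymm i j x y hx hy]
      split_ifs with h
      · rw [show n = -m by omega]; push_cast; ring
      · simp

theorem bracket_jacobi (i j k : ZMod 2) (f g h : ℤ →₀ L) (hf : f ∈ homog parity i)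
    (hg : g ∈ homog parity j) (hh : h ∈ homog parity k) :
    bracket f (bracket g h) =
      bracket (bracket f g) h + ksgn i j • bracket g (bracket f h) := by
  induction f, hf using induct with
  | zero => simp
  | add f f' _ _ hf hf' => simp only [map_add, LinearMap.add_apply, hf, hf']; module
  | single m x hx _ =>
    induction g, hg using induct with
    | zero => simp
    | add f g _ _ hf hg => simp only [map_add, LinearMap.add_apply, hf, hg]; module
    | single n y hy _ =>
      induction h, hh using induct with
      | zero => simp
      | add f g _ _ hf hg => simp only [map_add, hf, hg]; module
      | single l z hz _ =>
        simp only [bracket_single, jacobi i j k x y z hx hy hz, Finsupp.single_add,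
          Finsupp.smul_single, add_assoc, add_left_comm n m l]

theorem cocycle_jacobi (B : InvariantForm L) (i j k : ZMod 2) (f g h : ℤ →₀ L)
    (hf : f ∈ homog parity i) (hg : g ∈ homog parity j) (hh : h ∈ homog parity k) :
    cocycle B f (bracket g h) =
      cocycle B (bracket f g) h + ksgn i j * cocycle B g (bracket f h) := by
  induction f, hf using induct with
  | zero => simp
  | add f f' _ _ hf hf' => simp only [map_add, LinearMap.add_apply, hf, hf']; ring
  | single m x hx _ =>
    induction g, hg using induct with
    | zero => simp
    | add f g _ _ hf hg => simp only [map_add, LinearMap.add_apply, hf, hg]; ring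
    | single n y hy _ =>
      induction h, hh using induct with
      | zero => simp
      | add f g _ _ hf hg => simp only [map_add, hf, hg]; ring
      | single l z hz _ =>
        have h1 := B.invariant x y z
        have h2 := B.invariant y x z
        rw [skew j i y x hy hx, ksgn_comm j i] at h2
        simp only [map_neg, map_smul, LinearMap.neg_apply, LinearMap.smul_apply,
          smul_eq_mul] at h2
        simp only [bracket_single, cocycle_single, add_assoc, add_left_comm n m l]
        split_ifs with h0
        · have hs := ksgn_mul_self i j
          rw [← h2, ← h1]; push_cast
          linear_combination (n : ℂ) * B.form (br x y) z * hs
        · simp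

end Loop

variable {L : Type*} [AddCommGroup L] [Module ℂ L] [LieSuperalgebra L]

/-- The underlying space `(L ⊗ ℂ[t, t⁻¹]) ⊕ ℂ K ⊕ ℂ d` of the affinization of `L` with respect to
an invariant form. -/
def Affinization (_B : InvariantForm L) : Type _ := (ℤ →₀ L) × ℂ × ℂ

instance (B : InvariantForm L) : AddCommGroup (Affinization B) :=
  inferInstanceAs (AddCommGroup ((ℤ →₀ L) × ℂ × ℂ))

instance (B : InvariantForm L) : Module ℂ (Affinization B) :=
  inferInstanceAs (Module ℂ ((ℤ →₀ L) × ℂ × ℂ))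

namespace Affinization

variable (B : InvariantForm L)

/-- The component in `L ⊗ ℂ[t, t⁻¹]`. -/
def loop : Affinization B →ₗ[ℂ] (ℤ →₀ L) := LinearMap.fst ℂ (ℤ →₀ L) (ℂ × ℂ)

/-- The coefficient of `K`. -/
def coeffK : Affinization B →ₗ[ℂ] ℂ := LinearMap.fst ℂ ℂ ℂ ∘ₗ LinearMap.snd ℂ (ℤ →₀ L) (ℂ × ℂ)

/-- The coefficient of `d`. -/
def coeffD : Affinization B →ₗ[ℂ] ℂ := LinearMap.snd ℂ ℂ ℂ ∘ₗ LinearMap.snd ℂ (ℤ →₀ L) (ℂ × ℂ)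

/-- The element `f + c K + s d`. -/
def mk (f : ℤ →₀ L) (c s : ℂ) : Affinization B := (f, c, s)

@[simp] theorem loop_mk (f : ℤ →₀ L) (c s : ℂ) : loop B (mk B f c s) = f := rfl
@[simp] theorem coeffK_mk (f : ℤ →₀ L) (c s : ℂ) : coeffK B (mk B f c s) = c := rfl
@[simp] theorem coeffD_mk (f : ℤ →₀ L) (c s : ℂ) : coeffD B (mk B f c s) = s := rfl

variable {B} in
theorem ext {x y : Affinization B} (h1 : loop B x = loop B y) (h2 : coeffK B x = coeffK B y)
    (h3 : coeffD B x = coeffD B y) : x = y :=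
  Prod.ext h1 (Prod.ext h2 h3)

/-- The bracket of the affinization: `[x t^m, y t^n] = [x, y] t^(m+n) + m δ_{m+n,0} B(x, y) K`,
`[d, x t^n] = n x t^n`, and `K` is central. -/
def bracket : Affinization B →ₗ[ℂ] Affinization B →ₗ[ℂ] Affinization B :=
  LinearMap.mk₂ ℂ
    (fun x y => mk B
      (Loop.bracket (loop B x) (loop B y) + coeffD B x • Loop.deriv (loop B y) -
        coeffD B y • Loop.deriv (loop B x))
      (Loop.cocycle B (loop B x) (loop B y)) 0)
    (by
      intro x x' y
      apply ext <;> simp [map_add]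
      module)
    (by
      intro c x y
      apply ext <;> simp [map_smul]
      module)
    (by
      intro x y y'
      apply ext <;> simp [map_add]
      module)
    (by
      intro c x y
      apply ext <;> simp [map_smul]
      module)

@[simp] theorem loop_bracket (x y : Affinization B) :
    loop B (bracket B x y) = Loop.bracket (loop B x) (loop B y) +
      coeffD B x • Loop.deriv (loop B y) - coeffD B y • Loop.deriv (loop B x) := rfl
@[simp] theorem coeffK_bracket (x y : Affinization B) :
    coeffK B (bracket B x y) = Loop.cocycle B (loop B x) (loop B y) := rfl
@[simp] theorem coeffD_bracket (x y : Affinization B) : coeffD B (bracket B x y) = 0 := rfl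

/-- The parity involution of the affinization; `K` and `d` are even. -/
def parity : Affinization B →ₗ[ℂ] Affinization B :=
  LinearMap.prodMap Loop.parity LinearMap.id

@[simp] theorem loop_parity (x : Affinization B) :
    loop B (parity B x) = Loop.parity (loop B x) := rfl
@[simp] theorem coeffK_parity (x : Affinization B) : coeffK B (parity B x) = coeffK B x := rfl
@[simp] theorem coeffD_parity (x : Affinization B) : coeffD B (parity B x) = coeffD B x := rfl

variable {B} in
theorem homog_loop {i : ZMod 2} {x : Affinization B} (hx : x ∈ homog (parity B) i) :
    loop B x ∈ homog Loop.parity i := by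
  rw [mem_homog] at hx ⊢
  rw [← loop_parity, hx, map_smul]

variable {B} in
theorem homog_coeffD {i : ZMod 2} {x : Affinization B} (hx : x ∈ homog (parity B) i) :
    i = 0 ∨ coeffD B x = 0 := by
  rw [mem_homog] at hx
  rcases val_cases i with rfl | rfl
  · exact Or.inl rfl
  · right
    have h := congrArg (coeffD B) hx
    simp only [coeffD_parity, map_smul, ZMod.val_one, pow_one, smul_eq_mul] at h
    linear_combination (1 / 2 : ℂ) * h

theorem ksgn_zero_left (j : ZMod 2) : ksgn 0 j = 1 := by simp [ksgn]

theorem ksgn_zero_right (j : ZMod 2) : ksgn j 0 = 1 := by simp [ksgn]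

theorem ksgn_mul_of (i j : ZMod 2) (c : ℂ) (h : i = 0 ∨ c = 0) : ksgn i j * c = c := by
  rcases h with rfl | rfl <;> simp [ksgn]

instance : LieSuperalgebra (Affinization B) where
  br := bracket B
  par := parity B
  par_par := by intro x; apply ext <;> simp [Loop.parity_parity]
  par_br := by
    intro x y
    apply ext <;> simp [Loop.parity_bracket, Loop.parity_deriv, Loop.parity_cocycle]
  skew := by
    intro i j x y hx hy
    have h1 := ksgn_mul_of i j _ (homog_coeffD hx)
    have h2 := ksgn_mul_of j i _ (homog_coeffD hy)
    rw [ksgn_comm] at h2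
    apply ext
    · simp only [loop_bracket, map_neg, map_smul, smul_sub, smul_add, smul_smul, h1, h2,
        Loop.bracket_skew i j _ _ (homog_loop hx) (homog_loop hy)]
      module
    · simp only [coeffK_bracket, map_neg, map_smul, smul_eq_mul]
      exact Loop.cocycle_skew B i j _ _ (homog_loop hx) (homog_loop hy)
    · simp
  jacobi := by
    intro i j k x y z hx hy hz
    have h1 := ksgn_mul_of i j _ (homog_coeffD hx)
    have h2 := ksgn_mul_of j i _ (homog_coeffD hy)
    rw [ksgn_comm] at h2
    have hdf : Loop.deriv (loop B x) ∈ homog Loop.parity i := by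
      have := homog_loop hx
      rw [mem_homog] at this ⊢
      rw [Loop.parity_deriv, this, map_smul]
    apply ext
    · have hJ := Loop.bracket_jacobi i j k _ _ _ (homog_loop hx) (homog_loop hy) (homog_loop hz)
      have hS := Loop.bracket_skew i j _ _ hdf (homog_loop hy)
      have e1 : ∀ w : ℤ →₀ L, ksgn i j • (coeffD B x • w) = coeffD B x • w := fun w => by
        rw [smul_smul, h1]
      have e2 : ∀ w : ℤ →₀ L, ksgn i j • (coeffD B y • w) = coeffD B y • w := fun w => by
        rw [smul_smul, h2]
      simp only [map_add, map_sub, map_smul, loop_bracket, coeffD_bracket, zero_smul, sub_zero,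
        LinearMap.add_apply, LinearMap.sub_apply, LinearMap.smul_apply, Loop.deriv_bracket,
        smul_add, smul_sub, e1, e2, hJ, hS]
      module
    · have hJ := Loop.cocycle_jacobi B i j k _ _ _ (homog_loop hx) (homog_loop hy) (homog_loop hz)
      have hS := Loop.cocycle_skew B i j _ _ hdf (homog_loop hy)
      simp only [map_add, map_sub, map_smul, loop_bracket, coeffK_bracket, smul_eq_mul,
        LinearMap.add_apply, LinearMap.sub_apply, LinearMap.smul_apply]
      have c1 := Loop.cocycle_deriv B (loop B x) (loop B y)
      have c2 := Loop.cocycle_deriv B (loop B x) (loop B z)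
      have c3 := Loop.cocycle_deriv B (loop B y) (loop B z)
      linear_combination hJ - coeffD B z * c1 + coeffD B z * hS - coeffD B x * c3 + coeffD B y * c2 -
        (Loop.cocycle B (loop B y) (Loop.deriv (loop B z))) * h1
    · simp

end Affinization

/-- The twisted affinization `L̂(L, σ, m)` for an automorphism `σ` of `L` with `σ ^ m = 1`: the
subalgebra of the affinization of `L` formed by `K`, `d` and the `x t^j` such that
`σ x = ε ^ j x`, where `ε = exp (2 π i / m)`. -/
def twistedAffinization (B : InvariantForm L) (σ : Iso L L) (m : ℕ) :
    SuperSubalgebra (Affinization B) where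
  carrier :=
    { carrier := {z | ∀ j : ℤ, σ.toEquiv (Affinization.loop B z j) =
        Complex.exp (2 * Real.pi * Complex.I / m) ^ j • Affinization.loop B z j}
      zero_mem' := by intro j; simp
      add_mem' := by
        intro x y hx hy j
        simp only [map_add, Finsupp.add_apply, hx j, hy j, smul_add]
      smul_mem' := by
        intro c x hx j
        simp only [map_smul, Finsupp.smul_apply, hx j]
        rw [smul_comm] }
  par_mem := by
    intro z hz j
    show σ.toEquiv (par (Affinization.loop B z j)) = _ • par (Affinization.loop B z j)
    rw [σ.map_par, hz j, map_smul]
  br_mem := by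
    intro z hz w hw j
    have hε : Complex.exp (2 * Real.pi * Complex.I / m) ≠ 0 := Complex.exp_ne_zero _
    have hD : ∀ z : ℤ →₀ L, Loop.deriv z j = (j : ℂ) • z j := by
      intro z
      induction z using Loop.induct' with
      | zero => simp
      | add f g hf hg => simp [hf, hg]
      | single n x => by_cases h : n = j <;> simp [h]
    have hB : σ.toEquiv (Loop.bracket (Affinization.loop B z) (Affinization.loop B w) j) =
        Complex.exp (2 * Real.pi * Complex.I / m) ^ j •
          Loop.bracket (Affinization.loop B z) (Affinization.loop B w) j := by
      simp only [Loop.bracket, Finsupp.lsum_apply, LinearMap.coe_mk, AddHom.coe_mk, Finsupp.sum,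
        LinearMap.coe_sum, Finset.sum_apply, Finsupp.finsetSum_apply, map_sum, Finset.smul_sum,
        LinearMap.comp_apply, Finsupp.lsingle_apply]
      refine Finset.sum_congr rfl fun a _ => Finset.sum_congr rfl fun b _ => ?_
      by_cases h : a + b = j
      · subst h
        simp only [Finsupp.single_eq_same, σ.map_br, hz a, hw b, map_smul, LinearMap.smul_apply,
          smul_smul, zpow_add₀ hε]
        rw [mul_comm]
      · simp [h]
    show σ.toEquiv ((Affinization.loop B (Affinization.bracket B z w)) j) =
      _ • (Affinization.loop B (Affinization.bracket B z w)) j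
    simp only [Affinization.loop_bracket, Finsupp.sub_apply, Finsupp.add_apply,
      Finsupp.smul_apply, hD, map_sub, map_add, map_smul, hB, hz j, hw j, smul_sub, smul_add,
      smul_comm (Complex.exp (2 * Real.pi * Complex.I / m) ^ j)]

end Affine

/-! ### `G(3)` and its affinizations -/

/-- The root datum with Cartan datum `(A, p)` for an invertible matrix `A`, with `𝔥 = ℂ^X`. -/
def rootDatumOfDet {X : Type*} [Fintype X] [DecidableEq X] (A : Matrix X X ℂ) (p : X → ZMod 2)
    (hA : A.det ≠ 0) : SuperRootDatum X (X → ℂ) where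
  finite := inferInstance
  a := fun x => Pi.single x 1
  b := fun y => Fintype.linearCombination ℂ fun x => A x y
  p := p
  a_indep := Pi.linearIndependent_single_one X ℂ
  b_indep := by
    have hcols : LinearIndependent ℂ fun y => A.col y :=
      Matrix.linearIndependent_cols_of_det_ne_zero hA
    let φ : Module.Dual ℂ (X → ℂ) →ₗ[ℂ] (X → ℂ) :=
      LinearMap.pi fun x => LinearMap.applyₗ (Pi.single x (1 : ℂ))
    refine LinearIndependent.of_comp φ ?_
    have e : (φ ∘ fun y => Fintype.linearCombination ℂ fun x => A x y) = fun y => A.col y := by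
      ext y x
      simp [φ, Matrix.col]
    rw [e]
    exact hcols

/-- The Gram matrix of the simple roots `ε₂, ε₃ - δ₁, δ₁ - ε₂` of `G(3)`, where
`ε₁ + ε₂ + ε₃ = 0`, `(ε_i, ε_i) = 1`, `(ε_i, ε_j) = -1/2`, `(ε_i, δ₁) = 0`, `(δ₁, δ₁) = -1`. -/
def cartanG3 : Matrix (Fin 3) (Fin 3) ℂ :=
  !![1, -1/2, -1;
     -1/2, 0, 3/2;
     -1, 3/2, 0]

/-- The parities of `ε₂, ε₃ - δ₁, δ₁ - ε₂`: `p(ε_i) = 0`, `p(δ₁) = 1`. -/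
def parityG3 : Fin 3 → ZMod 2 := ![0, 1, 1]

theorem cartanG3_det : cartanG3.det ≠ 0 := by
  simp [cartanG3, Matrix.det_fin_three]
  norm_num

/-- The root datum of `G(3)`. -/
def datumG3 : SuperRootDatum (Fin 3) (Fin 3 → ℂ) := rootDatumOfDet cartanG3 parityG3 cartanG3_det

/-- The basic classical Lie superalgebra `G(3)`. -/
abbrev G3 : Type := Contragredient datumG3

/-- The element `h ∈ 𝔥` with `⟨h, α₁⟩ = π i` and `⟨h, α₂⟩ = ⟨h, α₃⟩ = 0`. -/
def hG3 : Fin 3 → ℂ := (Real.pi * Complex.I) • ![3, 2, 1]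

theorem hG3_spec : datumG3.b 0 hG3 = Real.pi * Complex.I ∧ datumG3.b 1 hG3 = 0 ∧
    datumG3.b 2 hG3 = 0 := by
  refine ⟨?_, ?_, ?_⟩ <;>
    simp [datumG3, rootDatumOfDet, hG3, Fintype.linearCombination_apply, Fin.sum_univ_three,
      cartanG3] <;> ring

/-- The automorphism `σ = exp (ad h)` of `G(3)`, of order two. -/
def sigmaG3 : Iso G3 G3 := expAd datumG3 hG3

/-- The affine Lie superalgebra `G(3)^{(1)}`. -/
abbrev G3Aff1 : Type := Affinization (killing G3)

/-- The twisted affine Lie superalgebra `G(3)^{(2)}`. -/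
abbrev G3Aff2 : Type := (twistedAffinization (killing G3) sigmaG3 2).carrier

/-- The Cartan matrix `A`: the Gram matrix of
`ε₃ - δ₁, δ + ε₁ - ε₃, ε₂, δ₁ - ε₂`, where `δ` is isotropic and orthogonal to all roots. -/
def cartanG3Aff1 : Matrix (Fin 4) (Fin 4) ℂ :=
  !![0, -3/2, -1/2, 3/2;
     -3/2, 3, 0, 0;
     -1/2, 0, 1, -1;
     3/2, 0, -1, 0]

/-- The Cartan matrix `A'`: the Gram matrix of
`ϵ₃ - ϵ₂ - ϵ₁, 2ϵ₁, 2ϵ₂, δ - (ϵ₃ + 2ϵ₂)`, where `ϵ₁, ϵ₂, ϵ₃` are orthogonal of squares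
`3/2, 1/2, -2` and `δ` is isotropic and orthogonal to all roots. -/
def cartanG3Aff2 : Matrix (Fin 4) (Fin 4) ℂ :=
  !![0, -3, -1, 3;
     -3, 6, 0, 0;
     -1, 0, 2, -2;
     3, 0, -2, 0]

/-- The common parity function of the two Cartan data: the first and the fourth simple roots
are odd. -/
def parityG3Aff : Fin 4 → ZMod 2 := ![1, 0, 0, 1]

end

/-!
The four simple generators of an affine Lie superalgebra are found inside the affinization, and a
recognition principle identifies the affinization with the contragredient superalgebra. The
principle (`Realization.ker_lift`, `Realization.isoOfKer`) says: if `L` is generated by elements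
`ι h`, `e x`, `f x` that satisfy the relations of `𝔤̃(v)`, if `ι` is injective, and if every nonzero
graded ideal of `L` meets `ι 𝔥`, then `L ≅ 𝔤(v)`. For the proof, the kernel of `𝔤̃(v) → L` avoids
`𝔥`, so it lies in the maximal ideal; conversely an ideal `J` of `𝔤̃(v)` avoiding `𝔥` has an image
that avoids `ι 𝔥`, because by the triangular decomposition `𝔤̃(v) = 𝔫₋ + 𝔥 + 𝔫₊`
(`Realization.triangular`) the `𝔥`-component of an element of `J` is its component of height zero
and so lies in `J`.

The principle is used twice. First, `G(3)` is identified with an explicit superalgebra `G3Model` of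
dimension 31, given by a table of integer structure constants whose super Jacobi identity is checked
by computation. This gives the finite dimension of `G(3)`, its simplicity (`G3Model.ideal_eq_top`),
its lowest and highest root vectors, and the value `κ(e_{-θ}, e_θ) = 6 ≠ 0` of the Killing form.
Secondly, in the affinization of the model the fourth pair of generators is `e_{-θ} t`,
`e_θ t⁻¹`, where `θ = 3 α₁ + 2 α₂ + 2 α₃` (`G3Model.affRealization`). As `κ(e_{-θ}, e_θ) ≠ 0`, the
simple coroots are linearly independent. Simplicity of `G(3)` gives both generation
(`G3Model.aff_generates`) and the ideal criterion (`G3Model.aff_ideal_eq_bot`): the coefficients at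
`t ^ m` of an ideal form an ideal of `G(3)`. Scaling the `f x` by `2` scales the Cartan matrix
by `2`, so the affinization admits both `A` and `A' = 2 A`.

Finally, an inner automorphism gives a twisted affinization isomorphic to the untwisted one. Let
`h₀ ∈ 𝔥` have integer eigenvalues on `𝔤` and let `σ = (-1) ^ (ad h₀)`. For `[h₀, x] = n x` the map
`x t^m ↦ x t^(2m + n) + δ_{m,0} κ(h₀, x) K`, `K ↦ 2 K`, `d ↦ (d - h₀) / 2` is an isomorphism of
the affinization onto the twisted one (`IntegralBasis.untwistIso`).
-/

noncomputable section

open LieSuperalgebra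

/-! ### Structure constants of `G(3)` -/

namespace G3Model

/-- Structure constants of `G(3)`: an entry `(j, k, c)` of row `i`, where `i ≤ j`, means that `b k`
occurs in `[b i, b j]` with coefficient `c`. Here `b 0, b 1, b 2` is the basis of `𝔥` dual to
`α₁, α₂, α₃`, the elements `b 3, …, b 16` are root vectors for the positive roots in order of
height, starting with `α₁, α₂, α₃`, and for `3 ≤ k ≤ 16` the element `b (14 + k)` is a root vector
for the root opposite to that of `b k`. The root vectors are scaled so that the constants are
integers; for `x = 0, 1, 2` the bracket `[b (3 + x), b (17 + x)]` is twice the simple coroot. -/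
def table : List (List (ℕ × ℕ × ℤ)) :=
  [[(3, 3, 1), (6, 6, 1), (7, 7, 1), (9, 9, 2), (10, 10, 1), (11, 11, 2), (12, 12, 2),
    (13, 13, 3), (14, 14, 2), (15, 15, 3), (16, 16, 3), (17, 17, -1), (20, 20, -1), (21, 21, -1),
    (23, 23, -2), (24, 24, -1), (25, 25, -2), (26, 26, -2), (27, 27, -3), (28, 28, -2),
    (29, 29, -3), (30, 30, -3)],
   [(4, 4, 1), (6, 6, 1), (8, 8, 1), (10, 10, 1), (11, 11, 1), (13, 13, 1), (14, 14, 1),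
    (15, 15, 1), (16, 16, 2), (18, 18, -1), (20, 20, -1), (22, 22, -1), (24, 24, -1),
    (25, 25, -1), (27, 27, -1), (28, 28, -1), (29, 29, -1), (30, 30, -2)],
   [(5, 5, 1), (7, 7, 1), (8, 8, 1), (9, 9, 1), (10, 10, 1), (11, 11, 1), (12, 12, 2),
    (13, 13, 1), (14, 14, 2), (15, 15, 2), (16, 16, 2), (19, 19, -1), (21, 21, -1), (22, 22, -1),
    (23, 23, -1), (24, 24, -1), (25, 25, -1), (26, 26, -2), (27, 27, -1), (28, 28, -2),
    (29, 29, -2), (30, 30, -2)],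
   [(4, 6, -1), (5, 7, -1), (7, 9, 2), (8, 10, -3), (10, 11, 2), (11, 13, 3), (14, 15, 1),
    (17, 0, 2), (17, 1, -1), (17, 2, -2), (20, 18, -1), (21, 19, -2), (23, 21, 1), (24, 22, -1),
    (25, 24, 2), (27, 25, 1), (29, 28, 1)],
   [(5, 8, 1), (7, 10, 2), (9, 11, 1), (12, 14, -4), (15, 16, 1), (18, 0, -1), (18, 2, 3),
    (20, 17, 1), (22, 19, -3), (24, 21, -1), (25, 23, -1), (28, 26, 1), (30, 29, -3)],
   [(6, 10, 1), (9, 12, 1), (11, 14, 1), (13, 15, 1), (19, 0, -2), (19, 1, 3), (21, 17, 2),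
    (22, 18, -3), (24, 20, -1), (26, 23, 4), (28, 25, 1), (29, 27, 3)],
   [(7, 11, -2), (9, 13, -3), (12, 15, 4), (14, 16, 1), (17, 4, 1), (18, 3, -1), (20, 0, -1),
    (20, 1, 1), (20, 2, -1), (24, 19, 1), (25, 21, -1), (27, 23, -1), (29, 26, 1), (30, 28, 3)],
   [(7, 12, 2), (10, 14, 2), (11, 15, 2), (17, 5, 2), (19, 3, -2), (21, 1, -4), (21, 2, 4),
    (23, 17, 2), (24, 18, 2), (25, 20, -2), (26, 21, -4), (28, 24, -2), (29, 25, -2)],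
   [(9, 14, -3), (13, 16, 1), (18, 5, -3), (19, 4, -3), (22, 0, 9), (22, 1, -9), (22, 2, -9),
    (24, 17, -3), (28, 23, 3), (30, 27, -9)],
   [(10, 15, -1), (17, 7, -1), (21, 3, -2), (23, 0, 2), (23, 1, 1), (23, 2, -4), (25, 18, -1),
    (26, 19, 4), (27, 20, 1), (28, 22, 1), (29, 24, -1)],
   [(11, 16, 1), (17, 8, 1), (18, 7, -1), (19, 6, -1), (20, 5, 1), (21, 4, 2), (22, 3, 3),
    (24, 0, -1), (24, 1, 2), (24, 2, 1), (25, 17, -2), (28, 21, -1), (29, 23, 1), (30, 25, 3)],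
   [(17, 10, -2), (18, 9, -1), (20, 7, -1), (21, 6, -2), (23, 4, -1), (24, 3, 2), (25, 0, -1),
    (25, 1, -1), (25, 2, 1), (27, 17, 1), (28, 19, 1), (29, 21, 1), (30, 24, 3)],
   [(19, 9, 4), (21, 7, -4), (23, 5, 4), (26, 1, 16), (26, 2, -16), (28, 18, -4), (29, 20, 4)],
   [(17, 11, -1), (20, 9, -1), (23, 6, 1), (25, 3, -1), (27, 0, 1), (27, 2, -1), (29, 19, -1),
    (30, 22, -1)],
   [(18, 12, -1), (19, 11, -1), (21, 10, 2), (22, 9, -3), (23, 8, -1), (24, 7, 1), (25, 5, -1),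
    (26, 4, 4), (28, 0, -1), (28, 1, 4), (28, 2, -1), (29, 17, -1), (30, 20, -3)],
   [(17, 14, -1), (19, 13, -3), (20, 12, -1), (21, 11, 2), (23, 10, 1), (24, 9, -1), (25, 7, -1),
    (26, 6, -4), (27, 5, 1), (28, 3, 1), (29, 0, -1), (29, 1, -3), (29, 2, 3), (30, 18, 3)],
   [(18, 15, -3), (20, 14, 3), (22, 13, 9), (24, 11, -3), (25, 10, -3), (27, 8, 1), (28, 6, -3),
    (29, 4, 3), (30, 1, 9)],
   [(18, 20, -1), (19, 21, -1), (21, 23, 2), (22, 24, -3), (24, 25, 2), (25, 27, 3), (28, 29, 1)],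
   [(19, 22, 1), (21, 24, 2), (23, 25, 1), (26, 28, -4), (29, 30, 1)],
   [(20, 24, 1), (23, 26, 1), (25, 28, 1), (27, 29, 1)],
   [(21, 25, -2), (23, 27, -3), (26, 29, 4), (28, 30, 1)],
   [(21, 26, 2), (24, 28, 2), (25, 29, 2)],
   [(23, 28, -3), (27, 30, 1)],
   [(24, 29, -1)],
   [(25, 30, 1)],
   [],
   [],
   [],
   [],
   [],
   []]

/-- The parities of the basis vectors. -/
def parityList : List ℕ :=
  [0, 0, 0, 0, 1, 1, 1, 1, 0, 1, 0, 0, 0, 0, 1, 1, 0, 0, 1, 1, 1, 1, 0, 1, 0, 0, 0, 0, 1, 1, 0]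

/-- The parity of `b i`, as a natural number. -/
def parNat (i : ℕ) : ℕ := parityList.getD i 0

/-- The sign `(-1)^{p(i) p(j)}`, as an integer. -/
def sgn (i j : ℕ) : ℤ := bif Nat.beq (parNat i * parNat j) 1 then -1 else 1

/-- A sparse integer vector: `(k, c)` stands for `c • b k`, and the list for the sum of its entries.
The operations on sparse vectors are written so that the kernel evaluates them quickly. -/
abbrev SVec := List (ℕ × ℤ)

/-- The entries of a row of `table` that describe the bracket with the `m`-th basis vector. -/
def lookup : List (ℕ × ℕ × ℤ) → ℕ → SVec
  | [], _ => []
  | (j, k, c) :: l, m => bif Nat.beq j m then (k, c) :: lookup l m else lookup l m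

/-- The multiple of a sparse vector by an integer. -/
def scale (c : ℤ) : SVec → SVec
  | [] => []
  | (k, d) :: l => (k, c * d) :: scale c l

/-- The bracket `[b i, b j]`; for `j < i` it comes from `[b j, b i]` by the rule of signs. -/
def brVec (i j : ℕ) : SVec :=
  bif Nat.ble i j then lookup (table.getD i []) j
  else scale (- sgn i j) (lookup (table.getD j []) i)

/-- The coefficient of `b m` in a sparse vector. -/
def coef : SVec → ℕ → ℤ
  | [], _ => 0
  | (k, c) :: l, m => bif Nat.beq k m then c + coef l m else coef l m

/-- The bracket of `b i` with a sparse vector. -/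
def adL (i : ℕ) : SVec → SVec
  | [] => []
  | (k, c) :: l => scale c (brVec i k) ++ adL i l

/-- The bracket of a sparse vector with `b k`. -/
def adR (k : ℕ) : SVec → SVec
  | [] => []
  | (i, c) :: l => scale c (brVec i k) ++ adR k l

/-- Whether a sparse vector represents zero. -/
def isZero (l : SVec) : Bool := l.all fun x => Int.beq' (coef l x.1) 0

/-- The defect `[b i, [b j, b k]] - [[b i, b j], b k] - (-1)^{p(i) p(j)} [b j, [b i, b k]]` of the
super Jacobi identity. -/
def jacobiator (i j k : ℕ) : SVec :=
  adL i (brVec j k) ++ (scale (-1) (adR k (brVec i j)) ++ scale (- sgn i j) (adL j (brVec i k)))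

/-- The indices of the basis, as literals, which the kernel compares quickly. -/
def idxList : List ℕ := [0, 1, 2, 3, 4, 5, 6, 7, 8, 9, 10, 11, 12, 13, 14, 15, 16, 17, 18, 19, 20,
  21, 22, 23, 24, 25, 26, 27, 28, 29, 30]

/-- Whether a test succeeds for all indices of the basis. -/
def allIdx (P : ℕ → Bool) : Bool := idxList.all P

/-- The super Jacobi identity for the triples `i ≤ j ≤ k`. -/
def jacobiCheck : Bool := allIdx fun i => allIdx fun j => Nat.blt j i || allIdx fun k =>
  Nat.blt k j || isZero (jacobiator i j k)

theorem jacobiCheck_eq : jacobiCheck = true := by decide +kernel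

/-- The rule of signs; it is not automatic for `i = j`. -/
def skewCheck : Bool := allIdx fun i => allIdx fun j =>
  isZero (brVec i j ++ scale (sgn i j) (brVec j i))

theorem skewCheck_eq : skewCheck = true := by decide +kernel

/-- All indices that occur are less than `31`, and the bracket is even. -/
def rangeCheck : Bool := allIdx fun i => allIdx fun j => (brVec i j).all fun x =>
  Nat.blt x.1 31 && Nat.beq (parNat x.1) ((parNat i + parNat j) % 2)

theorem rangeCheck_eq : rangeCheck = true := by decide +kernel

theorem allIdx_apply {P : ℕ → Bool} (h : allIdx P = true) (i : Fin 31) : P i = true := by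
  rw [allIdx, List.all_eq_true] at h
  exact h i (by revert i; decide)

theorem isZero_jacobiator {i j k : Fin 31} (hij : i ≤ j) (hjk : j ≤ k) :
    isZero (jacobiator i j k) = true := by
  have h1 := allIdx_apply (allIdx_apply jacobiCheck_eq i) j
  rw [Bool.or_eq_true] at h1
  have h2 := allIdx_apply (h1.resolve_left (by simpa [Nat.blt_eq] using hij)) k
  rw [Bool.or_eq_true] at h2
  exact h2.resolve_left (by simpa [Nat.blt_eq] using hjk)

theorem isZero_skew (i j : Fin 31) : isZero (brVec i j ++ scale (sgn i j) (brVec j i)) = true :=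
  allIdx_apply (allIdx_apply skewCheck_eq i) j

theorem range_brVec (i j : Fin 31) {x : ℕ × ℤ} (hx : x ∈ brVec i j) :
    x.1 < 31 ∧ parNat x.1 = (parNat i + parNat j) % 2 := by
  have := List.all_eq_true.1 (allIdx_apply (allIdx_apply rangeCheck_eq i) j) x hx
  simpa [Nat.blt_eq] using this

end G3Model

/-! ### The explicit model of `G(3)` -/

/-- The underlying space of the model of `G(3)` with the structure constants `G3Model.table`. -/
def G3Model : Type := Fin 31 → ℂ

instance : AddCommGroup G3Model := inferInstanceAs (AddCommGroup (Fin 31 → ℂ))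

instance : Module ℂ G3Model := inferInstanceAs (Module ℂ (Fin 31 → ℂ))

namespace G3Model

/-- The standard basis, ordered as in `table`. -/
def b : Module.Basis (Fin 31) ℂ G3Model := Pi.basisFun ℂ (Fin 31)

/-- The basis vector with a natural number as its index, zero if the index is out of range. -/
def bN (k : ℕ) : G3Model := if h : k < 31 then b ⟨k, h⟩ else 0

theorem bN_coe (i : Fin 31) : bN i = b i := by simp [bN]

/-- The element of the model that a sparse vector represents. -/
def vec : SVec → G3Model
  | [] => 0
  | (k, c) :: l => (c : ℂ) • bN k + vec l

@[simp] theorem vec_append (l l' : SVec) : vec (l ++ l') = vec l + vec l' := by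
  induction l with
  | nil => simp [vec]
  | cons x l ih => simp [vec, ih, add_assoc]

@[simp] theorem vec_scale (c : ℤ) (l : SVec) : vec (scale c l) = (c : ℂ) • vec l := by
  induction l with
  | nil => simp [vec, scale]
  | cons x l ih => simp [vec, scale, ih, smul_smul]

theorem vec_apply (l : SVec) (m : Fin 31) : b.repr (vec l) m = coef l m := by
  induction l with
  | nil => simp [vec, coef]
  | cons x l ih =>
    obtain ⟨k, c⟩ := x
    rw [vec, coef, map_add, map_smul, Finsupp.add_apply, Finsupp.smul_apply, ih]
    by_cases h : k = m
    · subst h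
      simp [bN_coe]
    · have h0 : b.repr (bN k) m = 0 := by
        rw [bN]
        split_ifs with hk
        · rw [Module.Basis.repr_self, Finsupp.single_apply, if_neg]
          rintro rfl
          exact h rfl
        · simp
      have hb : Nat.beq k m = false := by
        rw [← Bool.not_eq_true, Nat.beq_eq]; exact h
      simp [h0, hb]

theorem coef_eq_zero_of_notMem (l : SVec) (m : ℕ) (h : ∀ x ∈ l, x.1 ≠ m) : coef l m = 0 := by
  induction l with
  | nil => rfl
  | cons x l ih =>
    obtain ⟨k, c⟩ := x
    have hb : Nat.beq k m = false := by
      rw [← Bool.not_eq_true, Nat.beq_eq]; exact h _ List.mem_cons_self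
    rw [coef, hb]
    exact ih fun x hx => h x (List.mem_cons_of_mem _ hx)

theorem vec_eq_zero {l : SVec} (h : isZero l = true) : vec l = 0 := by
  rw [isZero, List.all_eq_true] at h
  apply b.repr.injective
  ext m
  rw [vec_apply]
  by_cases hm : ∃ x ∈ l, x.1 = m
  · obtain ⟨x, hx, hxm⟩ := hm
    have := h x hx
    simp [← hxm, by simpa using this]
  · push Not at hm
    simp [coef_eq_zero_of_notMem l m hm]

/-- The bracket of the model. -/
def brG : G3Model →ₗ[ℂ] G3Model →ₗ[ℂ] G3Model :=
  b.constr ℂ fun i => b.constr ℂ fun j => vec (brVec i j)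

theorem brG_b (i j : Fin 31) : brG (b i) (b j) = vec (brVec i j) := by
  simp [brG]

/-- The parity of a basis vector. -/
def p (i : Fin 31) : ZMod 2 := parNat i

/-- The parity involution of the model. -/
def parG : G3Model →ₗ[ℂ] G3Model := b.constr ℂ fun i => ((-1) ^ (p i).val : ℂ) • b i

theorem parG_b (i : Fin 31) : parG (b i) = ((-1) ^ (p i).val : ℂ) • b i := by simp [parG]

theorem parNat_cases (i : Fin 31) : parNat i = 0 ∨ parNat i = 1 := by
  revert i; decide

theorem sgn_eq (i j : Fin 31) : (sgn i j : ℂ) = ksgn (p i) (p j) := by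
  unfold sgn p
  rcases parNat_cases i with h | h <;> rcases parNat_cases j with h' | h' <;>
    simp [h, h', ksgn, show Nat.beq 0 1 = false from rfl, ZMod.val_one]

theorem brG_vec_right (i : Fin 31) {l : SVec} (hl : ∀ x ∈ l, x.1 < 31) :
    brG (b i) (vec l) = vec (adL i l) := by
  induction l with
  | nil => simp [vec, adL]
  | cons x l ih =>
    obtain ⟨k, c⟩ := x
    have hk : k < 31 := hl _ List.mem_cons_self
    have := brG_b i ⟨k, hk⟩
    rw [vec, adL, map_add, map_smul, ih fun x hx => hl x (List.mem_cons_of_mem _ hx)]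
    simp [bN, hk, this]

theorem brG_vec_left (i : Fin 31) {l : SVec} (hl : ∀ x ∈ l, x.1 < 31) :
    brG (vec l) (b i) = vec (adR i l) := by
  induction l with
  | nil => simp [vec, adR]
  | cons x l ih =>
    obtain ⟨k, c⟩ := x
    have hk : k < 31 := hl _ List.mem_cons_self
    have := brG_b ⟨k, hk⟩ i
    rw [vec, adR, map_add, map_smul, LinearMap.add_apply, LinearMap.smul_apply,
      ih fun x hx => hl x (List.mem_cons_of_mem _ hx)]
    simp [bN, hk, this]

theorem skew_b (i j : Fin 31) : brG (b i) (b j) = -(ksgn (p i) (p j) • brG (b j) (b i)) := by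
  have := vec_eq_zero (isZero_skew i j)
  rw [vec_append, vec_scale, ← brG_b, ← brG_b, sgn_eq] at this
  exact eq_neg_of_add_eq_zero_left this

/-- The super Jacobi identity for `x`, `y`, `z`, where `x` and `y` have the parities `i` and `j`. -/
def Jacobi (i j : ZMod 2) (x y z : G3Model) : Prop :=
  brG x (brG y z) = brG (brG x y) z + ksgn i j • brG y (brG x z)

theorem jacobi_b_of_le {i j k : Fin 31} (hij : i ≤ j) (hjk : j ≤ k) :
    Jacobi (p i) (p j) (b i) (b j) (b k) := by
  have := vec_eq_zero (isZero_jacobiator hij hjk)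
  rw [jacobiator, vec_append, vec_append, vec_scale, vec_scale,
    ← brG_vec_right _ fun x hx => (range_brVec _ _ hx).1,
    ← brG_vec_right _ fun x hx => (range_brVec _ _ hx).1,
    ← brG_vec_left _ fun x hx => (range_brVec _ _ hx).1] at this
  simp only [← brG_b, Int.cast_neg, sgn_eq, Int.cast_one] at this
  rw [Jacobi, ← sub_eq_zero, ← this]
  module

theorem b_mem_homog (i : Fin 31) : b i ∈ homog parG (p i) := by
  rw [mem_homog, parG_b]

theorem homog_le_span (i : ZMod 2) :
    homog parG i ≤ Submodule.span ℂ (b '' {a | p a = i}) := by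
  intro x hx
  rw [← b.sum_repr x]
  refine Submodule.sum_mem _ fun a _ => ?_
  by_cases h : p a = i
  · exact Submodule.smul_mem _ _ (Submodule.subset_span ⟨a, h, rfl⟩)
  · have e : ∀ y, b.repr (parG y) a = (-1) ^ (p a).val * b.repr y a := by
      intro y
      have : (Finsupp.lapply a ∘ₗ b.repr.toLinearMap ∘ₗ parG) =
          ((-1) ^ (p a).val : ℂ) • (Finsupp.lapply a ∘ₗ b.repr.toLinearMap) := by
        refine b.ext fun c => ?_
        by_cases hc : c = a
        · subst hc; simp [parG_b]
        · simp [parG_b, hc]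
      exact LinearMap.congr_fun this y
    rw [mem_homog] at hx
    have h1 := e x
    rw [hx, map_smul, Finsupp.smul_apply, smul_eq_mul] at h1
    have h2 : b.repr x a = 0 := by
      generalize p a = q at *
      rcases val_cases i with rfl | rfl <;> rcases val_cases q with rfl | rfl
      · exact absurd rfl h
      · simp [ZMod.val_one] at h1; linear_combination (1 / 2 : ℂ) * h1
      · simp [ZMod.val_one] at h1; linear_combination (-1 / 2 : ℂ) * h1
      · exact absurd rfl h
    rw [h2, zero_smul]
    exact Submodule.zero_mem _

/-- A property of homogeneous elements that is linear need only be checked on basis vectors. -/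
theorem homog_induction {i : ZMod 2} {P : G3Model → Prop} (h0 : P 0)
    (hadd : ∀ x y, P x → P y → P (x + y)) (hsmul : ∀ (c : ℂ) x, P x → P (c • x))
    (hb : ∀ a, p a = i → P (b a)) {x : G3Model} (hx : x ∈ homog parG i) : P x := by
  have h := homog_le_span i hx
  clear hx
  induction h using Submodule.span_induction with
  | mem x h =>
    obtain ⟨a, ha, rfl⟩ := h
    exact hb a ha
  | zero => exact h0
  | add x y _ _ hx hy => exact hadd x y hx hy
  | smul c x _ hx => exact hsmul c x hx

theorem brG_skew (i j : ZMod 2) (x y : G3Model) (hx : x ∈ homog parG i) (hy : y ∈ homog parG j) :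
    brG x y = -(ksgn i j • brG y x) := by
  refine homog_induction (P := fun x => brG x y = -(ksgn i j • brG y x)) (by simp)
    (fun x x' h h' => ?_) (fun c x h => ?_) (fun a ha => ?_) hx
  · rw [map_add, map_add, LinearMap.add_apply, h, h']; module
  · rw [map_smul, map_smul, LinearMap.smul_apply, h]; module
  refine homog_induction (P := fun y => brG (b a) y = -(ksgn i j • brG y (b a))) (by simp)
    (fun x x' h h' => ?_) (fun c x h => ?_) (fun c hc => ?_) hy
  · rw [map_add, map_add, LinearMap.add_apply, h, h']; module
  · rw [map_smul, map_smul, LinearMap.smul_apply, h]; module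
  subst ha hc
  exact skew_b a c

theorem vec_mem_homog {l : SVec} {i : ZMod 2} (hl : ∀ x ∈ l, x.1 < 31 ∧ (parNat x.1 : ZMod 2) = i) :
    vec l ∈ homog parG i := by
  induction l with
  | nil => exact Submodule.zero_mem _
  | cons x l ih =>
    obtain ⟨k, c⟩ := x
    obtain ⟨hk, hp⟩ := hl _ List.mem_cons_self
    refine Submodule.add_mem _ (Submodule.smul_mem _ _ ?_)
      (ih fun x hx => hl x (List.mem_cons_of_mem _ hx))
    have := b_mem_homog ⟨k, hk⟩
    rw [p, hp] at this
    simpa [bN, hk] using this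

theorem brG_b_mem_homog (i j : Fin 31) : brG (b i) (b j) ∈ homog parG (p i + p j) := by
  rw [brG_b]
  refine vec_mem_homog fun x hx => ⟨(range_brVec i j hx).1, ?_⟩
  rw [(range_brVec i j hx).2, p, p, ← Nat.cast_add, ZMod.natCast_mod]

theorem brG_mem_homog {i j : ZMod 2} {x y : G3Model} (hx : x ∈ homog parG i)
    (hy : y ∈ homog parG j) : brG x y ∈ homog parG (i + j) := by
  refine homog_induction (P := fun x => brG x y ∈ homog parG (i + j)) (by simp)
    (fun x x' h h' => ?_) (fun c x h => ?_) (fun a ha => ?_) hx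
  · rw [map_add]; exact Submodule.add_mem _ h h'
  · rw [map_smul]; exact Submodule.smul_mem _ _ h
  refine homog_induction (P := fun y => brG (b a) y ∈ homog parG (i + j)) (by simp)
    (fun x x' h h' => ?_) (fun c x h => ?_) (fun c hc => ?_) hy
  · rw [map_add]; exact Submodule.add_mem _ h h'
  · rw [map_smul]; exact Submodule.smul_mem _ _ h
  subst ha hc
  exact brG_b_mem_homog a c

theorem Jacobi.swap_left {i j : ZMod 2} {x y z : G3Model} (hx : x ∈ homog parG i)
    (hy : y ∈ homog parG j) (h : Jacobi i j x y z) : Jacobi j i y x z := by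
  unfold Jacobi at *
  have hs := ksgn_mul_self i j
  rw [h, brG_skew j i y x hy hx, ksgn_comm j i, smul_add, smul_smul, hs]
  simp

theorem Jacobi.swap_right {i j k : ZMod 2} {x y z : G3Model} (hx : x ∈ homog parG i)
    (hy : y ∈ homog parG j) (hz : z ∈ homog parG k) (h : Jacobi i j x y z) : Jacobi i k x z y := by
  unfold Jacobi at *
  rw [brG_skew _ _ z y hz hy, brG_skew _ _ _ _ (brG_mem_homog hx hz) hy,
    brG_skew _ _ _ _ hz (brG_mem_homog hx hy), map_neg, map_smul, h]
  have e1 : ksgn (i + k) j = ksgn i j * ksgn k j := by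
    rcases val_cases i with rfl | rfl <;> rcases val_cases j with rfl | rfl <;>
      rcases val_cases k with rfl | rfl <;>
        simp [ksgn, show (1 + 1 : ZMod 2) = 0 from rfl, ZMod.val_one]
  have e2 : ksgn i k * ksgn k (i + j) = ksgn k j := by
    rcases val_cases i with rfl | rfl <;> rcases val_cases j with rfl | rfl <;>
      rcases val_cases k with rfl | rfl <;>
        simp [ksgn, show (1 + 1 : ZMod 2) = 0 from rfl, ZMod.val_one]
  rw [e1, smul_neg (ksgn i k), smul_smul (ksgn i k), e2]
  module

/-- The super Jacobi identity is symmetric in its three arguments up to sign, so the sorted triples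
suffice. -/
theorem jacobi_b (i j k : Fin 31) : Jacobi (p i) (p j) (b i) (b j) (b k) := by
  have m := b_mem_homog
  rcases le_total i j with h1 | h1 <;> rcases le_total j k with h2 | h2 <;>
    rcases le_total i k with h3 | h3
  · exact jacobi_b_of_le h1 h2
  · exact jacobi_b_of_le h1 h2
  · exact (jacobi_b_of_le h3 h2).swap_right (m _) (m _) (m _)
  · exact ((jacobi_b_of_le h3 h1).swap_left (m _) (m _)).swap_right (m _) (m _) (m _)
  · exact (jacobi_b_of_le h1 h3).swap_left (m _) (m _)
  · exact ((jacobi_b_of_le h2 h3).swap_right (m _) (m _) (m _)).swap_left (m _) (m _)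
  · exact (((jacobi_b_of_le h2 h1).swap_left (m _) (m _)).swap_right (m _) (m _) (m _)).swap_left
      (m _) (m _)
  · exact (((jacobi_b_of_le h2 h1).swap_left (m _) (m _)).swap_right (m _) (m _) (m _)).swap_left
      (m _) (m _)

theorem brG_jacobi (i j k : ZMod 2) (x y z : G3Model) (hx : x ∈ homog parG i)
    (hy : y ∈ homog parG j) (hz : z ∈ homog parG k) : Jacobi i j x y z := by
  refine homog_induction (P := fun x => Jacobi i j x y z) (by simp [Jacobi]) (fun x x' h h' => ?_)
    (fun c x h => ?_) (fun a ha => ?_) hx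
  · simp only [Jacobi, map_add, LinearMap.add_apply] at *; rw [h, h']; module
  · simp only [Jacobi, map_smul, LinearMap.smul_apply] at *; rw [h]; module
  refine homog_induction (P := fun y => Jacobi i j (b a) y z) (by simp [Jacobi])
    (fun x x' h h' => ?_)
    (fun c x h => ?_) (fun c hc => ?_) hy
  · simp only [Jacobi, map_add, LinearMap.add_apply] at *; rw [h, h']; module
  · simp only [Jacobi, map_smul, LinearMap.smul_apply] at *; rw [h]; module
  refine homog_induction (P := fun z => Jacobi i j (b a) (b c) z) (by simp [Jacobi])
    (fun x x' h h' => ?_)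
    (fun c x h => ?_) (fun d _ => ?_) hz
  · simp only [Jacobi, map_add] at *; rw [h, h']; module
  · simp only [Jacobi, map_smul] at *; rw [h]; module
  subst ha hc
  exact jacobi_b a c d

theorem parG_mem {i : ZMod 2} {x : G3Model} (hx : x ∈ homog parG i) :
    parG x = ((-1) ^ i.val : ℂ) • x := mem_homog.1 hx

instance : LieSuperalgebra G3Model where
  br := brG
  par := parG
  par_par := by
    intro x
    have : parG ∘ₗ parG = LinearMap.id := by
      refine b.ext fun i => ?_
      simp [parG_b, smul_smul, ← mul_pow]
    exact LinearMap.congr_fun this x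
  par_br := by
    intro x y
    have : brG.compr₂ parG = brG.compl₁₂ parG parG := by
      refine b.ext fun i => b.ext fun j => ?_
      simp only [LinearMap.compr₂_apply, LinearMap.compl₁₂_apply, parG_b, map_smul,
        LinearMap.smul_apply, parG_mem (brG_b_mem_homog i j), smul_smul]
      congr 1
      rcases val_cases (p i) with h | h <;> rcases val_cases (p j) with h' | h' <;>
        simp [h, h', show (1 + 1 : ZMod 2) = 0 from rfl, ZMod.val_one]
    exact LinearMap.congr_fun₂ this x y
  skew := brG_skew
  jacobi := brG_jacobi

end G3Model

/-! ### Generators of Lie superalgebras and eigenvector decompositions -/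

section General

variable {L : Type*} [AddCommGroup L] [Module ℂ L] [LieSuperalgebra L]

/-- The set `S` generates the Lie superalgebra `L`. -/
def Generates (S : Set L) : Prop :=
  ∀ K : SuperSubalgebra L, S ⊆ K.carrier → K.carrier = ⊤

theorem exists_homog_of_mem {K : Submodule ℂ L} (hK : ∀ x ∈ K, par x ∈ K) {z : L} (hz : z ∈ K) :
    ∃ z0 ∈ homog (par : L →ₗ[ℂ] L) 0, ∃ z1 ∈ homog (par : L →ₗ[ℂ] L) 1,
      z0 ∈ K ∧ z1 ∈ K ∧ z = z0 + z1 := by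
  refine ⟨(1 / 2 : ℂ) • (z + par z), ?_, (1 / 2 : ℂ) • (z - par z), ?_, ?_, ?_, ?_⟩
  · rw [mem_homog]; simp [par_par, add_comm]
  · rw [mem_homog]; simp [par_par, ZMod.val_one, ← smul_neg]
  · exact K.smul_mem _ (K.add_mem hz (hK z hz))
  · exact K.smul_mem _ (K.sub_mem hz (hK z hz))
  · module

theorem br_br_homog {i j : ZMod 2} {x y : L} (hx : x ∈ homog par i) (hy : y ∈ homog par j) (z : L) :
    br (br x y) z = br x (br y z) - ksgn i j • br y (br x z) :=
  LinearMap.congr_fun (br_br_eq hx hy) z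

theorem jacobi_even {j : ZMod 2} {x y : L} (hx : x ∈ homog par 0) (hy : y ∈ homog par j) (z : L) :
    br x (br y z) = br (br x y) z + br y (br x z) := by
  rw [br_br_homog hx hy]
  simp [ksgn]

/-- The elements `x` with `[x, K] ⊆ K`. -/
def stabilizer (K : Submodule ℂ L) : Submodule ℂ L where
  carrier := {x | ∀ y ∈ K, br x y ∈ K}
  zero_mem' := fun y _ => by simp
  add_mem' := fun {x x'} hx hx' y hy => by
    rw [map_add]; exact K.add_mem (hx y hy) (hx' y hy)
  smul_mem' := fun c x hx y hy => by
    rw [map_smul]; exact K.smul_mem c (hx y hy)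

theorem par_mem_stabilizer {K : Submodule ℂ L} (hpar : ∀ x ∈ K, par x ∈ K) {x : L}
    (hx : x ∈ stabilizer K) : par x ∈ stabilizer K := fun y hy => by
  have := hpar _ (hx _ (hpar y hy))
  rwa [par_br, par_par] at this

theorem br_mem_stabilizer {K : Submodule ℂ L} (hpar : ∀ x ∈ K, par x ∈ K) {x y : L}
    (hx : x ∈ stabilizer K) (hy : y ∈ stabilizer K) : br x y ∈ stabilizer K := by
  have key : ∀ (i j : ZMod 2) (x y : L), x ∈ homog par i → y ∈ homog par j →
      x ∈ stabilizer K → y ∈ stabilizer K → br x y ∈ stabilizer K := by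
    intro i j x y hx hy kx ky z hz
    rw [br_br_homog hx hy]
    exact K.sub_mem (kx _ (ky _ hz)) (K.smul_mem _ (ky _ (kx _ hz)))
  obtain ⟨x0, h0, x1, h1, m0, m1, rfl⟩ :=
    exists_homog_of_mem (fun x => par_mem_stabilizer hpar) hx
  obtain ⟨y0, g0, y1, g1, n0, n1, rfl⟩ :=
    exists_homog_of_mem (fun x => par_mem_stabilizer hpar) hy
  simp only [map_add, LinearMap.add_apply]
  exact add_mem (add_mem (key _ _ _ _ h0 g0 m0 n0) (key _ _ _ _ h1 g0 m1 n0))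
    (add_mem (key _ _ _ _ h0 g1 m0 n1) (key _ _ _ _ h1 g1 m1 n1))

/-- A graded subspace that contains a generating set and is stable under bracketing with it is
everything: its stabilizer is a subalgebra. -/
theorem Generates.eq_top {S : Set L} (hS : Generates S) {K : Submodule ℂ L}
    (hpar : ∀ x ∈ K, par x ∈ K) (hSK : S ⊆ K) (hbr : ∀ s ∈ S, ∀ y ∈ K, br s y ∈ K) : K = ⊤ := by
  have hN : stabilizer K = ⊤ := hS ⟨stabilizer K, fun x => par_mem_stabilizer hpar,
    fun x hx y hy => br_mem_stabilizer hpar hx hy⟩ hbr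
  have hmem : ∀ x, x ∈ stabilizer K := fun x => by rw [hN]; trivial
  exact hS ⟨K, hpar, fun x _ y hy => hmem x y hy⟩ hSK

end General

/-- If `x₀ + x'` lies in a subspace stable under `D`, where `x₀` is an eigenvector and `x'` is
a sum of eigenvectors with other eigenvalues, then so does `x₀`. -/
theorem eigen_component_mem {V : Type*} [AddCommGroup V] [Module ℂ V] (D : Module.End ℂ V)
    {J : Submodule ℂ V} (hJ : ∀ x ∈ J, D x ∈ J) {μ : ℂ} {x₀ x' : V} (h₀ : x₀ ∈ D.eigenspace μ)
    (h' : x' ∈ ⨆ ν ≠ μ, D.eigenspace ν) (h : x₀ + x' ∈ J) : x₀ ∈ J := by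
  let Dq : Module.End ℂ (V ⧸ J) := J.mapQ J D hJ
  have hmap : ∀ ν, (D.eigenspace ν).map J.mkQ ≤ Dq.eigenspace ν := by
    rintro ν _ ⟨x, hx, rfl⟩
    rw [SetLike.mem_coe, Module.End.mem_eigenspace_iff] at hx
    rw [Module.End.mem_eigenspace_iff, ← map_smul, ← hx]
    rfl
  have e0 : J.mkQ x₀ ∈ Dq.eigenspace μ := hmap μ ⟨x₀, h₀, rfl⟩
  have e1 : J.mkQ x' ∈ ⨆ ν ≠ μ, Dq.eigenspace ν := by
    have : J.mkQ x' ∈ (⨆ ν ≠ μ, D.eigenspace ν).map J.mkQ := ⟨x', h', rfl⟩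
    simp only [Submodule.map_iSup] at this
    exact iSup₂_mono (fun ν _ => hmap ν) this
  have e2 : J.mkQ x₀ = -J.mkQ x' := by
    rw [eq_neg_iff_add_eq_zero, ← map_add, Submodule.mkQ_apply, Submodule.Quotient.mk_eq_zero]
    exact h
  have := (Submodule.disjoint_def.1 (Dq.eigenspaces_iSupIndep μ)) _ e0
    (by rw [e2]; exact Submodule.neg_mem _ e1)
  rwa [Submodule.mkQ_apply, Submodule.Quotient.mk_eq_zero] at this

/-! ### The universal property of the half-baked algebra -/

section FreeGen

variable {X H : Type*}

/-- A subspace of the free nonassociative algebra that is closed under products and contains the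
generators is everything. -/
theorem freeGen_induction {K : Submodule ℂ (FreeGen X H)} (hmul : ∀ x ∈ K, ∀ y ∈ K, x * y ∈ K)
    (hof : ∀ g, FreeNonUnitalNonAssocAlgebra.of ℂ g ∈ K) (x : FreeGen X H) : x ∈ K := by
  let A : NonUnitalSubalgebra ℂ (FreeGen X H) :=
    { K with mul_mem' := fun {x y} hx hy => hmul x hx y hy }
  let φ : FreeGen X H →ₙₐ[ℂ] A :=
    FreeNonUnitalNonAssocAlgebra.lift ℂ fun g => (⟨FreeNonUnitalNonAssocAlgebra.of ℂ g, hof g⟩ : A)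
  have h : (NonUnitalSubalgebraClass.subtype A).comp φ = NonUnitalAlgHom.id ℂ (FreeGen X H) := by
    apply FreeNonUnitalNonAssocAlgebra.hom_ext
    intro g
    simp [φ]
  have hx := DFunLike.congr_fun h x
  have : ((φ x : A) : FreeGen X H) = x := hx
  rw [← this]
  exact (φ x).2

end FreeGen

/-- A Lie superalgebra regarded as a nonassociative algebra, with the bracket as its product. -/
def BrAlg (L : Type*) : Type _ := L

section BrAlg

variable (L : Type*) [AddCommGroup L] [Module ℂ L] [LieSuperalgebra L]

instance : AddCommGroup (BrAlg L) := inferInstanceAs (AddCommGroup L)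
instance : Module ℂ (BrAlg L) := inferInstanceAs (Module ℂ L)

instance : NonUnitalNonAssocRing (BrAlg L) where
  mul x y := (br (L := L) x y : L)
  left_distrib x y z := map_add (br (L := L) x) y z
  right_distrib x y z := LinearMap.congr_fun (map_add (br (L := L)) x y) z
  zero_mul x := LinearMap.congr_fun (map_zero (br (L := L))) x
  mul_zero x := map_zero (br (L := L) x)

instance : IsScalarTower ℂ (BrAlg L) (BrAlg L) where
  smul_assoc c x y := LinearMap.congr_fun (map_smul (br (L := L)) c x) y

instance : SMulCommClass ℂ (BrAlg L) (BrAlg L) where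
  smul_comm c x y := (map_smul (br (L := L) x) c y).symm

end BrAlg

variable {X H : Type*} [AddCommGroup H] [Module ℂ H]

/-- Elements of `L` satisfying the defining relations of the half-baked algebra of `v`. -/
structure Realization (v : SuperRootDatum X H) (L : Type*) [AddCommGroup L] [Module ℂ L]
    [LieSuperalgebra L] where
  ι : H →ₗ[ℂ] L
  e : X → L
  f : X → L
  ι_mem : ∀ h, ι h ∈ homog par 0
  e_mem : ∀ x, e x ∈ homog par (v.p x)
  f_mem : ∀ x, f x ∈ homog par (v.p x)
  comm : ∀ h h', br (ι h) (ι h') = 0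
  ef : ∀ x, br (e x) (f x) = ι (v.a x)
  ef_ne : ∀ x y, x ≠ y → br (e x) (f y) = 0
  he : ∀ h x, br (ι h) (e x) = v.b x h • e x
  hf : ∀ h x, br (ι h) (f x) = -(v.b x h • f x)

namespace Realization

variable {v : SuperRootDatum X H} {L : Type*} [AddCommGroup L] [Module ℂ L] [LieSuperalgebra L]

/-- The set of all `ι h`, `e x` and `f x`. -/
def gens (R : Realization v L) : Set L := Set.range R.ι ∪ Set.range R.e ∪ Set.range R.f

theorem gens_subset {R : Realization v L} {K : Set L} (h1 : ∀ h, R.ι h ∈ K) (h2 : ∀ x, R.e x ∈ K)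
    (h3 : ∀ x, R.f x ∈ K) : R.gens ⊆ K := by
  rintro _ ((⟨h, rfl⟩ | ⟨x, rfl⟩) | ⟨x, rfl⟩)
  exacts [h1 h, h2 x, h3 x]

theorem fe_ne (R : Realization v L) (x y : X) (h : x ≠ y) : br (R.f x) (R.e y) = 0 := by
  rw [skew _ _ _ _ (R.f_mem x) (R.e_mem y), R.ef_ne y x h.symm]; simp

theorem fe (R : Realization v L) (x : X) :
    br (R.f x) (R.e x) = R.ι (-(ksgn (v.p x) (v.p x) • v.a x)) := by
  rw [skew _ _ _ _ (R.f_mem x) (R.e_mem x), R.ef x, map_neg, map_smul]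

/-- The homomorphism from the free nonassociative algebra that sends the generators to those of the
realization. -/
def liftFree (R : Realization v L) : FreeGen X H →ₙₐ[ℂ] BrAlg L :=
  FreeNonUnitalNonAssocAlgebra.lift ℂ fun g => (match g with
    | Gen.h h => R.ι h
    | Gen.e x => R.e x
    | Gen.f x => R.f x : L)

variable (R : Realization v L)

/-- `liftFree` as a linear map to `L`. -/
def liftLin : FreeGen X H →ₗ[ℂ] L := (R.liftFree : FreeGen X H →ₗ[ℂ] BrAlg L)

theorem liftLin_mul (x y : FreeGen X H) : R.liftLin (x * y) = br (R.liftLin x) (R.liftLin y) :=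
  map_mul R.liftFree x y

@[simp] theorem liftLin_h (h : H) : R.liftLin (genH h) = R.ι h := by
  exact FreeNonUnitalNonAssocAlgebra.lift_of_apply ℂ (A := BrAlg L) _ _

@[simp] theorem liftLin_e (x : X) : R.liftLin (genE x) = R.e x := by
  exact FreeNonUnitalNonAssocAlgebra.lift_of_apply ℂ (A := BrAlg L) _ _

@[simp] theorem liftLin_f (x : X) : R.liftLin (genF x) = R.f x := by
  exact FreeNonUnitalNonAssocAlgebra.lift_of_apply ℂ (A := BrAlg L) _ _

theorem liftLin_par (x : FreeGen X H) : R.liftLin (freePar H v.p x) = par (R.liftLin x) := by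
  refine freeGen_induction (K := LinearMap.eqLocus
    (R.liftLin ∘ₗ (freePar H v.p : FreeGen X H →ₗ[ℂ] FreeGen X H)) (par ∘ₗ R.liftLin))
    (fun x hx y hy => ?_) (fun g => ?_) x
  · have hx' : R.liftLin (freePar H v.p x) = par (R.liftLin x) := hx
    have hy' : R.liftLin (freePar H v.p y) = par (R.liftLin y) := hy
    show R.liftLin (freePar H v.p (x * y)) = par (R.liftLin (x * y))
    rw [map_mul, liftLin_mul, liftLin_mul, par_br, hx', hy']
  · show R.liftLin (freePar H v.p _) = par (R.liftLin _)
    rcases g with h | x | x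
    · have := mem_homog.1 (R.ι_mem h)
      simp only [freePar, genScale, FreeNonUnitalNonAssocAlgebra.lift_of_apply]
      simp [this]
    · have := mem_homog.1 (R.e_mem x)
      simp only [freePar, genScale, FreeNonUnitalNonAssocAlgebra.lift_of_apply]
      simp [this]
    · have := mem_homog.1 (R.f_mem x)
      simp only [freePar, genScale, FreeNonUnitalNonAssocAlgebra.lift_of_apply]
      simp [this]

theorem liftLin_homog {i : ZMod 2} {x : FreeGen X H}
    (hx : x ∈ homog (freePar H v.p : FreeGen X H →ₗ[ℂ] FreeGen X H) i) :
    R.liftLin x ∈ homog par i := by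
  rw [mem_homog] at *
  rw [← liftLin_par, ← map_smul, ← hx]
  rfl

theorem liftLin_relIdeal (x : FreeGen X H) (hx : x ∈ relIdeal v) : R.liftLin x = 0 := by
  have : IsRelIdeal v (LinearMap.ker R.liftLin) := by
    refine ⟨fun r hr => ?_, fun x y hy => ?_⟩
    · rw [LinearMap.mem_ker]
      cases hr with
      | add h h' => simp
      | smul c h => simp
      | comm h h' => rw [liftLin_mul]; simp [R.comm]
      | ef x => rw [map_sub, liftLin_mul]; simp [R.ef]
      | ef_ne x y hxy => rw [liftLin_mul]; simp [R.ef_ne x y hxy]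
      | he h x => rw [map_sub, liftLin_mul]; simp [R.he]
      | hf h x => rw [map_add, liftLin_mul]; simp [R.hf]
      | skew i j x y hx hy =>
        rw [map_add, map_smul, liftLin_mul, liftLin_mul,
          skew i j _ _ (R.liftLin_homog hx) (R.liftLin_homog hy)]
        simp
      | jacobi i j k x y z hx hy hz =>
        simp only [map_sub, map_smul, liftLin_mul]
        rw [jacobi i j k _ _ _ (R.liftLin_homog hx) (R.liftLin_homog hy) (R.liftLin_homog hz)]
        simp
    · rw [LinearMap.mem_ker] at hy
      simp [LinearMap.mem_ker, liftLin_mul, hy]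
  rw [relIdeal, Submodule.mem_sInf] at hx
  exact LinearMap.mem_ker.1 (hx _ this)

/-- The homomorphism `𝔤̃(v) → L` given by a realization of `v` in `L`. -/
def lift : HalfBaked v →ₗ[ℂ] L := HalfBaked.desc v R.liftLin R.liftLin_relIdeal

@[simp] theorem lift_mk (x : FreeGen X H) : R.lift (HalfBaked.mk v x) = R.liftLin x := rfl

theorem lift_br (x y : HalfBaked v) : R.lift (br x y) = br (R.lift x) (R.lift y) := by
  obtain ⟨x, rfl⟩ := HalfBaked.mk_surjective v x
  obtain ⟨y, rfl⟩ := HalfBaked.mk_surjective v y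
  exact R.liftLin_mul x y

theorem lift_par (x : HalfBaked v) : R.lift (par x) = par (R.lift x) := by
  obtain ⟨x, rfl⟩ := HalfBaked.mk_surjective v x
  exact R.liftLin_par x

end Realization

namespace HalfBaked

theorem mk_rel {v : SuperRootDatum X H} {r : FreeGen X H} (hr : Relator v r) : mk v r = 0 :=
  (mk_eq_zero v r).2 ((relIdeal_isRelIdeal v).1 r hr)

/-- The tautological realization of `v` in `𝔤̃(v)`. -/
def realization (v : SuperRootDatum X H) : Realization v (HalfBaked v) where
  ι :=
    { toFun := fun h => mk v (genH h)
      map_add' := fun h h' => by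
        have := mk_rel (Relator.add (v := v) h h')
        rwa [sub_sub, map_sub, sub_eq_zero, map_add] at this
      map_smul' := fun c h => by
        have := mk_rel (Relator.smul (v := v) c h)
        rwa [map_sub, sub_eq_zero, map_smul] at this }
  e x := mk v (genE x)
  f x := mk v (genF x)
  ι_mem h := by
    rw [mem_homog]
    show mk v (freePar H v.p (genH h)) = _
    simp [freePar, genScale]
  e_mem x := by
    rw [mem_homog]
    show mk v (freePar H v.p (genE x)) = _
    simp [freePar, genScale]
  f_mem x := by
    rw [mem_homog]
    show mk v (freePar H v.p (genF x)) = _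
    simp [freePar, genScale]
  comm h h' := mk_rel (Relator.comm (v := v) h h')
  ef x := by
    have := mk_rel (Relator.ef (v := v) x)
    rwa [map_sub, sub_eq_zero] at this
  ef_ne x y h := mk_rel (Relator.ef_ne (v := v) x y h)
  he h x := by
    have := mk_rel (Relator.he (v := v) h x)
    rwa [map_sub, sub_eq_zero, map_smul] at this
  hf h x := by
    have := mk_rel (Relator.hf (v := v) h x)
    rw [map_add, map_smul] at this
    exact eq_neg_of_add_eq_zero_left this

theorem generates (v : SuperRootDatum X H) : Generates (realization v).gens := by
  intro K hK
  rw [eq_top_iff]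
  rintro x -
  obtain ⟨x, rfl⟩ := mk_surjective v x
  refine freeGen_induction (K := K.carrier.comap (mk v)) (fun x hx y hy => ?_) (fun g => ?_) x
  · exact K.br_mem _ hx _ hy
  · rcases g with h | x | x
    · exact hK (Or.inl (Or.inl ⟨h, rfl⟩))
    · exact hK (Or.inl (Or.inr ⟨x, rfl⟩))
    · exact hK (Or.inr ⟨x, rfl⟩)

end HalfBaked

/-! ### The triangular decomposition -/

section Words

variable {L : Type*} [AddCommGroup L] [Module ℂ L] [LieSuperalgebra L] {X : Type*}

/-- Iterated brackets `[e x₁, [e x₂, …, [e xₖ₋₁, e xₖ]]]`. -/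
inductive IsWord (e : X → L) : L → Prop
  | of (x : X) : IsWord e (e x)
  | cons (x : X) (n : L) : IsWord e n → IsWord e (br (e x) n)

/-- The span of the iterated brackets of the `e x`. -/
def wordSpan (e : X → L) : Submodule ℂ L := Submodule.span ℂ {n | IsWord e n}

theorem mem_wordSpan (e : X → L) (x : X) : e x ∈ wordSpan e :=
  Submodule.subset_span (IsWord.of x)

theorem br_mem_wordSpan {e : X → L} (x : X) {n : L} (hn : n ∈ wordSpan e) :
    br (e x) n ∈ wordSpan e := by
  have : wordSpan e ≤ (wordSpan e).comap (br (e x)) :=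
    Submodule.span_le.2 fun n hn => Submodule.subset_span (IsWord.cons x n hn)
  exact this hn

theorem par_mem_wordSpan {e : X → L} {q : X → ZMod 2} (he : ∀ x, e x ∈ homog par (q x)) {n : L}
    (hn : n ∈ wordSpan e) : par n ∈ wordSpan e := by
  have : wordSpan e ≤ (wordSpan e).comap par := by
    refine Submodule.span_le.2 fun n hn => ?_
    show par n ∈ wordSpan e
    induction hn with
    | of x =>
      rw [mem_homog.1 (he x)]
      exact Submodule.smul_mem _ _ (mem_wordSpan e x)
    | cons x n _ ih =>
      rw [par_br, mem_homog.1 (he x), map_smul, LinearMap.smul_apply]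
      exact Submodule.smul_mem _ _ (br_mem_wordSpan x ih)
  exact this hn

theorem br_eigen_mem_wordSpan {e : X → L} {q : X → ZMod 2} (he : ∀ x, e x ∈ homog par (q x)) {D : L}
    (hD : D ∈ homog par 0) {c : X → ℂ} (hc : ∀ x, br D (e x) = c x • e x) {n : L}
    (hn : n ∈ wordSpan e) : br D n ∈ wordSpan e := by
  have : wordSpan e ≤ (wordSpan e).comap (br D) := by
    refine Submodule.span_le.2 fun n hn => ?_
    show br D n ∈ wordSpan e
    induction hn with
    | of x =>
      rw [hc]
      exact Submodule.smul_mem _ _ (mem_wordSpan e x)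
    | cons x n hn ih =>
      rw [jacobi_even hD (he x), hc, map_smul, LinearMap.smul_apply]
      exact Submodule.add_mem _
          (Submodule.smul_mem _ _ (Submodule.subset_span (IsWord.cons x n hn)))
        (br_mem_wordSpan x ih)
  exact this hn

/-- If `[D, e x] = s • e x` for all `x`, then a word of length `k` is an eigenvector of `ad D` with
eigenvalue `k s`. -/
theorem wordSpan_le_eigen {e : X → L} {q : X → ZMod 2} (he : ∀ x, e x ∈ homog par (q x)) {D : L}
    (hD : D ∈ homog par 0) {s : ℂ} (hs : s ≠ 0) (hc : ∀ x, br D (e x) = s • e x) :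
    wordSpan e ≤ ⨆ ν ≠ (0 : ℂ), Module.End.eigenspace (br D) ν := by
  refine Submodule.span_le.2 fun n hn => ?_
  have : ∃ k : ℕ, br D n = ((k + 1 : ℕ) * s) • n := by
    induction hn with
    | of x => exact ⟨0, by simp [hc]⟩
    | cons x n _ ih =>
      obtain ⟨k, hk⟩ := ih
      refine ⟨k + 1, ?_⟩
      rw [jacobi_even hD (he x), hc, hk, map_smul, map_smul, LinearMap.smul_apply]
      push_cast
      module
  obtain ⟨k, hk⟩ := this
  refine Submodule.mem_iSup_of_mem (((k + 1 : ℕ) : ℂ) * s) (Submodule.mem_iSup_of_mem ?_ ?_)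
  · exact mul_ne_zero (Nat.cast_ne_zero.2 (Nat.succ_ne_zero k)) hs
  · exact Module.End.mem_eigenspace_iff.2 hk

/-- An element `g` with `[g, e x] ∈ ι 𝔥` for all `x` maps the span of the words in the `e x` to its
sum with `ι 𝔥`. -/
theorem br_lower_mem {H : Type*} [AddCommGroup H] [Module ℂ H] {ι : H →ₗ[ℂ] L} {e : X → L}
    {q : X → ZMod 2} (he : ∀ x, e x ∈ homog par (q x)) (hι : ∀ h, ι h ∈ homog par 0)
    {c : H → X → ℂ} (hc : ∀ h x, br (ι h) (e x) = c h x • e x) {g : L} {j : ZMod 2}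
    (hg : g ∈ homog par j) (hge : ∀ x, br g (e x) ∈ LinearMap.range ι) {n : L}
    (hn : n ∈ wordSpan e) : br g n ∈ LinearMap.range ι ⊔ wordSpan e := by
  have : wordSpan e ≤ (LinearMap.range ι ⊔ wordSpan e).comap (br g) := by
    refine Submodule.span_le.2 fun n hn => ?_
    show br g n ∈ LinearMap.range ι ⊔ wordSpan e
    induction hn with
    | of x => exact Submodule.mem_sup_left (hge x)
    | cons x n hn ih =>
      obtain ⟨h, hh⟩ := hge x
      have e1 := br_br_homog hg (he x) n
      rw [eq_sub_iff_add_eq] at e1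
      rw [← e1, ← hh]
      refine Submodule.add_mem _ (Submodule.mem_sup_right
        (br_eigen_mem_wordSpan he (hι h) (hc h) (Submodule.subset_span hn)))
        (Submodule.smul_mem _ _ (Submodule.mem_sup_right ?_))
      obtain ⟨_, ⟨h', rfl⟩, m, hm, e2⟩ := Submodule.mem_sup.1 ih
      rw [← e2, map_add]
      refine Submodule.add_mem _ ?_ (br_mem_wordSpan x hm)
      rw [skew _ _ _ _ (he x) (hι h'), hc]
      exact Submodule.neg_mem _ (Submodule.smul_mem _ _ (Submodule.smul_mem _ _ (mem_wordSpan e x)))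
  exact this hn

end Words

variable {X H : Type*} [AddCommGroup H] [Module ℂ H]

namespace Realization

variable {v : SuperRootDatum X H} {L : Type*} [AddCommGroup L] [Module ℂ L] [LieSuperalgebra L]

/-- The triangular decomposition `L = 𝔫₋ + 𝔥 + 𝔫₊`. -/
theorem triangular (R : Realization v L) (hgen : Generates R.gens) :
    LinearMap.range R.ι ⊔ (wordSpan R.e ⊔ wordSpan R.f) = ⊤ := by
  have hf : ∀ h x, br (R.ι h) (R.f x) = (-v.b x h) • R.f x := fun h x => by
    rw [R.hf, neg_smul]
  have le1 : LinearMap.range R.ι ⊔ wordSpan R.e ≤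
      LinearMap.range R.ι ⊔ (wordSpan R.e ⊔ wordSpan R.f) := sup_le_sup_left le_sup_left _
  have le2 : LinearMap.range R.ι ⊔ wordSpan R.f ≤
      LinearMap.range R.ι ⊔ (wordSpan R.e ⊔ wordSpan R.f) := sup_le_sup_left le_sup_right _
  have hι : ∀ h, R.ι h ∈ LinearMap.range R.ι := fun h => ⟨h, rfl⟩
  refine hgen.eq_top ?_ (gens_subset (fun h => ?_) (fun x => ?_) (fun x => ?_)) ?_
  · intro x hx
    obtain ⟨_, ⟨h, rfl⟩, z, hz, rfl⟩ := Submodule.mem_sup.1 hx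
    obtain ⟨n, hn, m, hm, rfl⟩ := Submodule.mem_sup.1 hz
    rw [map_add, map_add, mem_homog.1 (R.ι_mem h)]
    exact Submodule.add_mem _ (Submodule.mem_sup_left (Submodule.smul_mem _ _ (hι h)))
      (Submodule.add_mem _ (le1 (Submodule.mem_sup_right (par_mem_wordSpan R.e_mem hn)))
        (le2 (Submodule.mem_sup_right (par_mem_wordSpan R.f_mem hm))))
  · exact Submodule.mem_sup_left (hι h)
  · exact le1 (Submodule.mem_sup_right (mem_wordSpan _ x))
  · exact le2 (Submodule.mem_sup_right (mem_wordSpan _ x))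
  · rintro s hs y hy
    obtain ⟨_, ⟨h', rfl⟩, z, hz, rfl⟩ := Submodule.mem_sup.1 hy
    obtain ⟨n, hn, m, hm, rfl⟩ := Submodule.mem_sup.1 hz
    rw [map_add, map_add]
    rcases hs with ((⟨h, rfl⟩ | ⟨x, rfl⟩) | ⟨x, rfl⟩)
    · rw [R.comm, zero_add]
      exact Submodule.add_mem _
        (le1 (Submodule.mem_sup_right (br_eigen_mem_wordSpan R.e_mem (R.ι_mem h) (R.he h) hn)))
        (le2 (Submodule.mem_sup_right (br_eigen_mem_wordSpan R.f_mem (R.ι_mem h) (hf h) hm)))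
    · refine Submodule.add_mem _ ?_ (Submodule.add_mem _
        (le1 (Submodule.mem_sup_right (br_mem_wordSpan x hn)))
        (le2 (br_lower_mem R.f_mem R.ι_mem hf (R.e_mem x) (fun y => ?_) hm)))
      · rw [skew _ _ _ _ (R.e_mem x) (R.ι_mem h'), R.he]
        exact Submodule.neg_mem _ (Submodule.smul_mem _ _ (Submodule.smul_mem _ _
          (le1 (Submodule.mem_sup_right (mem_wordSpan _ x)))))
      · by_cases hxy : x = y
        · subst hxy; rw [R.ef]; exact hι _
        · rw [R.ef_ne x y hxy]; exact Submodule.zero_mem _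
    · refine Submodule.add_mem _ ?_ (Submodule.add_mem _
        (le1 (br_lower_mem R.e_mem R.ι_mem R.he (R.f_mem x) (fun y => ?_) hn))
        (le2 (Submodule.mem_sup_right (br_mem_wordSpan x hm))))
      · rw [skew _ _ _ _ (R.f_mem x) (R.ι_mem h'), hf]
        exact Submodule.neg_mem _ (Submodule.smul_mem _ _ (Submodule.smul_mem _ _
          (le2 (Submodule.mem_sup_right (mem_wordSpan _ x)))))
      · by_cases hxy : x = y
        · subst hxy; rw [R.fe]; exact hι _
        · rw [R.fe_ne x y hxy]; exact Submodule.zero_mem _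

/-- Modulo `ι 𝔥`, every element is a sum of eigenvectors of `ad ρ` with nonzero eigenvalues, if all
simple roots take the value `1` at `ρ`. -/
theorem exists_eigen (R : Realization v L) (hgen : Generates R.gens) {ρ : H}
    (hρ : ∀ x, v.b x ρ = 1) (z : L) :
    ∃ h, ∃ z' ∈ ⨆ ν ≠ (0 : ℂ), Module.End.eigenspace (br (R.ι ρ)) ν, z = R.ι h + z' := by
  have hz : z ∈ LinearMap.range R.ι ⊔ (wordSpan R.e ⊔ wordSpan R.f) := by
    rw [R.triangular hgen]; trivial
  obtain ⟨_, ⟨h, rfl⟩, z', hz', rfl⟩ := Submodule.mem_sup.1 hz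
  refine ⟨h, z', ?_, rfl⟩
  refine (sup_le ?_ ?_ : wordSpan R.e ⊔ wordSpan R.f ≤ _) hz'
  · exact wordSpan_le_eigen R.e_mem (R.ι_mem ρ) one_ne_zero fun x => by rw [R.he, hρ]
  · exact wordSpan_le_eigen R.f_mem (R.ι_mem ρ) (neg_ne_zero.2 one_ne_zero) fun x => by
      rw [R.hf, hρ, neg_smul]

variable (R : Realization v L)

theorem lift_ι (h : H) : R.lift ((HalfBaked.realization v).ι h) = R.ι h := R.liftLin_h h

theorem lift_e (x : X) : R.lift ((HalfBaked.realization v).e x) = R.e x := R.liftLin_e x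

theorem lift_f (x : X) : R.lift ((HalfBaked.realization v).f x) = R.f x := R.liftLin_f x

theorem lift_surjective (hgen : Generates R.gens) : Function.Surjective R.lift := by
  rw [← LinearMap.range_eq_top]
  refine hgen ⟨LinearMap.range R.lift, ?_, ?_⟩ (gens_subset (fun h => ⟨_, R.lift_ι h⟩)
    (fun x => ⟨_, R.lift_e x⟩) (fun x => ⟨_, R.lift_f x⟩))
  · rintro _ ⟨x, rfl⟩
    exact ⟨par x, R.lift_par x⟩
  · rintro _ ⟨x, rfl⟩ _ ⟨y, rfl⟩
    exact ⟨br x y, R.lift_br x y⟩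

/-- The kernel of `𝔤̃(v) → L`. -/
def kerIdeal : SuperIdeal (HalfBaked v) where
  carrier := LinearMap.ker R.lift
  par_mem x hx := by rw [LinearMap.mem_ker] at *; rw [R.lift_par, hx, map_zero]
  br_mem_left x y hy := by rw [LinearMap.mem_ker] at *; rw [R.lift_br, hy, map_zero]
  br_mem_right x y hx := by
    rw [LinearMap.mem_ker] at *; rw [R.lift_br, hx, map_zero, LinearMap.zero_apply]

/-- The image in `L` of an ideal of `𝔤̃(v)`. -/
def mapIdeal (hgen : Generates R.gens) (J : SuperIdeal (HalfBaked v)) : SuperIdeal L where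
  carrier := J.carrier.map R.lift
  par_mem := by
    rintro _ ⟨x, hx, rfl⟩
    exact ⟨par x, J.par_mem x hx, R.lift_par x⟩
  br_mem_left := by
    rintro y _ ⟨x, hx, rfl⟩
    obtain ⟨y, rfl⟩ := R.lift_surjective hgen y
    exact ⟨br y x, J.br_mem_left y x hx, R.lift_br y x⟩
  br_mem_right := by
    rintro _ y ⟨x, hx, rfl⟩
    obtain ⟨y, rfl⟩ := R.lift_surjective hgen y
    exact ⟨br x y, J.br_mem_right x y hx, R.lift_br x y⟩

/-- If `ι` is injective and every nonzero graded ideal of `L` meets `ι 𝔥`, then the kernel of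
`𝔤̃(v) → L` is the maximal ideal avoiding `𝔥`. The element `ρ` is only used to separate `𝔥` from
the root vectors. -/
theorem ker_lift (hgen : Generates R.gens) (hinj : Function.Injective R.ι) {ρ : H}
    (hρ : ∀ x, v.b x ρ = 1)
    (hideal : ∀ I : SuperIdeal L, (∀ h, R.ι h ∈ I.carrier → h = 0) → I.carrier = ⊥) :
    (maxIdeal v).carrier = LinearMap.ker R.lift := by
  apply le_antisymm
  · refine sSup_le ?_
    rintro _ ⟨J, hJ, rfl⟩ z hz
    have h0 : (R.mapIdeal hgen J).carrier = ⊥ := by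
      refine hideal _ ?_
      rintro h ⟨j, hj, hjh⟩
      obtain ⟨h', j', hj', rfl⟩ :=
        (HalfBaked.realization v).exists_eigen (HalfBaked.generates v) hρ j
      -- The eigenvalue-zero component `ι h'` of `j` stays in `J`, so it vanishes.
      have hmem : (HalfBaked.realization v).ι h' ∈ J.carrier :=
        eigen_component_mem (br ((HalfBaked.realization v).ι ρ)) (fun x => J.br_mem_left _ x)
          (by rw [Module.End.mem_eigenspace_iff, Realization.comm, zero_smul]) hj' hj
      have h0 : (HalfBaked.realization v).ι h' = 0 := hJ h' hmem
      have hmap : ∀ ν, (Module.End.eigenspace (br ((HalfBaked.realization v).ι ρ)) ν).map R.lift ≤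
          Module.End.eigenspace (br (R.ι ρ)) ν := by
        rintro ν _ ⟨x, hx, rfl⟩
        rw [SetLike.mem_coe, Module.End.mem_eigenspace_iff] at hx
        rw [Module.End.mem_eigenspace_iff, ← map_smul, ← hx, R.lift_br, R.lift_ι]
      have hq : R.lift j' ∈ ⨆ ν ≠ (0 : ℂ), Module.End.eigenspace (br (R.ι ρ)) ν := by
        have : R.lift j' ∈ (⨆ ν ≠ (0 : ℂ),
          Module.End.eigenspace (br ((HalfBaked.realization v).ι ρ)) ν).map R.lift :=
            ⟨j', hj', rfl⟩
        simp only [Submodule.map_iSup] at this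
        exact iSup₂_mono (fun ν _ => hmap ν) this
      -- Now `ι h` is both of eigenvalue zero and a sum of vectors of nonzero eigenvalues.
      rw [map_add, h0, map_zero, zero_add] at hjh
      have := Submodule.disjoint_def.1
        ((Module.End.eigenspaces_iSupIndep (br (R.ι ρ))) 0) (R.ι h)
        (by rw [Module.End.mem_eigenspace_iff, R.comm, zero_smul]) (by rw [← hjh]; exact hq)
      exact hinj (by rw [this, map_zero])
    have : R.lift z ∈ (R.mapIdeal hgen J).carrier := ⟨z, hz, rfl⟩
    rwa [h0] at this
  · refine le_sumAvoiding v R.kerIdeal fun h hh => ?_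
    have : R.ι h = 0 := by rw [← R.lift_ι]; exact hh
    have : h = 0 := hinj (by rw [this, map_zero])
    rw [this]
    exact map_zero (HalfBaked.realization v).ι

/-- A superalgebra generated by a realization of `v` is isomorphic to `𝔤(v)`, if the kernel of
`𝔤̃(v) → L` is the maximal ideal avoiding `𝔥`. -/
def isoOfKer (hgen : Generates R.gens) (hker : (maxIdeal v).carrier = LinearMap.ker R.lift) :
    Iso (Contragredient v) L where
  toEquiv := (Submodule.quotEquivOfEq _ _ hker).trans
    (R.lift.quotKerEquivOfSurjective (R.lift_surjective hgen))
  map_par x := by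
    obtain ⟨x, rfl⟩ := (maxIdeal v).carrier.mkQ_surjective x
    exact R.lift_par x
  map_br x y := by
    obtain ⟨x, rfl⟩ := (maxIdeal v).carrier.mkQ_surjective x
    obtain ⟨y, rfl⟩ := (maxIdeal v).carrier.mkQ_surjective y
    exact R.lift_br x y

end Realization

/-! ### The model is isomorphic to `G(3)` -/

namespace G3Model

theorem br_b (i j : Fin 31) : br (b i) (b j) = vec (brVec i j) := brG_b i j

theorem par_b (i : Fin 31) : par (b i) = ((-1) ^ (p i).val : ℂ) • b i := parG_b i

theorem b_mem (i : Fin 31) : b i ∈ homog par (p i) := b_mem_homog i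

/-- The coefficient of `α_{j+1}` in the weight of `b k`, which is zero for `k < 3`. -/
def wt (j : Fin 3) (k : Fin 31) : ℤ := coef (brVec j k) k

theorem brVec_cartan : ∀ (j : Fin 3) (k : Fin 31),
    brVec j k = if wt j k = 0 then [] else [((k : ℕ), wt j k)] := by
  decide +kernel

/-- The fundamental coweights, the basis of the Cartan subalgebra dual to the simple roots. -/
def w (j : Fin 3) : G3Model := b (Fin.castLE (by norm_num) j)

theorem br_w_b (j : Fin 3) (k : Fin 31) : br (w j) (b k) = (wt j k : ℂ) • b k := by
  rw [w, br_b, Fin.val_castLE, brVec_cartan]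
  split_ifs with h
  · simp [h, vec]
  · simp [vec, bN_coe]

/-- The index of the root vector of the simple root `α_{x+1}`. -/
def eIdx (x : Fin 3) : Fin 31 := ⟨3 + x, by omega⟩

/-- The index of the root vector of `-α_{x+1}`. -/
def fIdx (x : Fin 3) : Fin 31 := ⟨17 + x, by omega⟩

theorem wt_e : ∀ j x : Fin 3, wt j (eIdx x) = if j = x then 1 else 0 := by decide +kernel
theorem wt_f : ∀ j x : Fin 3, wt j (fIdx x) = if j = x then -1 else 0 := by decide +kernel
theorem wt_w : ∀ j x : Fin 3, wt j (Fin.castLE (by norm_num) x) = 0 := by decide +kernel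

theorem brVec_ef_ne : ∀ x y : Fin 3, x ≠ y → brVec (eIdx x) (fIdx y) = [] := by decide +kernel

/-- The values of the simple roots at an element of the Cartan subalgebra `ℂ³` of `datumG3`. -/
def rootValues : (Fin 3 → ℂ) →ₗ[ℂ] (Fin 3 → ℂ) := LinearMap.pi datumG3.b

theorem rootValues_apply (h : Fin 3 → ℂ) (j : Fin 3) :
    rootValues h j = ∑ x, h x * cartanG3 x j := by
  simp [rootValues, datumG3, rootDatumOfDet, Fintype.linearCombination_apply]

/-- The fundamental coweights in terms of the simple coroots: the rows of the inverse of the Cartan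
matrix. -/
def coweight : Fin 3 → Fin 3 → ℂ := ![![3, 2, 1], ![2, 4/3, 4/3], ![1, 4/3, 1/3]]

theorem rootValues_coweight (j : Fin 3) : rootValues (coweight j) = Pi.single j 1 := by
  ext y
  rw [rootValues_apply]
  fin_cases j <;> fin_cases y <;>
    simp [coweight, cartanG3, Fin.sum_univ_three] <;> norm_num

theorem rootValues_injective : Function.Injective rootValues := by
  rw [← LinearMap.ker_eq_bot, LinearMap.ker_eq_bot_iff_range_eq_top, eq_top_iff]
  rintro c -
  refine ⟨∑ j, c j • coweight j, ?_⟩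
  simp only [map_sum, map_smul, rootValues_coweight]
  ext y
  simp [Pi.single_apply]

/-- The embedding of the Cartan subalgebra of `datumG3` into the model: the simple roots must take
the same values at `h` and at its image. -/
def ι : (Fin 3 → ℂ) →ₗ[ℂ] G3Model := Fintype.linearCombination ℂ w ∘ₗ rootValues

theorem ι_apply (h : Fin 3 → ℂ) : ι h = ∑ j, datumG3.b j h • w j := by
  simp [ι, Fintype.linearCombination_apply, rootValues]

theorem ι_coweight (j : Fin 3) : ι (coweight j) = w j := by
  simp [ι, rootValues_coweight]

theorem w_independent : LinearIndependent ℂ w :=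
  b.linearIndependent.comp _ (Fin.castLE_injective _)

theorem ι_injective : Function.Injective ι :=
  w_independent.fintypeLinearCombination_injective.comp rootValues_injective

theorem br_ι_b (h : Fin 3 → ℂ) (k : Fin 31) :
    br (ι h) (b k) = (∑ j, datumG3.b j h * wt j k) • b k := by
  simp [ι_apply, br_w_b, Finset.sum_smul, smul_smul]

theorem br_e_f (x : Fin 3) : br (b (eIdx x)) (b (fIdx x)) = (2 : ℂ) • ι (Pi.single x 1) := by
  have h0 : brVec (eIdx 0) (fIdx 0) = [(0, 2), (1, -1), (2, -2)] := by decide +kernel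
  have h1 : brVec (eIdx 1) (fIdx 1) = [(0, -1), (2, 3)] := by decide +kernel
  have h2 : brVec (eIdx 2) (fIdx 2) = [(0, -2), (1, 3)] := by decide +kernel
  have e0 : bN 0 = w 0 := rfl
  have e1 : bN 1 = w 1 := rfl
  have e2 : bN 2 = w 2 := rfl
  rw [br_b, ι_apply]
  have hb : ∀ j, datumG3.b j (Pi.single x 1) = cartanG3 x j := fun j => by
    simp [datumG3, rootDatumOfDet, Fintype.linearCombination_apply, Pi.single_apply]
  simp only [hb]
  fin_cases x
  · simp only [Fin.zero_eta, h0, vec, Fin.sum_univ_three, e0, e1, e2]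
    simp [cartanG3]; module
  · simp only [Fin.mk_one, h1, vec, Fin.sum_univ_three, e0, e2]
    simp [cartanG3]; module
  · simp only [Fin.reduceFinMk, h2, vec, Fin.sum_univ_three, e0, e1]
    simp [cartanG3]; module

theorem p_eIdx : ∀ x, p (eIdx x) = parityG3 x := by decide
theorem p_fIdx : ∀ x, p (fIdx x) = parityG3 x := by decide
theorem p_w : ∀ j : Fin 3, p (Fin.castLE (by norm_num) j) = 0 := by decide

theorem w_mem (j : Fin 3) : w j ∈ homog par 0 := by
  have := b_mem (Fin.castLE (by norm_num) j)
  rwa [p_w] at this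

theorem br_ι_ι (h h' : Fin 3 → ℂ) : br (ι h) (ι h') = 0 := by
  rw [ι_apply h', map_sum]
  refine Finset.sum_eq_zero fun j _ => ?_
  rw [map_smul, w, br_ι_b]
  simp [wt_w]

/-- The realization of the root datum of `G(3)` in the model. The factor `1 / 2` makes `[e x, f x]`
the simple coroot. -/
def realization : Realization datumG3 G3Model where
  ι := ι
  e x := b (eIdx x)
  f x := (1 / 2 : ℂ) • b (fIdx x)
  ι_mem h := by
    rw [ι_apply]
    exact Submodule.sum_mem _ fun j _ => Submodule.smul_mem _ _ (w_mem j)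
  e_mem x := by
    have := b_mem (eIdx x)
    rwa [p_eIdx] at this
  f_mem x := by
    have := b_mem (fIdx x)
    rw [p_fIdx] at this
    exact Submodule.smul_mem _ _ this
  comm := br_ι_ι
  ef x := by
    rw [map_smul, br_e_f, smul_smul]
    norm_num
    rfl
  ef_ne x y h := by
    rw [map_smul, br_b, brVec_ef_ne x y h]
    simp [vec]
  he h x := by
    rw [br_ι_b]
    simp [wt_e]
  hf h x := by
    rw [map_smul, br_ι_b, smul_comm]
    simp [wt_f]

/-- Every other root vector is, up to a nonzero factor, a bracket of two basis vectors that come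
before it. -/
theorem brVec_gen : ∀ k : Fin 31, 3 ≤ k → (∃ x, k = eIdx x) ∨ (∃ x, k = fIdx x) ∨
    ∃ i j : Fin 31, i < k ∧ j < k ∧ brVec i j = [((k : ℕ), coef (brVec i j) k)] ∧
      coef (brVec i j) k ≠ 0 ∧
      wt 0 k = wt 0 i + wt 0 j := by
  decide +kernel

theorem exists_b_eq_w (k : Fin 31) (h : k < 3) : ∃ j : Fin 3, b k = w j :=
  ⟨⟨k, h⟩, rfl⟩

theorem generates : Generates realization.gens := by
  intro K hK
  have he : ∀ x, b (eIdx x) ∈ K.carrier := fun x => hK (Or.inl (Or.inr ⟨x, rfl⟩))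
  have hf : ∀ x, b (fIdx x) ∈ K.carrier := fun x => by
    have h1 : (1 / 2 : ℂ) • b (fIdx x) ∈ K.carrier := hK (Or.inr ⟨x, rfl⟩)
    have := K.carrier.smul_mem 2 h1
    rw [smul_smul] at this
    norm_num at this
    exact this
  have key : ∀ k : Fin 31, b k ∈ K.carrier := by
    intro k
    induction k using WellFoundedLT.induction with
    | ind k ih =>
      rcases lt_or_ge k 3 with h | h
      · obtain ⟨j, hj⟩ := exists_b_eq_w k h
        rw [hj, ← ι_coweight]
        exact hK (Or.inl (Or.inl ⟨_, rfl⟩))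
      · rcases brVec_gen k h with ⟨x, rfl⟩ | ⟨x, rfl⟩ | ⟨i, j, hi, hj, hT, h0, -⟩
        · exact he x
        · exact hf x
        · have := K.br_mem _ (ih i hi) _ (ih j hj)
          rw [br_b, hT] at this
          simp only [vec, bN_coe, add_zero] at this
          exact (Submodule.smul_mem_iff _ (Int.cast_ne_zero.2 h0)).1 this
  rw [eq_top_iff, ← b.span_eq, Submodule.span_le]
  rintro _ ⟨k, rfl⟩
  exact key k

/-- The index of the root vector of the opposite root; the value at `k < 3` is irrelevant. -/
def opp (k : Fin 31) : Fin 31 := if (k : ℕ) < 17 then k + 14 else k - 14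

/-- The bracket of two opposite root vectors is a nonzero element of the Cartan subalgebra. -/
theorem brVec_opp : ∀ k : Fin 31, 3 ≤ k → brVec k (opp k) ≠ [] ∧
    ∀ x ∈ brVec k (opp k), x.1 < 3 ∧ coef (brVec k (opp k)) x.1 ≠ 0 := by
  decide +kernel

/-- The eigenvalue on `b k` of `w 0 + 10 w 1 + 100 w 2`. The coefficients of the roots lie between
`-3` and `3`, so distinct weights give distinct eigenvalues. -/
def genericWt (k : Fin 31) : ℤ := wt 0 k + 10 * wt 1 k + 100 * wt 2 k

theorem genericWt_inj : ∀ k l : Fin 31, 3 ≤ k → genericWt k = genericWt l → k = l := by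
  decide +kernel

theorem br_opp (k : Fin 31) (hk : 3 ≤ k) : ∃ h, h ≠ 0 ∧ br (b k) (b (opp k)) = ι h := by
  obtain ⟨h0, h1⟩ := brVec_opp k hk
  rw [br_b]
  have hmem : ∀ l : SVec, (∀ x ∈ l, x.1 < 3) → ∃ h, vec l = ι h := by
    intro l
    induction l with
    | nil => exact fun _ => ⟨0, by simp [vec]⟩
    | cons x l ih =>
      intro hl
      obtain ⟨k, c⟩ := x
      obtain ⟨h, hh⟩ := ih fun x hx => hl x (List.mem_cons_of_mem _ hx)
      have hk : k < 3 := hl _ List.mem_cons_self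
      refine ⟨(c : ℂ) • coweight ⟨k, hk⟩ + h, ?_⟩
      rw [map_add, map_smul, ι_coweight, vec, hh, bN, dif_pos (by omega)]
      rfl
  obtain ⟨h, hh⟩ := hmem _ fun x hx => (h1 x hx).1
  refine ⟨h, ?_, hh⟩
  rintro rfl
  obtain ⟨x, hx⟩ := List.exists_mem_of_ne_nil _ h0
  have := vec_apply (brVec k (opp k)) ⟨x.1, by have := (h1 x hx).1; omega⟩
  rw [hh, map_zero, map_zero] at this
  exact (h1 x hx).2 (Int.cast_eq_zero.1 this.symm)

/-- A nonzero graded ideal of the model meets the Cartan subalgebra: by the weight decomposition, it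
contains a nonzero element of the Cartan subalgebra or a root vector, and the bracket of the latter
with an opposite root vector is nonzero. -/
theorem ideal_eq_bot (I : SuperIdeal G3Model) (hI : ∀ h, ι h ∈ I.carrier → h = 0) :
    I.carrier = ⊥ := by
  rw [eq_bot_iff]
  intro x hx
  let D : G3Model := w 0 + (10 : ℂ) • w 1 + (100 : ℂ) • w 2
  have hD : ∀ k, b k ∈ Module.End.eigenspace (br D) (genericWt k : ℂ) := fun k => by
    rw [Module.End.mem_eigenspace_iff]
    simp only [D, map_add, map_smul, LinearMap.add_apply, LinearMap.smul_apply, br_w_b, genericWt]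
    push_cast
    module
  have h3 : ∀ k : Fin 31, 3 ≤ k → b.repr x k = 0 := by
    intro k hk
    by_contra h0
    have hmem : b.repr x k • b k ∈ I.carrier := by
      refine eigen_component_mem (br D) (fun y => I.br_mem_left D y)
        (x' := ∑ l ∈ Finset.univ.erase k, b.repr x l • b l)
        (Submodule.smul_mem _ _ (hD k)) ?_ ?_
      · refine Submodule.sum_mem _ fun l hl => Submodule.smul_mem _ _ ?_
        refine Submodule.mem_iSup_of_mem (genericWt l : ℂ) (Submodule.mem_iSup_of_mem ?_ (hD l))
        intro h
        exact (Finset.mem_erase.1 hl).1 (genericWt_inj k l hk (by exact_mod_cast h.symm)).symm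
      · rw [Finset.add_sum_erase _ (fun l => b.repr x l • b l) (Finset.mem_univ k), b.sum_repr]
        exact hx
    have hk' : b k ∈ I.carrier := (Submodule.smul_mem_iff _ h0).1 hmem
    obtain ⟨h, hne, hh⟩ := br_opp k hk
    exact hne (hI h (by rw [← hh]; exact I.br_mem_right _ _ hk'))
  have hx' : x = ι (∑ j : Fin 3, b.repr x (Fin.castLE (by norm_num) j) • coweight j) := by
    simp only [map_sum, map_smul, ι_coweight]
    apply b.repr.injective
    ext k
    simp only [map_sum, map_smul, w, Module.Basis.repr_self, Finsupp.finsetSum_apply,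
      Finsupp.smul_apply, Finsupp.single_apply]
    rcases lt_or_ge k 3 with h | h
    · obtain ⟨j, rfl⟩ : ∃ j : Fin 3, k = Fin.castLE (by norm_num) j := ⟨⟨k, h⟩, rfl⟩
      simp
    · rw [h3 k h]
      symm
      refine Finset.sum_eq_zero fun j _ => ?_
      rw [if_neg, smul_zero]
      rintro rfl
      exact absurd j.2 (not_lt.2 h)
  rw [hx'] at hx ⊢
  rw [hI _ hx, map_zero]
  exact Submodule.zero_mem _

/-- The model is simple: a nonzero ideal contains a nonzero `ι h`, hence some `e x`, hence a coroot,
and all off-diagonal entries of the Cartan matrix are nonzero. -/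
theorem ideal_eq_top (I : SuperIdeal G3Model) (hI : I.carrier ≠ ⊥) : I.carrier = ⊤ := by
  have he : ∀ {h x}, ι h ∈ I.carrier → datumG3.b x h ≠ 0 → realization.e x ∈ I.carrier := by
    intro h x hh h0
    have := I.br_mem_right _ (realization.e x) hh
    rw [show br (ι h) _ = _ from realization.he h x] at this
    exact (Submodule.smul_mem_iff _ h0).1 this
  have hf : ∀ {h x}, ι h ∈ I.carrier → datumG3.b x h ≠ 0 → realization.f x ∈ I.carrier := by
    intro h x hh h0
    have := I.br_mem_right _ (realization.f x) hh
    rw [show br (ι h) _ = _ from realization.hf h x, ← neg_smul] at this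
    exact (Submodule.smul_mem_iff _ (neg_ne_zero.2 h0)).1 this
  have ha : ∀ {x}, realization.e x ∈ I.carrier → ι (datumG3.a x) ∈ I.carrier := by
    intro x hx
    rw [← show _ = ι (datumG3.a x) from realization.ef x]
    exact I.br_mem_right _ _ hx
  have hA : ∀ x y, x ≠ y → datumG3.b y (datumG3.a x) ≠ 0 := by
    intro x y hxy
    have : datumG3.b y (datumG3.a x) = cartanG3 x y := by
      simp [datumG3, rootDatumOfDet, Fintype.linearCombination_apply, Pi.single_apply]
    rw [this]
    fin_cases x <;> fin_cases y <;> simp [cartanG3] at hxy ⊢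
  obtain ⟨x, hx⟩ : ∃ x, ι (datumG3.a x) ∈ I.carrier := by
    by_contra! hno
    refine hI (ideal_eq_bot I fun h hh => ?_)
    by_contra h0
    obtain ⟨x, hx⟩ : ∃ x, datumG3.b x h ≠ 0 := by
      by_contra! hz
      exact h0 (rootValues_injective (by rw [map_zero]; exact funext hz))
    exact hno x (ha (he hh hx))
  have hall : ∀ y, ι (datumG3.a y) ∈ I.carrier := fun y => by
    by_cases hxy : x = y
    · exact hxy ▸ hx
    · exact ha (he hx (hA x y hxy))
  have hnext : ∀ y : Fin 3, ∃ z, z ≠ y := by decide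
  refine generates ⟨I.carrier, I.par_mem, fun y _ z hz => I.br_mem_left y z hz⟩
    (Realization.gens_subset (fun h => ?_) (fun y => ?_) (fun y => ?_))
  · have : h = ∑ y, h y • datumG3.a y := by
      ext z
      simp [datumG3, rootDatumOfDet, Pi.single_apply]
    rw [this, map_sum]
    exact Submodule.sum_mem _ fun y _ => by
      rw [map_smul]; exact Submodule.smul_mem _ _ (hall y)
  · obtain ⟨z, hz⟩ := hnext y
    exact he (hall z) (hA z y hz)
  · obtain ⟨z, hz⟩ := hnext y
    exact hf (hall z) (hA z y hz)

theorem ker_lift : (maxIdeal datumG3).carrier = LinearMap.ker realization.lift := by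
  refine realization.ker_lift generates ι_injective (ρ := ∑ j, coweight j) (fun x => ?_)
    ideal_eq_bot
  have : rootValues (∑ j, coweight j) x = 1 := by
    simp [map_sum, rootValues_coweight, Pi.single_apply]
  exact this

/-- The isomorphism of `G(3)` with the model. -/
def isoG3 : Iso G3 G3Model := realization.isoOfKer generates ker_lift

/-- The Killing form on the Cartan subalgebra: a signed sum over the weights. -/
theorem killing_w (i j : Fin 3) :
    killingBilin G3Model (w i) (w j) = ∑ k : Fin 31, (-1) ^ (p k).val * (wt i k * wt j k : ℂ) := by
  rw [killingBilin_apply, LinearMap.trace_eq_matrix_trace ℂ b, Matrix.trace]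
  refine Finset.sum_congr rfl fun k _ => ?_
  rw [Matrix.diag_apply, LinearMap.toMatrix_apply]
  simp [br_w_b, par_b]
  ring

theorem killing_w_one : killingBilin G3Model (w 1) (w 1) = 8 := by
  have h : ∑ k : Fin 31, (bif Nat.beq (parNat k) 0 then 1 else -1) * (wt 1 k * wt 1 k) = 8 := by
    decide +kernel
  rw [killing_w]
  have h' := congrArg (Int.cast : ℤ → ℂ) h
  push_cast at h'
  rw [← h']
  refine Finset.sum_congr rfl fun k _ => ?_
  congr 1
  rcases parNat_cases k with h | h <;> simp [p, h, ZMod.val_one, show Nat.beq 1 0 = false from rfl]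

/-- The lowest root vector, of weight `-θ = -(3 α₁ + 2 α₂ + 2 α₃)`. -/
def lowVec : G3Model := b 30

/-- The highest root vector, of weight `θ`. The factor `1 / 6` makes `[lowVec, highVec]` the coroot
with the values prescribed by the second row of `cartanG3Aff1`. -/
def highVec : G3Model := (1 / 6 : ℂ) • b 16

theorem br_low_high : br lowVec highVec = (-3 / 2 : ℂ) • w 1 := by
  have h : brVec (30 : Fin 31) (16 : Fin 31) = [(1, -9)] := by decide +kernel
  rw [lowVec, highVec, map_smul, br_b, h]
  have e1 : bN 1 = w 1 := rfl
  simp only [vec, e1]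
  module

theorem wt_low : ∀ j, wt j 30 = ![-3, -2, -2] j := by decide +kernel
theorem wt_high : ∀ j, wt j 16 = ![3, 2, 2] j := by decide +kernel

theorem br_w_low (j : Fin 3) : br (w j) lowVec = -(![3, 2, 2] j : ℂ) • lowVec := by
  rw [lowVec, br_w_b, wt_low]
  fin_cases j <;> simp

theorem br_w_high (j : Fin 3) : br (w j) highVec = (![3, 2, 2] j : ℂ) • highVec := by
  rw [highVec, map_smul, br_w_b, wt_high]
  fin_cases j <;> simp [smul_smul, mul_comm]

theorem low_mem : lowVec ∈ homog par 0 := b_mem 30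

theorem high_mem : highVec ∈ homog par 0 := Submodule.smul_mem _ _ (b_mem 16)

theorem br_f_low (x : Fin 3) : br (realization.f x) lowVec = 0 := by
  have h : ∀ x : Fin 3, brVec (fIdx x) (30 : Fin 31) = [] := by decide +kernel
  show br ((1 / 2 : ℂ) • b (fIdx x)) (b 30) = 0
  rw [map_smul, LinearMap.smul_apply, br_b, h, vec, smul_zero]

theorem br_e_high (x : Fin 3) : br (realization.e x) highVec = 0 := by
  have h : ∀ x : Fin 3, brVec (eIdx x) (16 : Fin 31) = [] := by decide +kernel
  show br (b (eIdx x)) ((1 / 6 : ℂ) • b 16) = 0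
  rw [map_smul, br_b, h, vec, smul_zero]

/-- By invariance, `κ(w 1, [lowVec, highVec]) = κ([w 1, lowVec], highVec)`. -/
theorem killing_low_high : killingBilin G3Model lowVec highVec = 6 := by
  have h := (killing G3Model).invariant (w 1) lowVec highVec
  rw [br_w_low, br_low_high] at h
  simp only [killing, map_smul, LinearMap.smul_apply, killing_w_one] at h
  simp at h
  linear_combination (-1 / 2 : ℂ) * h

end G3Model

/-! ### Isomorphisms and affinizations -/

namespace LieSuperalgebra.Iso

variable {L L' L'' : Type*} [AddCommGroup L] [Module ℂ L] [LieSuperalgebra L]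
  [AddCommGroup L'] [Module ℂ L'] [LieSuperalgebra L']
  [AddCommGroup L''] [Module ℂ L''] [LieSuperalgebra L'']

theorem map_mem (φ : Iso L L') {i : ZMod 2} {x : L} (hx : x ∈ homog par i) :
    φ.toEquiv x ∈ homog par i := by
  rw [mem_homog] at *
  rw [← φ.map_par, hx, map_smul]

/-- The inverse isomorphism. -/
def symm (φ : Iso L L') : Iso L' L where
  toEquiv := φ.toEquiv.symm
  map_par x := by rw [LinearEquiv.symm_apply_eq, φ.map_par, LinearEquiv.apply_symm_apply]
  map_br x y := by
    rw [LinearEquiv.symm_apply_eq, φ.map_br, LinearEquiv.apply_symm_apply,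
      LinearEquiv.apply_symm_apply]

/-- The composite of two isomorphisms. -/
def trans (φ : Iso L L') (ψ : Iso L' L'') : Iso L L'' where
  toEquiv := φ.toEquiv.trans ψ.toEquiv
  map_par x := by simp [φ.map_par, ψ.map_par]
  map_br x y := by simp [φ.map_br, ψ.map_br]

theorem killingBilin_apply (φ : Iso L L') (x y : L) :
    killingBilin L' (φ.toEquiv x) (φ.toEquiv y) = killingBilin L x y := by
  rw [_root_.killingBilin_apply, _root_.killingBilin_apply, ← LinearMap.trace_conj' _ φ.toEquiv]
  congr 1
  ext z
  simp [LinearEquiv.conj_apply, φ.map_par, φ.map_br]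

/-- An isomorphism of Lie superalgebras induces an isomorphism of their affinizations with respect
to the Killing forms. -/
def affinization (φ : Iso L L') : Iso (Affinization (killing L)) (Affinization (killing L')) where
  toEquiv := LinearEquiv.prodCongr (Finsupp.mapRange.linearEquiv φ.toEquiv)
    (LinearEquiv.refl ℂ (ℂ × ℂ))
  map_par x := by
    refine Affinization.ext ?_ rfl rfl
    show Finsupp.mapRange.linearMap φ.toEquiv.toLinearMap (Loop.parity (Affinization.loop _ x)) =
      Loop.parity (Finsupp.mapRange.linearMap φ.toEquiv.toLinearMap (Affinization.loop _ x))
    ext m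
    simp [Loop.parity, φ.map_par]
  map_br x y := by
    have hbr : ∀ f g : ℤ →₀ L, Finsupp.mapRange.linearMap φ.toEquiv.toLinearMap (Loop.bracket f g) =
        Loop.bracket (Finsupp.mapRange.linearMap φ.toEquiv.toLinearMap f)
          (Finsupp.mapRange.linearMap φ.toEquiv.toLinearMap g) := by
      intro f g
      induction f using Loop.induct' with
      | zero => simp
      | add f f' hf hf' => simp only [map_add, LinearMap.add_apply, hf, hf']
      | single m x =>
        induction g using Loop.induct' with
        | zero => simp
        | add f g hf hg => simp only [map_add, hf, hg]
        | single n y => simp [φ.map_br]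
    have hder : ∀ f : ℤ →₀ L, Finsupp.mapRange.linearMap φ.toEquiv.toLinearMap (Loop.deriv f) =
        Loop.deriv (Finsupp.mapRange.linearMap φ.toEquiv.toLinearMap f) := by
      intro f
      induction f using Loop.induct' with
      | zero => simp
      | add f g hf hg => simp only [map_add, hf, hg]
      | single n y => simp
    have hco : ∀ f g : ℤ →₀ L, Loop.cocycle (killing L) f g =
        Loop.cocycle (killing L') (Finsupp.mapRange.linearMap φ.toEquiv.toLinearMap f)
          (Finsupp.mapRange.linearMap φ.toEquiv.toLinearMap g) := by
      intro f g
      induction f using Loop.induct' with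
      | zero => simp
      | add f f' hf hf' => simp only [map_add, LinearMap.add_apply, hf, hf']
      | single m x =>
        induction g using Loop.induct' with
        | zero => simp
        | add f g hf hg => simp only [map_add, hf, hg]
        | single n y => simp [killing, φ.killingBilin_apply]
    refine Affinization.ext ?_ ?_ rfl
    · show Finsupp.mapRange.linearMap φ.toEquiv.toLinearMap (Loop.bracket (Affinization.loop _ x)
        (Affinization.loop _ y) + Affinization.coeffD _ x • Loop.deriv (Affinization.loop _ y) -
          Affinization.coeffD _ y • Loop.deriv (Affinization.loop _ x)) = _
      rw [map_sub, map_add, map_smul, map_smul, hbr, hder, hder]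
      rfl
    · exact hco _ _

end LieSuperalgebra.Iso

theorem AdmitsCartanDatum.of_iso {L L' : Type*} [AddCommGroup L] [Module ℂ L] [LieSuperalgebra L]
    [AddCommGroup L'] [Module ℂ L'] [LieSuperalgebra L'] {X : Type*} [Fintype X] [DecidableEq X]
    {A : Matrix X X ℂ} {p : X → ZMod 2} (h : AdmitsCartanDatum L' A p) (φ : Iso L L') :
    AdmitsCartanDatum L A p := by
  obtain ⟨H, i1, i2, v, hA, hp, hH, ⟨ψ⟩⟩ := h
  exact ⟨H, i1, i2, v, hA, hp, hH, ⟨φ.trans ψ⟩⟩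

namespace Affinization

variable {L : Type*} [AddCommGroup L] [Module ℂ L] [LieSuperalgebra L] (B : InvariantForm L)

/-- The element `x t^m`. -/
def term (m : ℤ) : L →ₗ[ℂ] Affinization B where
  toFun x := mk B (Finsupp.single m x) 0 0
  map_add' x y := by apply ext <;> simp
  map_smul' c x := by apply ext <;> simp

@[simp] theorem loop_term (m : ℤ) (x : L) : loop B (term B m x) = Finsupp.single m x := rfl
@[simp] theorem coeffK_term (m : ℤ) (x : L) : coeffK B (term B m x) = 0 := rfl
@[simp] theorem coeffD_term (m : ℤ) (x : L) : coeffD B (term B m x) = 0 := rfl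

theorem br_term_term (m n : ℤ) (x y : L) : br (term B m x) (term B n y) =
    mk B (Finsupp.single (m + n) (br x y)) (if m + n = 0 then m * B.form x y else 0) 0 := by
  show bracket B _ _ = _
  apply ext <;> simp

theorem br_mk_term (x : L) (k s : ℂ) (n : ℤ) (y : L) :
    br (mk B (Finsupp.single 0 x) k s) (term B n y) = term B n (br x y + (s * n) • y) := by
  show bracket B _ _ = _
  apply ext <;> simp [smul_smul]

theorem br_mk_mk (x y : L) (k s k' s' : ℂ) :
    br (mk B (Finsupp.single 0 x) k s) (mk B (Finsupp.single 0 y) k' s') = term B 0 (br x y) := by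
  show bracket B _ _ = _
  apply ext <;> simp

theorem par_term (m : ℤ) (x : L) : par (term B m x) = term B m (par x) := by
  show parity B _ = _
  apply ext <;> simp

theorem term_mem {m : ℤ} {i : ZMod 2} {x : L} (hx : x ∈ homog par i) :
    term B m x ∈ homog par i := by
  rw [mem_homog] at *
  rw [par_term, hx, map_smul]

theorem mk_mem {x : L} (hx : x ∈ homog par 0) (k s : ℂ) :
    mk B (Finsupp.single 0 x) k s ∈ homog par 0 := by
  rw [mem_homog] at *
  show parity B _ = _
  apply ext <;> simp [hx]

theorem eq_sum_terms (z : Affinization B) : z = ∑ m ∈ (loop B z).support, term B m (loop B z m) +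
    mk B 0 (coeffK B z) (coeffD B z) := by
  apply ext
  · rw [map_add, map_sum]
    simp only [loop_term, loop_mk, add_zero]
    exact (Finsupp.sum_single (loop B z)).symm
  · rw [map_add, map_sum]; simp
  · rw [map_add, map_sum]; simp

theorem mem_of_terms_mem {K : Submodule ℂ (Affinization B)} (h1 : ∀ m x, term B m x ∈ K)
    (h2 : ∀ k s, mk B 0 k s ∈ K) (z : Affinization B) : z ∈ K := by
  rw [eq_sum_terms B z]
  exact K.add_mem (K.sum_mem fun m _ => h1 _ _) (h2 _ _)

/-- The elements `x` with `x t^m ∈ K` form an ideal of `L`, if `K` is stable under bracketing with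
`L t^0`. -/
def coeffIdeal {K : Submodule ℂ (Affinization B)} (hpar : ∀ x ∈ K, par x ∈ K) (m : ℤ)
    (hl : ∀ y, ∀ x ∈ K, br (term B 0 y) x ∈ K) (hr : ∀ y, ∀ x ∈ K, br x (term B 0 y) ∈ K) :
    SuperIdeal L where
  carrier := K.comap (term B m)
  par_mem x hx := by
    rw [Submodule.mem_comap, ← par_term]
    exact hpar _ hx
  br_mem_left x y hy := by
    have := hl x _ hy
    rw [br_term_term, zero_add, Int.cast_zero, zero_mul, ite_self] at this
    exact this
  br_mem_right x y hx := by
    have := hr y _ hx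
    rw [br_term_term, add_zero] at this
    have h0 : (if m = 0 then (m : ℂ) * B.form x y else 0) = 0 := by
      split_ifs with h
      · simp [h]
      · rfl
    rw [h0] at this
    exact this

/-- An ideal of the affinization contains the components in nonzero degrees of its elements, since
these are eigenvectors of `ad d`. -/
theorem term_loop_mem (I : SuperIdeal (Affinization B)) {z : Affinization B} (hz : z ∈ I.carrier)
    {m : ℤ} (hm : m ≠ 0) : term B m (loop B z m) ∈ I.carrier := by
  have hterm : ∀ (n : ℤ) (x : L), term B n x ∈ Module.End.eigenspace (br (mk B 0 0 1)) (n : ℂ) := by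
    intro n x
    rw [Module.End.mem_eigenspace_iff]
    have := br_mk_term B 0 0 1 n x
    simpa using this
  have hzero : ∀ k s, mk B 0 k s ∈ Module.End.eigenspace (br (mk B 0 0 1)) ((0 : ℤ) : ℂ) := by
    intro k s
    rw [Module.End.mem_eigenspace_iff]
    have := br_mk_mk B 0 0 0 1 k s
    simpa using this
  refine eigen_component_mem (br (mk B 0 0 1)) (fun y => I.br_mem_left _ y) (hterm m _)
    (x' := ∑ n ∈ (loop B z).support.erase m, term B n (loop B z n) +
      mk B 0 (coeffK B z) (coeffD B z)) ?_ ?_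
  · refine Submodule.add_mem _ (Submodule.sum_mem _ fun n hn => ?_) ?_
    · refine Submodule.mem_iSup_of_mem (n : ℂ) (Submodule.mem_iSup_of_mem ?_ (hterm n _))
      exact fun h => (Finset.mem_erase.1 hn).1 (by exact_mod_cast h)
    · refine Submodule.mem_iSup_of_mem ((0 : ℤ) : ℂ) (Submodule.mem_iSup_of_mem ?_ (hzero _ _))
      exact fun h => hm (by exact_mod_cast h.symm)
  · rw [← add_assoc]
    have : term B m (loop B z m) + ∑ n ∈ (loop B z).support.erase m, term B n (loop B z n) =
        ∑ n ∈ (loop B z).support, term B n (loop B z n) := by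
      by_cases h : m ∈ (loop B z).support
      · exact Finset.add_sum_erase _ (fun n => term B n (loop B z n)) h
      · rw [Finsupp.notMem_support_iff.1 h, map_zero, zero_add, Finset.erase_eq_of_notMem h]
    rw [this, ← eq_sum_terms]
    exact hz

end Affinization

/-! ### The affinization of `G(3)` as a contragredient superalgebra -/

namespace G3Model

open Affinization

/-- The Killing form of the model. -/
abbrev κ : InvariantForm G3Model := killing G3Model

theorem low_ne_zero : lowVec ≠ 0 := b.ne_zero 30

theorem br_low_high_ne_zero : br lowVec highVec ≠ 0 := by
  rw [br_low_high]
  exact smul_ne_zero (by norm_num) (b.ne_zero _)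

theorem high_ne_zero : highVec ≠ 0 := fun h => br_low_high_ne_zero (by rw [h, map_zero])

/-- If `ad x` is a scalar then `x = 0`. The scalar vanishes as the even part of `x` acts by a
derivation, and the centre is an ideal. -/
theorem eq_zero_of_ad_scalar {x : G3Model} {s : ℂ} (h : ∀ y, br x y = s • y) : s = 0 ∧ x = 0 := by
  have hp : ∀ y, br (par x) y = s • y := fun y => by
    have := congrArg par (h (par y))
    rwa [par_br, par_par, map_smul, par_par] at this
  have hs : s = 0 := by
    have hx0 : (1 / 2 : ℂ) • (x + par x) ∈ homog par 0 := by
      rw [mem_homog]; simp [par_par, add_comm]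
    have hx0' : ∀ y, br ((1 / 2 : ℂ) • (x + par x)) y = s • y := fun y => by
      rw [map_smul, map_add, LinearMap.smul_apply, LinearMap.add_apply, h, hp]
      module
    have := jacobi_even hx0 low_mem highVec
    rw [hx0', hx0', hx0', map_smul, map_smul, LinearMap.smul_apply, left_eq_add] at this
    exact (smul_eq_zero.1 this).resolve_right br_low_high_ne_zero
  refine ⟨hs, ?_⟩
  subst hs
  simp only [zero_smul] at h hp
  let Z : SuperIdeal G3Model :=
    { carrier :=
        { carrier := {x | ∀ y, br x y = 0 ∧ br y x = 0}
          zero_mem' := fun y => by simp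
          add_mem' := fun {x x'} hx hx' y => by simp [hx y, hx' y]
          smul_mem' := fun c x hx y => by simp [hx y] }
      par_mem := fun x hx y => by
        constructor
        · have := congrArg par (hx (par y)).1
          rwa [par_br, par_par, map_zero] at this
        · have := congrArg par (hx (par y)).2
          rwa [par_br, par_par, map_zero] at this
      br_mem_left := fun x y hy z => by rw [(hy x).2]; simp
      br_mem_right := fun x y hx z => by rw [(hx y).1]; simp }
  have hx : x ∈ Z.carrier := by
    intro y
    refine ⟨h y, ?_⟩
    obtain ⟨y0, h0, y1, h1, rfl⟩ := exists_homog y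
    have e : x = (1 / 2 : ℂ) • (x + par x) + (1 / 2 : ℂ) • (x - par x) := by module
    have hx0 : (1 / 2 : ℂ) • (x + par x) ∈ homog par 0 := by
      rw [mem_homog]; simp [par_par, add_comm]
    have hx1 : (1 / 2 : ℂ) • (x - par x) ∈ homog par 1 := by
      rw [mem_homog]; simp [par_par, ZMod.val_one, ← smul_neg]
    rw [e, map_add, map_add, LinearMap.add_apply, LinearMap.add_apply, skew _ _ _ _ h0 hx0,
      skew _ _ _ _ h0 hx1, skew _ _ _ _ h1 hx0, skew _ _ _ _ h1 hx1]
    simp [h, hp]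
  by_contra h0
  have hZ : Z.carrier = ⊤ := ideal_eq_top Z fun hb => h0 (by rw [hb] at hx; exact hx)
  have hl : lowVec ∈ Z.carrier := by rw [hZ]; trivial
  exact br_low_high_ne_zero (hl highVec).1

/-- The root vectors of the simple roots `ε₃ - δ₁, δ + ε₁ - ε₃, ε₂, δ₁ - ε₂` of the affinization are
the `affE x t ^ affDeg x`. -/
def affE : Fin 4 → G3Model :=
  ![realization.e 1, lowVec, realization.e 0, realization.e 2]

/-- The root vectors opposite to the simple ones are the `affF x t ^ (-affDeg x)`. -/
def affF : Fin 4 → G3Model :=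
  ![realization.f 1, highVec, realization.f 0, realization.f 2]

/-- The coefficients of `δ` in the simple roots. -/
def affDeg : Fin 4 → ℤ := ![0, 1, 0, 0]

/-- The components in the Cartan subalgebra of `G(3)` of the simple coroots. -/
def affA : Fin 4 → Fin 3 → ℂ :=
  ![Pi.single 1 1, (-3 / 2 : ℂ) • coweight 1, Pi.single 0 1, Pi.single 2 1]

/-- The restrictions of the simple roots to the Cartan subalgebra of `G(3)`. -/
def affB : Fin 4 → Module.Dual ℂ (Fin 3 → ℂ) :=
  ![datumG3.b 1, -((3 : ℂ) • datumG3.b 0 + (2 : ℂ) • datumG3.b 1 + (2 : ℂ) • datumG3.b 2),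
    datumG3.b 0, datumG3.b 2]

/-- The coefficients of `K` in the simple coroots. -/
def affK : Fin 4 → ℂ := ![0, 6, 0, 0]

theorem b_coweight (i j : Fin 3) : datumG3.b i (coweight j) = Pi.single (M := fun _ => ℂ) j 1 i :=
  congrFun (rootValues_coweight j) i

theorem b_single (i j : Fin 3) : datumG3.b i (Pi.single j 1) = cartanG3 j i := by
  simp [datumG3, rootDatumOfDet, Fintype.linearCombination_apply, Pi.single_apply]

/-- The affine root datum with the simple coroots scaled by `c`. An element `(h, k, s)` of its
Cartan subalgebra stands for `h + k K + s d`. -/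
def affDatum (c : ℂ) (hc : c ≠ 0) : SuperRootDatum (Fin 4) ((Fin 3 → ℂ) × ℂ × ℂ) where
  finite := inferInstance
  a x := c • (affA x, affK x, 0)
  b x := affB x ∘ₗ LinearMap.fst ℂ _ _ +
    (affDeg x : ℂ) • (LinearMap.snd ℂ ℂ ℂ ∘ₗ LinearMap.snd ℂ (Fin 3 → ℂ) (ℂ × ℂ))
  p := parityG3Aff
  a_indep := by
    rw [Fintype.linearIndependent_iff]
    intro g hg
    simp only [Fin.sum_univ_four, affA, affK] at hg
    have hK := congrArg (fun z => z.2.1) hg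
    simp [hc] at hK
    have h1 := congrArg (fun z => z.1) hg
    simp [hK] at h1
    have e0 := congrFun h1 0
    have e1 := congrFun h1 1
    have e2 := congrFun h1 2
    simp [hc] at e0 e1 e2
    intro i
    fin_cases i
    exacts [e1, hK, e0, e2]
  b_indep := by
    rw [Fintype.linearIndependent_iff]
    intro g hg
    have hD := LinearMap.congr_fun hg (0, 0, 1)
    simp [Fin.sum_univ_four, affB, affDeg] at hD
    have hj : ∀ j, _ := fun j => LinearMap.congr_fun hg (coweight j, 0, 0)
    simp [Fin.sum_univ_four, affB, affDeg, hD, b_coweight] at hj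
    have e0 := hj 0
    have e1 := hj 1
    have e2 := hj 2
    simp at e0 e1 e2
    intro i
    fin_cases i
    exacts [e1, hD, e0, e2]

theorem affB_affA (x y : Fin 4) : affB y (affA x) = cartanG3Aff1 x y := by
  fin_cases x <;> fin_cases y <;>
    simp [affA, affB, b_single, b_coweight, cartanG3, cartanG3Aff1] <;> norm_num

theorem affDatum_cartan (c : ℂ) (hc : c ≠ 0) : (affDatum c hc).cartan = c • cartanG3Aff1 := by
  ext x y
  show affB y (c • affA x) + affDeg y * (c * 0) = c * cartanG3Aff1 x y
  rw [map_smul, affB_affA, smul_eq_mul, mul_zero, mul_zero, add_zero]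

/-- The kernel is spanned by the coefficients of `δ` in terms of the simple roots. -/
theorem rank_cartan (c : ℂ) (hc : c ≠ 0) : (c • cartanG3Aff1).rank = 3 := by
  have hker : LinearMap.ker (c • cartanG3Aff1).mulVecLin = Submodule.span ℂ {![2, 1, 3, 2]} := by
    ext x
    rw [LinearMap.mem_ker, Submodule.mem_span_singleton, Matrix.mulVecLin_apply,
      Matrix.smul_mulVec, smul_eq_zero_iff_right hc]
    constructor
    · intro h
      have h0 := congrFun h 0
      have h1 := congrFun h 1
      have h3 := congrFun h 3
      simp [cartanG3Aff1, Matrix.mulVec, dotProduct, Fin.sum_univ_four] at h0 h1 h3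
      refine ⟨x 1, ?_⟩
      ext i
      fin_cases i <;> simp
      · linear_combination (2 / 3 : ℂ) * h1
      · linear_combination h1 + h3
      · linear_combination (-2 / 3 : ℂ) * h0 + (1 / 3 : ℂ) * (h1 + h3)
    · rintro ⟨r, rfl⟩
      ext i
      fin_cases i <;> simp [cartanG3Aff1, Matrix.mulVec, dotProduct, Fin.sum_univ_four] <;> ring
  have h := LinearMap.finrank_range_add_finrank_ker (c • cartanG3Aff1).mulVecLin
  rw [hker, finrank_span_singleton (by intro h; simpa using congrFun h 0)] at h
  simp at h
  exact h

theorem affE_mem (x : Fin 4) : affE x ∈ homog par (parityG3Aff x) := by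
  fin_cases x
  exacts [realization.e_mem 1, low_mem, realization.e_mem 0, realization.e_mem 2]

theorem affF_mem (x : Fin 4) : affF x ∈ homog par (parityG3Aff x) := by
  fin_cases x
  exacts [realization.f_mem 1, high_mem, realization.f_mem 0, realization.f_mem 2]

theorem br_ι_affE (h : Fin 3 → ℂ) (x : Fin 4) : br (ι h) (affE x) = affB x h • affE x := by
  have hl : br (ι h) lowVec = affB 1 h • lowVec := by
    rw [ι_apply]
    simp [affB, br_w_low, Fin.sum_univ_three]
    module
  fin_cases x
  exacts [realization.he h 1, hl, realization.he h 0, realization.he h 2]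

theorem br_ι_affF (h : Fin 3 → ℂ) (x : Fin 4) : br (ι h) (affF x) = -(affB x h • affF x) := by
  have hl : br (ι h) highVec = -(affB 1 h • highVec) := by
    rw [ι_apply]
    simp [affB, br_w_high, Fin.sum_univ_three]
    module
  fin_cases x
  exacts [realization.hf h 1, hl, realization.hf h 0, realization.hf h 2]

theorem br_low_f (x : Fin 3) : br lowVec (realization.f x) = 0 := by
  rw [skew _ _ _ _ low_mem (realization.f_mem x), br_f_low]
  simp

theorem br_affE_affF (x : Fin 4) : br (affE x) (affF x) = ι (affA x) := by
  have hl : br lowVec highVec = ι ((-3 / 2 : ℂ) • coweight 1) := by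
    rw [br_low_high, map_smul, ι_coweight]
  fin_cases x
  exacts [realization.ef 1, hl, realization.ef 0, realization.ef 2]

theorem br_affE_affF_ne (x y : Fin 4) (h : x ≠ y) : br (affE x) (affF y) = 0 := by
  fin_cases x <;> fin_cases y <;> first
    | exact absurd rfl h
    | exact br_low_f _
    | exact br_e_high _
    | exact realization.ef_ne _ _ (by decide)

theorem affDeg_mul_killing (x : Fin 4) : (affDeg x : ℂ) * κ.form (affE x) (affF x) = affK x := by
  have hl : κ.form lowVec highVec = 6 := killing_low_high
  fin_cases x <;> simp [affDeg, affK, affE, affF, hl]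

theorem affDeg_mul_killing_ne (x y : Fin 4) (h : x ≠ y) (h0 : affDeg x + -affDeg y = 0) :
    (affDeg x : ℂ) * κ.form (affE x) (affF y) = 0 := by
  fin_cases x <;> fin_cases y <;> simp [affDeg] at h h0 ⊢

/-- The realization of the affine root datum in the affinization, with the `f x` scaled by `c`. -/
def affRealization (c : ℂ) (hc : c ≠ 0) : Realization (affDatum c hc) (Affinization κ) where
  ι :=
    { toFun := fun h => mk κ (Finsupp.single 0 (ι h.1)) h.2.1 h.2.2
      map_add' := fun h h' => by apply Affinization.ext <;> simp
      map_smul' := fun c h => by apply Affinization.ext <;> simp }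
  e x := term κ (affDeg x) (affE x)
  f x := c • term κ (-affDeg x) (affF x)
  ι_mem h := mk_mem κ (realization.ι_mem h.1) _ _
  e_mem x := term_mem κ (affE_mem x)
  f_mem x := Submodule.smul_mem _ _ (term_mem κ (affF_mem x))
  comm h h' := by
    show br (mk κ (Finsupp.single 0 (ι h.1)) h.2.1 h.2.2)
      (mk κ (Finsupp.single 0 (ι h'.1)) h'.2.1 h'.2.2) = 0
    rw [br_mk_mk, br_ι_ι, map_zero]
  ef x := by
    show br (term κ (affDeg x) (affE x)) (c • term κ (-affDeg x) (affF x)) =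
      mk κ (Finsupp.single 0 (ι (c • affA x))) (c * affK x) (c * 0)
    rw [map_smul, br_term_term, br_affE_affF, add_neg_cancel, if_pos rfl, affDeg_mul_killing]
    apply Affinization.ext <;> simp
  ef_ne x y h := by
    rw [map_smul, br_term_term, br_affE_affF_ne x y h]
    have : (if affDeg x + -affDeg y = 0 then (affDeg x : ℂ) * κ.form (affE x) (affF y) else 0) =
        0 := by
      split_ifs with h0
      · exact affDeg_mul_killing_ne x y h h0
      · rfl
    rw [this]
    apply Affinization.ext <;> simp
  he h x := by
    show br (mk κ (Finsupp.single 0 (ι h.1)) h.2.1 h.2.2) _ = (affB x h.1 + affDeg x * h.2.2) • _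
    rw [br_mk_term, br_ι_affE, ← map_smul]
    congr 1
    module
  hf h x := by
    show br (mk κ (Finsupp.single 0 (ι h.1)) h.2.1 h.2.2) _ =
      -((affB x h.1 + affDeg x * h.2.2) • _)
    rw [map_smul, br_mk_term, br_ι_affF, ← map_smul, ← map_smul, ← map_smul, ← map_neg]
    congr 1
    push_cast
    module

/-- The simple root vectors generate: they generate `L t^0`, and by simplicity the coefficients at
each `t ^ m` are either zero or everything. -/
theorem aff_generates (c : ℂ) (hc : c ≠ 0) : Generates (affRealization c hc).gens := by
  intro K hK
  have hι : ∀ h k s, mk κ (Finsupp.single 0 (ι h)) k s ∈ K.carrier := fun h k s =>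
    hK (Or.inl (Or.inl ⟨(h, k, s), rfl⟩))
  have hKD : ∀ k s, mk κ 0 k s ∈ K.carrier := fun k s => by
    have := hι 0 k s
    rwa [map_zero, Finsupp.single_zero] at this
  have he : ∀ x, term κ (affDeg x) (affE x) ∈ K.carrier := fun x =>
    hK (Or.inl (Or.inr ⟨x, rfl⟩))
  have hf : ∀ x, term κ (-affDeg x) (affF x) ∈ K.carrier := fun x =>
    (Submodule.smul_mem_iff _ hc).1 (hK (Or.inr ⟨x, rfl⟩))
  have h0 : ∀ x, term κ 0 x ∈ K.carrier := by
    let S : SuperSubalgebra G3Model :=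
      { carrier := K.carrier.comap (term κ 0)
        par_mem := fun x hx => by
          rw [Submodule.mem_comap, ← par_term]
          exact K.par_mem _ hx
        br_mem := fun x hx y hy => by
          have := K.br_mem _ hx _ hy
          rw [br_term_term, Int.cast_zero, zero_mul, ite_self] at this
          exact this }
    have hS : S.carrier = ⊤ := by
      refine generates S (Realization.gens_subset (fun h => hι h 0 0) (fun x => ?_) (fun x => ?_))
      · fin_cases x
        exacts [he 2, he 0, he 3]
      · fin_cases x
        exacts [hf 2, hf 0, hf 3]
    intro x
    have : x ∈ S.carrier := by rw [hS]; trivial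
    exact this
  have hideal : ∀ m : ℤ, (∃ x ≠ 0, term κ m x ∈ K.carrier) → ∀ x, term κ m x ∈ K.carrier := by
    rintro m ⟨y, hy, hyK⟩ x
    let I := coeffIdeal κ K.par_mem m (fun y x hx => K.br_mem _ (h0 y) _ hx)
      (fun y x hx => K.br_mem _ hx _ (h0 y))
    have hI : I.carrier = ⊤ := ideal_eq_top I ((Submodule.ne_bot_iff _).2 ⟨y, hyK, hy⟩)
    have : x ∈ I.carrier := by rw [hI]; trivial
    exact this
  have h1 : ∀ x, term κ 1 x ∈ K.carrier := hideal 1 ⟨_, low_ne_zero, he 1⟩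
  have h2 : ∀ x, term κ (-1) x ∈ K.carrier := hideal (-1) ⟨_, high_ne_zero, hf 1⟩
  have hstep : ∀ m n : ℤ, (∀ x, term κ m x ∈ K.carrier) → (∀ x, term κ n x ∈ K.carrier) →
      ∀ x, term κ (m + n) x ∈ K.carrier := by
    intro m n hm hn
    refine hideal _ ⟨_, br_low_high_ne_zero, ?_⟩
    have := K.br_mem _ (hm lowVec) _ (hn highVec)
    rw [br_term_term] at this
    have h3 := K.carrier.sub_mem this
      (hKD (if m + n = 0 then m * κ.form lowVec highVec else 0) 0)
    convert h3 using 1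
    apply Affinization.ext <;> simp
  have hall : ∀ m x, term κ m x ∈ K.carrier := by
    intro m
    induction m using Int.induction_on with
    | zero => exact h0
    | succ n ih => exact hstep n 1 ih h1
    | pred n ih => exact hstep (-n) (-1) ih h2
  rw [eq_top_iff]
  exact fun z _ => mem_of_terms_mem κ hall hKD z

theorem aff_ι_injective (c : ℂ) (hc : c ≠ 0) : Function.Injective (affRealization c hc).ι := by
  intro h h' e
  have e' : mk κ (Finsupp.single 0 (ι h.1)) h.2.1 h.2.2 =
    mk κ (Finsupp.single 0 (ι h'.1)) h'.2.1 h'.2.2 := e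
  have e1 := congrArg (loop κ) e'
  have e2 := congrArg (coeffK κ) e'
  have e3 := congrArg (coeffD κ) e'
  simp only [loop_mk, coeffK_mk, coeffD_mk] at e1 e2 e3
  exact Prod.ext (ι_injective (Finsupp.single_injective 0 e1)) (Prod.ext e2 e3)

/-- A nonzero graded ideal of the affinization meets the Cartan subalgebra. If it contains a nonzero
`x t^m` with `m ≠ 0`, then by simplicity it contains `lowVec t^m`, whose bracket with
`highVec t^(-m)` is a nonzero element of the Cartan subalgebra. Otherwise its elements have
degree zero and commute with all `y t`, so they are multiples of `K`. -/
theorem aff_ideal_eq_bot (c : ℂ) (hc : c ≠ 0) (I : SuperIdeal (Affinization κ))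
    (hI : ∀ h, (affRealization c hc).ι h ∈ I.carrier → h = 0) : I.carrier = ⊥ := by
  have hm : ∀ m : ℤ, m ≠ 0 → ∀ x, term κ m x ∈ I.carrier → x = 0 := by
    intro m hm x hx
    by_contra h0
    let J := coeffIdeal κ I.par_mem m (fun y x hx => I.br_mem_left _ x hx)
      (fun y x hx => I.br_mem_right x _ hx)
    have hJ : J.carrier = ⊤ := ideal_eq_top J ((Submodule.ne_bot_iff _).2 ⟨x, hx, h0⟩)
    have hl : lowVec ∈ J.carrier := by rw [hJ]; trivial
    have h1 : br (term κ m lowVec) (term κ (-m) highVec) ∈ I.carrier := I.br_mem_right _ _ hl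
    rw [br_term_term, add_neg_cancel, if_pos rfl,
      show κ.form lowVec highVec = 6 from killing_low_high, br_low_high, ← ι_coweight,
      ← map_smul] at h1
    have := hI ((-3 / 2 : ℂ) • coweight 1, m * 6, 0) h1
    simp [hm] at this
  rw [eq_bot_iff]
  intro z hz
  have hz0 : z = mk κ (Finsupp.single 0 (loop κ z 0)) (coeffK κ z) (coeffD κ z) := by
    refine Affinization.ext ?_ rfl rfl
    ext1 n
    by_cases hn : n = 0
    · subst hn; simp
    · rw [hm n hn _ (term_loop_mem κ I hz hn)]
      simp [Finsupp.single_eq_of_ne, hn]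
  have hs : ∀ y, br (loop κ z 0) y = (-coeffD κ z) • y := by
    intro y
    have h1 : br z (term κ 1 y) ∈ I.carrier := I.br_mem_right _ _ hz
    rw [hz0, br_mk_term] at h1
    have := hm 1 one_ne_zero _ h1
    rw [eq_neg_of_add_eq_zero_left this]
    simp
  obtain ⟨h1, h2⟩ := eq_zero_of_ad_scalar hs
  rw [h2, neg_eq_zero.1 h1] at hz0
  rw [hz0] at hz ⊢
  have := hI (0, coeffK κ z, 0) (by
    show mk κ (Finsupp.single 0 (ι 0)) _ _ ∈ I.carrier
    rwa [map_zero])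
  have hk : coeffK κ z = 0 := by simpa using congrArg (fun q => q.2.1) this
  rw [hk, Finsupp.single_zero]
  exact Submodule.zero_mem _

theorem aff_admits (c : ℂ) (hc : c ≠ 0) :
    AdmitsCartanDatum (Affinization κ) (c • cartanG3Aff1) parityG3Aff := by
  refine ⟨(Fin 3 → ℂ) × ℂ × ℂ, inferInstance, inferInstance, affDatum c hc, affDatum_cartan c hc,
    rfl, ?_, ⟨?_⟩⟩
  · rw [rank_cartan c hc]
    simp
  · refine ((affRealization c hc).isoOfKer (aff_generates c hc)
      ((affRealization c hc).ker_lift (aff_generates c hc) (aff_ι_injective c hc)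
        (ρ := (∑ j, coweight j, 0, 8)) (fun x => ?_) (aff_ideal_eq_bot c hc))).symm
    -- The value `8` at `d` compensates `-θ(∑ j, coweight j) = -7`.
    show affB x (∑ j, coweight j) + affDeg x * 8 = 1
    simp only [Fin.sum_univ_three]
    fin_cases x <;> simp [affB, affDeg, b_coweight]
    norm_num

end G3Model

/-! ### The untwisting isomorphism -/

theorem Loop.deriv_apply_zero {L : Type*} [AddCommGroup L] [Module ℂ L] (f : ℤ →₀ L) :
    Loop.deriv f 0 = 0 := by
  induction f using Loop.induct' with
  | zero => simp
  | add f g hf hg => rw [map_add, Finsupp.add_apply, hf, hg, add_zero]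
  | single m x => by_cases h : m = 0 <;> simp [h]

/-- A homogeneous basis of a Lie superalgebra consisting of eigenvectors with integer eigenvalues of
`ad h` for an even element `h`. -/
structure IntegralBasis (I L : Type*) [AddCommGroup L] [Module ℂ L] [LieSuperalgebra L] where
  basis : Module.Basis I ℂ L
  deg : I → ℤ
  h : L
  h_mem : h ∈ homog par 0
  br_h : ∀ k, br h (basis k) = (deg k : ℂ) • basis k
  parity : I → ZMod 2
  mem : ∀ k, basis k ∈ homog par (parity k)

namespace IntegralBasis

variable {I L : Type*} [AddCommGroup L] [Module ℂ L] [LieSuperalgebra L]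
  (G : IntegralBasis I L)

theorem repr_br_h (x : L) (k : I) : G.basis.repr (br G.h x) k = G.deg k * G.basis.repr x k := by
  have : Finsupp.lapply k ∘ₗ G.basis.repr.toLinearMap ∘ₗ br G.h =
      (G.deg k : ℂ) • (Finsupp.lapply k ∘ₗ G.basis.repr.toLinearMap) := by
    refine G.basis.ext fun l => ?_
    by_cases hl : l = k
    · subst hl; simp [G.br_h]
    · simp [G.br_h, hl]
  exact LinearMap.congr_fun this x

theorem br_h_h : br G.h G.h = 0 := by
  have := skew _ _ _ _ G.h_mem G.h_mem
  simp only [ksgn, mul_zero, ZMod.val_zero, pow_zero, one_smul] at this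
  have h2 : (2 : ℂ) • br G.h G.h = 0 := by
    rw [two_smul]
    nth_rewrite 1 [this]
    exact neg_add_cancel _
  exact (smul_eq_zero.1 h2).resolve_left two_ne_zero

theorem br_h_right (x : L) : br x G.h = -br G.h x := by
  obtain ⟨x0, h0, x1, h1, rfl⟩ := exists_homog x
  rw [map_add, map_add, LinearMap.add_apply, skew _ _ _ _ h0 G.h_mem, skew _ _ _ _ h1 G.h_mem]
  simp [ksgn]
  abel

theorem br_h_br (i j : I) : br G.h (br (G.basis i) (G.basis j)) =
    ((G.deg i + G.deg j : ℤ) : ℂ) • br (G.basis i) (G.basis j) := by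
  rw [jacobi_even G.h_mem (G.mem i), G.br_h, G.br_h, map_smul, map_smul, LinearMap.smul_apply]
  push_cast
  module

theorem loop_ext {V : Type*} [AddCommGroup V] [Module ℂ V] {F F' : (ℤ →₀ L) →ₗ[ℂ] V}
    (h : ∀ m k, F (Finsupp.single m (G.basis k)) = F' (Finsupp.single m (G.basis k))) : F = F' :=
  Finsupp.lhom_ext' fun m => G.basis.ext fun k => h m k

/-- The map `x t^m ↦ x t^(2m + n)`, for `[h, x] = n x`. It is a homomorphism of loop
superalgebras. -/
def spread : (ℤ →₀ L) →ₗ[ℂ] (ℤ →₀ L) :=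
  Finsupp.lsum ℂ fun m => G.basis.constr ℂ fun k => Finsupp.single (2 * m + G.deg k) (G.basis k)

theorem spread_basis (m : ℤ) (k : I) : G.spread (Finsupp.single m (G.basis k)) =
    Finsupp.single (2 * m + G.deg k) (G.basis k) := by
  simp [spread]

theorem spread_single {n : ℤ} {x : L} (hx : br G.h x = (n : ℂ) • x) (m : ℤ) :
    G.spread (Finsupp.single m x) = Finsupp.single (2 * m + n) x := by
  have hc : ∀ k, G.basis.repr x k ≠ 0 → G.deg k = n := by
    intro k hk
    have := G.repr_br_h x k
    rw [hx, map_smul, Finsupp.smul_apply, smul_eq_mul] at this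
    exact_mod_cast (mul_right_cancel₀ hk this).symm
  have hs : x = ∑ k ∈ (G.basis.repr x).support, G.basis.repr x k • G.basis k :=
    (G.basis.linearCombination_repr x).symm
  have e : ∀ F F' : L →ₗ[ℂ] (ℤ →₀ L), (∀ k, G.deg k = n → F (G.basis k) = F' (G.basis k)) →
      F x = F' x := by
    intro F F' h
    rw [hs, map_sum, map_sum]
    refine Finset.sum_congr rfl fun k hk => ?_
    rw [map_smul, map_smul, h k (hc k (Finsupp.mem_support_iff.1 hk))]
  refine e (G.spread ∘ₗ Finsupp.lsingle m) (Finsupp.lsingle (2 * m + n)) fun k hk => ?_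
  simp [spread_basis, hk]

theorem spread_bracket (f g : ℤ →₀ L) :
    G.spread (Loop.bracket f g) = Loop.bracket (G.spread f) (G.spread g) := by
  have : Loop.bracket.compr₂ G.spread = Loop.bracket.compl₁₂ G.spread G.spread := by
    refine G.loop_ext fun m i => G.loop_ext fun n j => ?_
    simp only [LinearMap.compr₂_apply, LinearMap.compl₁₂_apply, Loop.bracket_single, spread_basis]
    rw [G.spread_single (G.br_h_br i j)]
    congr 1
    ring
  exact LinearMap.congr_fun₂ this f g

theorem deriv_spread (f : ℤ →₀ L) : Loop.deriv (G.spread f) =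
    (2 : ℂ) • G.spread (Loop.deriv f) + Loop.bracket (Finsupp.single 0 G.h) (G.spread f) := by
  have : Loop.deriv ∘ₗ G.spread = (2 : ℂ) • (G.spread ∘ₗ Loop.deriv) +
      Loop.bracket (Finsupp.single 0 G.h) ∘ₗ G.spread := by
    refine G.loop_ext fun m i => ?_
    simp only [LinearMap.comp_apply, LinearMap.add_apply, LinearMap.smul_apply, spread_basis,
      Loop.deriv_single, map_smul, Loop.bracket_single, zero_add, G.br_h, ← Finsupp.smul_single]
    push_cast
    module
  exact LinearMap.congr_fun this f

theorem bracket_h (f : ℤ →₀ L) : Loop.bracket f (Finsupp.single 0 G.h) =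
    -Loop.bracket (Finsupp.single 0 G.h) f := by
  induction f using Loop.induct' with
  | zero => simp
  | add f g hf hg => rw [map_add, map_add, LinearMap.add_apply, hf, hg]; abel
  | single m x => simp [G.br_h_right]

variable (B : InvariantForm L)

theorem form_eq_zero (i j : I) (h : G.deg i + G.deg j ≠ 0) :
    B.form (G.basis i) (G.basis j) = 0 := by
  have h1 := B.invariant (G.basis i) G.h (G.basis j)
  rw [G.br_h_right, G.br_h, G.br_h, map_neg, map_smul, map_smul, LinearMap.neg_apply,
    LinearMap.smul_apply, smul_eq_mul, smul_eq_mul] at h1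
  have h2 : ((G.deg i + G.deg j : ℤ) : ℂ) * B.form (G.basis i) (G.basis j) = 0 := by
    push_cast
    linear_combination -h1
  exact (mul_eq_zero.1 h2).resolve_left (Int.cast_ne_zero.2 h)

theorem form_h_br (i j : I) : B.form G.h (br (G.basis i) (G.basis j)) =
    G.deg i * B.form (G.basis i) (G.basis j) := by
  rw [← B.invariant, G.br_h, map_smul, LinearMap.smul_apply, smul_eq_mul]

theorem cocycle_spread (f g : ℤ →₀ L) : Loop.cocycle B (G.spread f) (G.spread g) =
    2 * Loop.cocycle B f g + B.form G.h (Loop.bracket f g 0) := by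
  have : (Loop.cocycle B).compl₁₂ G.spread G.spread = (2 : ℂ) • Loop.cocycle B +
      Loop.bracket.compr₂ (B.form G.h ∘ₗ Finsupp.lapply 0) := by
    refine G.loop_ext fun m i => G.loop_ext fun n j => ?_
    simp only [LinearMap.compr₂_apply, LinearMap.compl₁₂_apply, LinearMap.add_apply,
      LinearMap.smul_apply, LinearMap.comp_apply, Finsupp.lapply_apply, Loop.bracket_single,
      spread_basis, Loop.cocycle_single, smul_eq_mul]
    by_cases h0 : G.deg i + G.deg j = 0
    · by_cases hmn : m + n = 0
      · rw [if_pos (by linarith), if_pos hmn, hmn, Finsupp.single_eq_same, form_h_br]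
        push_cast
        ring
      · rw [if_neg (by intro h; apply hmn; linarith), if_neg hmn,
          Finsupp.single_eq_of_ne (Ne.symm hmn)]
        simp
    · rw [G.form_eq_zero B i j h0]
      by_cases hmn : m + n = 0
      · rw [hmn, Finsupp.single_eq_same, form_h_br, G.form_eq_zero B i j h0]
        simp
      · rw [Finsupp.single_eq_of_ne (Ne.symm hmn)]
        simp
  exact LinearMap.congr_fun₂ this f g

theorem cocycle_h_left (f : ℤ →₀ L) : Loop.cocycle B (Finsupp.single 0 G.h) f = 0 := by
  induction f using Loop.induct' with
  | zero => simp
  | add f g hf hg => rw [map_add, hf, hg, add_zero]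
  | single m x => simp

theorem cocycle_h_right (f : ℤ →₀ L) : Loop.cocycle B f (Finsupp.single 0 G.h) = 0 := by
  induction f using Loop.induct' with
  | zero => simp
  | add f g hf hg => rw [map_add, LinearMap.add_apply, hf, hg, add_zero]
  | single m x =>
    rw [Loop.cocycle_single]
    split_ifs with h
    · rw [add_zero] at h; simp [h]
    · rfl

theorem repr_spread (f : ℤ →₀ L) (m : ℤ) (k : I) :
    G.basis.repr (G.spread f (2 * m + G.deg k)) k = G.basis.repr (f m) k := by
  have : Finsupp.lapply k ∘ₗ G.basis.repr.toLinearMap ∘ₗ Finsupp.lapply (2 * m + G.deg k) ∘ₗ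
      G.spread = Finsupp.lapply k ∘ₗ G.basis.repr.toLinearMap ∘ₗ
        (Finsupp.lapply m : (ℤ →₀ L) →ₗ[ℂ] L) := by
    refine G.loop_ext fun n l => ?_
    simp only [LinearMap.comp_apply, spread_basis, Finsupp.lapply_apply, LinearEquiv.coe_coe]
    by_cases hl : l = k
    · subst hl
      by_cases hn : n = m
      · subst hn; simp
      · rw [Finsupp.single_eq_of_ne (by intro h; apply hn; linarith),
          Finsupp.single_eq_of_ne (Ne.symm hn)]
    · have h0 : ∀ (a c : ℤ), G.basis.repr (Finsupp.single a (G.basis l) c) k = 0 := by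
        intro a c
        by_cases h : c = a
        · subst h; simp [hl]
        · rw [Finsupp.single_eq_of_ne h]; simp
      rw [h0, h0]
  exact LinearMap.congr_fun this f

theorem spread_injective : Function.Injective G.spread := by
  intro f g h
  ext1 m
  apply G.basis.repr.injective
  ext k
  rw [← G.repr_spread f, h, G.repr_spread g]

theorem parity_spread (f : ℤ →₀ L) : G.spread (Loop.parity f) = Loop.parity (G.spread f) := by
  have : G.spread ∘ₗ Loop.parity = Loop.parity ∘ₗ G.spread := by
    refine G.loop_ext fun m k => ?_
    simp only [LinearMap.comp_apply, Loop.parity_single, spread_basis, mem_homog.1 (G.mem k),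
      ← Finsupp.smul_single, map_smul]
  exact LinearMap.congr_fun this f

/-- The map `x t^m ↦ x t^(2m + n) + δ_{m,0} B(h, x) K`, `K ↦ 2 K`, `d ↦ (d - h) / 2`, for
`[h, x] = n x`. -/
def untwist : Affinization B →ₗ[ℂ] Affinization B where
  toFun z := Affinization.mk B
    (G.spread (Affinization.loop B z) - (Affinization.coeffD B z / 2) • Finsupp.single 0 G.h)
    (2 * Affinization.coeffK B z + B.form G.h (Affinization.loop B z 0))
    (Affinization.coeffD B z / 2)
  map_add' x y := by
    apply Affinization.ext
    · simp only [Affinization.loop_mk, map_add]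
      module
    · simp; ring
    · simp; ring
  map_smul' c x := by
    apply Affinization.ext
    · simp only [Affinization.loop_mk, map_smul, RingHom.id_apply, smul_eq_mul]
      module
    · simp; ring
    · simp; ring

theorem loop_untwist (z : Affinization B) : Affinization.loop B (G.untwist B z) =
    G.spread (Affinization.loop B z) - (Affinization.coeffD B z / 2) • Finsupp.single 0 G.h := rfl

theorem coeffK_untwist (z : Affinization B) : Affinization.coeffK B (G.untwist B z) =
    2 * Affinization.coeffK B z + B.form G.h (Affinization.loop B z 0) := rfl

theorem coeffD_untwist (z : Affinization B) :
    Affinization.coeffD B (G.untwist B z) = Affinization.coeffD B z / 2 := rfl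

theorem untwist_br (x y : Affinization B) :
    G.untwist B (br x y) = br (G.untwist B x) (G.untwist B y) := by
  apply Affinization.ext
  · show Affinization.loop B (G.untwist B (Affinization.bracket B x y)) =
      Affinization.loop B (Affinization.bracket B _ _)
    have hx := G.bracket_h (G.spread (Affinization.loop B x))
    simp only [loop_untwist, Affinization.loop_bracket, Affinization.coeffD_bracket, coeffD_untwist,
      map_add, map_sub, map_smul, LinearMap.sub_apply, LinearMap.smul_apply, spread_bracket,
      deriv_spread, hx, Loop.deriv_single, Loop.bracket_single, br_h_h, Int.cast_zero,
      zero_smul, Finsupp.single_zero]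
    module
  · show Affinization.coeffK B (G.untwist B (Affinization.bracket B x y)) =
      Affinization.coeffK B (Affinization.bracket B _ _)
    simp only [coeffK_untwist, Affinization.coeffK_bracket, Affinization.loop_bracket, loop_untwist,
      map_sub, map_smul, LinearMap.sub_apply, LinearMap.smul_apply, cocycle_h_left,
      cocycle_h_right, cocycle_spread, Finsupp.sub_apply, Finsupp.add_apply, Finsupp.smul_apply,
      Loop.deriv_apply_zero]
    simp
  · show Affinization.coeffD B (Affinization.bracket B x y) / 2 = 0
    simp

theorem untwist_par (x : Affinization B) : G.untwist B (par x) = par (G.untwist B x) := by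
  show G.untwist B (Affinization.parity B x) = Affinization.parity B (G.untwist B x)
  have hh : par G.h = G.h := by simpa using mem_homog.1 G.h_mem
  apply Affinization.ext
  · simp only [loop_untwist, Affinization.loop_parity, Affinization.coeffD_parity, parity_spread,
      map_sub, map_smul, Loop.parity_single, hh]
  · have e : ∀ y, B.form G.h (par y) = B.form G.h y := fun y => by
      rw [← B.even G.h y, hh]
    simp only [coeffK_untwist, Affinization.loop_parity, Affinization.coeffK_parity]
    exact congrArg (2 * Affinization.coeffK B x + ·) (e _)
  · rfl

theorem untwist_injective : Function.Injective (G.untwist B) := by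
  intro x y h
  have hD := congrArg (Affinization.coeffD B) h
  rw [coeffD_untwist, coeffD_untwist, div_left_inj' two_ne_zero] at hD
  have hl := congrArg (Affinization.loop B) h
  rw [loop_untwist, loop_untwist, hD, sub_left_inj] at hl
  have hl' := G.spread_injective hl
  have hK := congrArg (Affinization.coeffK B) h
  rw [coeffK_untwist, coeffK_untwist, hl'] at hK
  exact Affinization.ext hl' (by linear_combination (1 / 2 : ℂ) * hK) hD

section Twisted

variable (σ : Iso L L)

theorem exp_two : Complex.exp (2 * Real.pi * Complex.I / (2 : ℕ)) = -1 := by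
  rw [← Complex.exp_pi_mul_I]
  congr 1
  push_cast
  ring

/-- The twisted loop superalgebra is the image of the loop superalgebra: if `b k t^j` occurs in a
twisted loop, then `j` and the degree of `b k` have the same parity. -/
theorem mem_range_spread (hσ : ∀ k, σ.toEquiv (G.basis k) = ((-1 : ℂ) ^ G.deg k) • G.basis k)
    {g : ℤ →₀ L} (hg : ∀ j, σ.toEquiv (g j) = (-1 : ℂ) ^ j • g j) :
    g ∈ LinearMap.range G.spread := by
  have hr : ∀ x k, G.basis.repr (σ.toEquiv x) k = (-1 : ℂ) ^ G.deg k * G.basis.repr x k := by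
    intro x k
    have : Finsupp.lapply k ∘ₗ G.basis.repr.toLinearMap ∘ₗ σ.toEquiv.toLinearMap =
        ((-1 : ℂ) ^ G.deg k) • (Finsupp.lapply k ∘ₗ G.basis.repr.toLinearMap) := by
      refine G.basis.ext fun l => ?_
      by_cases hl : l = k
      · subst hl; simp [hσ]
      · simp [hσ, hl]
    exact LinearMap.congr_fun this x
  rw [← Finsupp.sum_single g]
  refine Submodule.sum_mem _ fun j _ => ?_
  rw [← G.basis.linearCombination_repr (g j), Finsupp.linearCombination_apply, Finsupp.sum,
    Finsupp.single_finsetSum]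
  refine Submodule.sum_mem _ fun k hk => ?_
  rw [← Finsupp.smul_single]
  refine Submodule.smul_mem _ _ ?_
  have h1 := hr (g j) k
  rw [hg j, map_smul, Finsupp.smul_apply, smul_eq_mul] at h1
  have h2 : (-1 : ℂ) ^ j = (-1) ^ G.deg k := mul_right_cancel₀ (Finsupp.mem_support_iff.1 hk) h1
  have h3 : Even (j - G.deg k) := by
    have h4 : (-1 : ℂ) ^ (j - G.deg k) = 1 := by
      rw [zpow_sub₀ (by norm_num), h2, div_self (zpow_ne_zero _ (by norm_num))]
    by_contra ho
    rw [Int.not_even_iff_odd] at ho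
    rw [ho.neg_one_zpow] at h4
    norm_num at h4
  obtain ⟨m, hm⟩ := h3
  refine ⟨Finsupp.single m (G.basis k), ?_⟩
  rw [spread_basis]
  congr 1
  linarith

theorem spread_mem (hσ : ∀ k, σ.toEquiv (G.basis k) = ((-1 : ℂ) ^ G.deg k) • G.basis k)
    (f : ℤ →₀ L) (j : ℤ) : σ.toEquiv (G.spread f j) = (-1 : ℂ) ^ j • G.spread f j := by
  have : σ.toEquiv.toLinearMap ∘ₗ Finsupp.lapply j ∘ₗ G.spread =
      ((-1 : ℂ) ^ j) • (Finsupp.lapply j ∘ₗ G.spread) := by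
    refine G.loop_ext fun m k => ?_
    simp only [LinearMap.comp_apply, LinearMap.smul_apply, spread_basis, Finsupp.lapply_apply,
      LinearEquiv.coe_coe]
    by_cases h : j = 2 * m + G.deg k
    · subst h
      rw [Finsupp.single_eq_same, hσ, zpow_add₀ (by norm_num), zpow_mul]
      simp
    · rw [Finsupp.single_eq_of_ne h]; simp
  exact LinearMap.congr_fun this f

theorem sigma_h (hσ : ∀ k, σ.toEquiv (G.basis k) = ((-1 : ℂ) ^ G.deg k) • G.basis k) :
    σ.toEquiv G.h = G.h := by
  have h0 := G.spread_mem σ hσ (Finsupp.single 0 G.h) 0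
  rw [G.spread_single (n := 0) (by rw [br_h_h]; simp)] at h0
  simpa using h0

theorem untwist_mem (hσ : ∀ k, σ.toEquiv (G.basis k) = ((-1 : ℂ) ^ G.deg k) • G.basis k)
    (z : Affinization B) : G.untwist B z ∈ (twistedAffinization B σ 2).carrier := by
  intro j
  rw [exp_two, loop_untwist, Finsupp.sub_apply, Finsupp.smul_apply, map_sub, map_smul,
    G.spread_mem σ hσ, smul_sub]
  congr 1
  by_cases hj : j = 0
  · subst hj; simp [G.sigma_h σ hσ]
  · rw [Finsupp.single_eq_of_ne hj]; simp

theorem untwist_surjective (hσ : ∀ k, σ.toEquiv (G.basis k) = ((-1 : ℂ) ^ G.deg k) • G.basis k)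
    {z : Affinization B} (hz : z ∈ (twistedAffinization B σ 2).carrier) :
    ∃ y, G.untwist B y = z := by
  obtain ⟨f, hf⟩ := G.mem_range_spread σ hσ (g := Affinization.loop B z) fun j => by
    have := hz j
    rwa [exp_two] at this
  have hh : G.spread (Finsupp.single 0 G.h) = Finsupp.single 0 G.h := by
    rw [G.spread_single (n := 0) (by rw [br_h_h]; simp)]
    simp
  let s := Affinization.coeffD B z
  let f' : ℤ →₀ L := f + s • Finsupp.single 0 G.h
  refine ⟨Affinization.mk B f' ((Affinization.coeffK B z - B.form G.h (f' 0)) / 2) (2 * s), ?_⟩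
  apply Affinization.ext
  · rw [loop_untwist, Affinization.loop_mk, Affinization.coeffD_mk, map_add, map_smul, hf, hh]
    module
  · rw [coeffK_untwist, Affinization.loop_mk, Affinization.coeffK_mk]
    ring
  · rw [coeffD_untwist, Affinization.coeffD_mk]
    exact mul_div_cancel_left₀ s two_ne_zero

/-- The isomorphism of the affinization with the twisted affinization for `σ = (-1) ^ (ad h)`. -/
def untwistIso (hσ : ∀ k, σ.toEquiv (G.basis k) = ((-1 : ℂ) ^ G.deg k) • G.basis k) :
    Iso (Affinization B) (twistedAffinization B σ 2).carrier where
  toEquiv := LinearEquiv.ofBijective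
    ((G.untwist B).codRestrict _ (G.untwist_mem B σ hσ))
    ⟨fun x y h => G.untwist_injective B (congrArg Subtype.val h), fun z => by
      obtain ⟨y, hy⟩ := G.untwist_surjective B σ hσ z.2
      exact ⟨y, Subtype.ext hy⟩⟩
  map_par x := Subtype.ext (G.untwist_par B x)
  map_br x y := Subtype.ext (G.untwist_br B x y)

end Twisted

end IntegralBasis

namespace G3Model

/-- The basis of `G(3)` that corresponds to the basis of the model, with the grading by the
coefficient of the first simple root. -/
def integralBasis : IntegralBasis (Fin 31) G3 where
  basis := b.map isoG3.toEquiv.symm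
  deg := wt 0
  h := isoG3.toEquiv.symm (w 0)
  h_mem := isoG3.symm.map_mem (w_mem 0)
  br_h k := by
    have := isoG3.symm.map_br (w 0) (b k)
    rw [br_w_b, map_smul] at this
    exact this.symm
  parity := p
  mem k := isoG3.symm.map_mem (b_mem k)

theorem sigmaG3_mkQ (x : HalfBaked datumG3) :
    sigmaG3.toEquiv ((maxIdeal datumG3).carrier.mkQ x) =
      (maxIdeal datumG3).carrier.mkQ (HalfBaked.scale datumG3
        (fun x => Complex.exp (datumG3.b x hG3)) (fun x => Complex.exp (-datumG3.b x hG3))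
        (fun x => by rw [← Complex.exp_add]; simp) x) := rfl

theorem isoG3_symm (x : HalfBaked datumG3) :
    isoG3.toEquiv.symm (realization.lift x) = (maxIdeal datumG3).carrier.mkQ x := by
  rw [LinearEquiv.symm_apply_eq]
  rfl

/-- The automorphism `σ` is `(-1) ^ (ad h₀)`, where `h₀` is the first fundamental coweight. -/
theorem sigmaG3_b (k : Fin 31) : sigmaG3.toEquiv (integralBasis.basis k) =
    ((-1 : ℂ) ^ integralBasis.deg k) • integralBasis.basis k := by
  have hb : ∀ k, integralBasis.basis k = isoG3.toEquiv.symm (b k) := fun k =>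
    Module.Basis.map_apply _ _ _
  have hexp : ∀ x : Fin 3, Complex.exp (datumG3.b x hG3) = (-1) ^ wt 0 (eIdx x) ∧
      Complex.exp (-datumG3.b x hG3) = (-1) ^ wt 0 (fIdx x) := by
    obtain ⟨h0, h1, h2⟩ := hG3_spec
    intro x
    rw [wt_e, wt_f]
    fin_cases x
    · simp [h0, Complex.exp_neg]
    · simp [h1]
    · simp [h2]
  show sigmaG3.toEquiv (integralBasis.basis k) = ((-1 : ℂ) ^ wt 0 k) • integralBasis.basis k
  rw [hb]
  induction k using WellFoundedLT.induction with
  | ind k ih =>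
    rcases lt_or_ge k 3 with h | h
    · obtain ⟨j, rfl⟩ : ∃ j : Fin 3, k = Fin.castLE (by norm_num) j := ⟨⟨k, h⟩, rfl⟩
      rw [wt_w, zpow_zero, one_smul, ← w, ← ι_coweight, ← show _ = ι (coweight j) from
        realization.lift_ι (coweight j), isoG3_symm, sigmaG3_mkQ]
      congr 1
      exact HalfBaked.scale_genH _ _ _ _ _
    · rcases brVec_gen k h with ⟨x, rfl⟩ | ⟨x, rfl⟩ | ⟨i, j, hi, hj, hT, h0, hdeg⟩
      · rw [← show _ = b (eIdx x) from realization.lift_e x, isoG3_symm, sigmaG3_mkQ, ← map_smul]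
        congr 1
        show HalfBaked.mk datumG3 (genScale _ _ _ (genE x)) = _
        simp only [genScale, FreeNonUnitalNonAssocAlgebra.lift_of_apply, (hexp x).1, map_smul]
        rfl
      · have e : b (fIdx x) = (2 : ℂ) • realization.lift ((HalfBaked.realization _).f x) := by
          rw [realization.lift_f]
          show _ = (2 : ℂ) • (1 / 2 : ℂ) • b (fIdx x)
          rw [smul_smul]
          norm_num
        rw [e, map_smul, map_smul, isoG3_symm, sigmaG3_mkQ, smul_comm _ (2 : ℂ),
          ← map_smul _ (_ ^ _)]
        congr 2
        show HalfBaked.mk datumG3 (genScale _ _ _ (genF x)) = _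
        simp only [genScale, FreeNonUnitalNonAssocAlgebra.lift_of_apply, (hexp x).2, map_smul]
        rfl
      · have e : b k = ((coef (brVec i j) k : ℂ))⁻¹ • br (b i) (b j) := by
          rw [br_b, hT]
          simp only [vec, bN_coe, add_zero]
          rw [← hT, inv_smul_smul₀ (Int.cast_ne_zero.2 h0)]
        have e2 : isoG3.toEquiv.symm (br (b i) (b j)) =
          br (isoG3.toEquiv.symm (b i)) (isoG3.toEquiv.symm (b j)) := isoG3.symm.map_br _ _
        rw [e, map_smul, map_smul, e2, sigmaG3.map_br, ih i hi, ih j hj, map_smul, map_smul,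
          LinearMap.smul_apply, hdeg, zpow_add₀ (by norm_num)]
        simp only [smul_smul]
        congr 1
        ring

end G3Model

end

theorem mainTheorem11 :
    Nonempty (LieSuperalgebra.Iso G3Aff1 G3Aff2) ∧
    AdmitsCartanDatum G3Aff1 cartanG3Aff1 parityG3Aff ∧
    AdmitsCartanDatum G3Aff2 cartanG3Aff2 parityG3Aff ∧
    cartanG3Aff2 = (2 : ℂ) • cartanG3Aff1 ∧
    DEquivalent cartanG3Aff2 parityG3Aff cartanG3Aff1 parityG3Aff := by
  have hA : cartanG3Aff2 = (2 : ℂ) • cartanG3Aff1 := by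
    ext i j
    fin_cases i <;> fin_cases j <;> simp [cartanG3Aff1, cartanG3Aff2] <;> norm_num
  have φ : LieSuperalgebra.Iso G3Aff1 G3Aff2 :=
    G3Model.integralBasis.untwistIso (killing G3) sigmaG3 G3Model.sigmaG3_b
  have ψ : LieSuperalgebra.Iso G3Aff1 (Affinization (killing G3Model)) :=
    G3Model.isoG3.affinization
  refine ⟨⟨φ⟩, ?_, ?_, hA, rfl, fun _ => 2, fun _ => two_ne_zero, ?_⟩
  · rw [← one_smul ℂ cartanG3Aff1]
    exact (G3Model.aff_admits 1 one_ne_zero).of_iso ψ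
  · rw [hA]
    exact (G3Model.aff_admits 2 two_ne_zero).of_iso (φ.symm.trans ψ)
  · rw [hA]
    ext i j
    simp [Matrix.diagonal_mul]
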